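/- \textbf{Theorem (Degenerations).} Let $x=(x_1,\dots,x_n)$ and $y=(y_1,\dots,y_n)$ be variables and let $a=(a_i)_{i\in\mathbb Z}$, $b=(b_i)_{i\in\mathbb Z}$ be sequences of parameters, all of them elements of a field $K$ (for instance, independent indeterminates in a field of rational functions, or complex numbers). Write $a'=(-a_{-i+1})_{i\in\mathbb Z}$, so that $(-a')_i=a_{1-i}$, and $(\tau^r a)_i=a_{i+r}$. \emph{Free fermionic Schur functions.} Consider one row of the six vertex model with column $k$ carrying the parameters $(a_k,b_k)$. Paths go right and down. A vertex with parameters $(x,y;a,b)$ has weight $1-bx$ if all four edges are empty, $y+a$ if all four are occupied, $1+by$ if exactly the top and bottom edges are occupied, $x-a$ if exactly the left and right ones are, $1-ab$ if exactly the top and right ones are, $x+y$ if exactly the left and bottom ones are, and $0$ otherwise. For Maya diagrams $v,w$ (subsets of $\mathbb Z$ containing all $k\ll 0$ and no $k\gg 0$) let $\langle v|\mathcal A_{a,b}(x,y)|w\rangle$ be the partition function of the row with columns $-N+1,\dots,M$, top edges $v$, bottom edges $w$ and empty left and right boundary edges, divided by $\prod_{i=1}^{N}(1+b_{1-i}y)\prod_{i=1}^{M}(1-b_ix)$;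 this is constant for large $N,M$. A charged partition $(\lambda;c)$ has the Maya diagram $\{\lambda_i-i+1+c: i\ge1\}$. For partitions $\mu\subseteq\lambda$, both taken with charge $0$, put \[ s_{\lambda/\mu;a,b}(x/y)=\langle\mu|\mathcal A_{a,b}(x_1,y_1)\cdots\mathcal A_{a,b}(x_n,y_n)|\lambda\rangle ,\qquad s_{\lambda;a,b}=s_{\lambda/\emptyset;a,b}. \] \emph{Functions from the literature.} Let $c(\alpha)=j-i$ be the content of a box $\alpha=(i,j)$. A supertableau of shape $\lambda/\mu$ over an ordered alphabet, some of whose letters are primed, has weakly increasing rows and columns, each primed letter at most once in each row and each unprimed letter at most once in each column. \begin{itemize} \item $s_{\lambda/\mu}(x)=\sum_T\prod_{\alpha}x_{T(\alpha)}$ over semistandard tableaux with entries in $\{1,\dots,n\}$ (classical). \item $s_{\lambda/\mu}(x/y)$ is the sum over supertableaux with letters $1<\dots<n<1'<\dots<n'$, where $i$ contributes $x_i$ and $i'$ contributes $y_i$ (supersymmetric, Berele--Regev). \item $s_{\lambda/\mu}(x/y\,||\,a)$ is the sum over supertableaux with letters $1'<1<2'<2<\dots<n'<n$, where $i$ in the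 box $\alpha$ contributes $x_i-a_{-c(\alpha)+1}$ and $i'$ contributes $y_i+a_{-c(\alpha)+1}$ (Molev's factorial supersymmetric). \item $s_{\lambda/\mu}(x\,||\,a)$ is the sum over the same supertableaux, where $i$ contributes $x_i-a_{-c(\alpha)+1}$ and $i'$ contributes $a_{-c(\alpha)+1}-a_i$ (skew double). For distinct $x_1,\dots,x_n$, \[ s_\lambda(x\,||\,a)=\frac{\det\big((x_i||a)^{\lambda_j+n-j}\big)_{1\le i,j\le n}}{\det\big((x_i||a)^{n-j}\big)_{1\le i,j\le n}},\qquad (x||a)^r=(x-a_n)(x-a_{n-1})\cdots(x-a_{n-r+1}), \] if $\lambda$ has at most $n$ rows, and $s_\lambda(x\,||\,a)=0$ otherwise (factorial/double). \item $s_{\lambda/\mu;a}(x,y)=\det\big(h_{\lambda_i-\mu_j-i+j;\tau^{\mu_j-j+1}a}\big)_{1\le i,j\le\ell(\lambda)}$, where $h_{0;a}=1$, $h_{k;a}=0$ for $k<0$, and $1+\sum_{k\ge1}\frac{h_{k;a}}{(u-a_1)\cdots(u-a_k)}=\prod_i\frac{u+y_i}{u-x_i}$ as series in $u^{-1}$ (Frobenius--Schur).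 \item $\widehat s_{\lambda/\mu}(x\,||\,a)=\sum_T\prod_\alpha X_{T(\alpha)}(a_{-c(\alpha)+1},a_{-c(\alpha)})$ over fillings with entries in $\{1,\dots,n\}$ whose rows weakly decrease and whose columns strictly decrease, where $X_i(g,h)=\dfrac{x_i\prod_{j<i}(1-gx_j)}{\prod_{j\le i}(1-hx_j)}$ (Molev's dual). For distinct $x_1,\dots,x_n$, $\widehat s_\lambda(x\,||\,a)=\det\big(\phi_{\lambda_j+n-j}(x_i)\big)/\det\big(\phi_{n-j}(x_i)\big)$ with \[ \phi_r(x)=\frac{x^r\prod_{k=1-r}^{n-r-1}(1-a_kx)}{\prod_{i=0}^{r-1}(1-a_{-i}x)} \] if $\lambda$ has at most $n$ rows, and $\widehat s_\lambda(x\,||\,a)=0$ otherwise. \end{itemize} \emph{Statement.} For all partitions $\mu\subseteq\lambda$: \begin{enumerate} \item $s_{\lambda/\mu;0,0}(x/0)=s_{\lambda/\mu}(x)$ (classical Schur functions); \item $s_{\lambda/\mu;0,0}(x/y)=s_{\lambda/\mu}(x/y)$ (supersymmetric Schur functions); \item $s_{\lambda/\mu;a,0}(x/a')=s_{\lambda/\mu}(x\,||\,{-a'})$,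 where $x/a'$ means $y_i=a'_i$ for $1\le i\le n$, and, for distinct $x_i$, $s_{\lambda;a,0}(x/a')$ equals the ratio of determinants for $s_\lambda(x\,||\,{-a'})$ (factorial, or double, Schur functions); \item $s_{\lambda/\mu;a,0}(x/y)=s_{\lambda/\mu}(x/y\,||\,{-a'})$ (Molev's factorial supersymmetric Schur functions); \item $s_{\lambda/\mu;a,0}(x/y)=s_{\lambda/\mu;a}(x,y)$ (Olshanski--Regev--Vershik Frobenius--Schur functions); \item if $1-b_kx_i\ne0$ for all $k$ and $i$, then $s_{\lambda/\mu;0,b}(x/0)=s_{\mu/\mu;0,b}(x/0)\,\widehat s_{\lambda/\mu}(x\,||\,{-b'})$ and, for distinct $x_i$, $s_{\lambda;0,b}(x/0)$ equals the ratio of determinants for $\widehat s_\lambda(x\,||\,{-b'})$ (Molev's dual Schur functions). \end{enumerate} -/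

import Mathlib

open scoped BigOperators

namespace FreeFermionic

noncomputable section

/-! ### The six vertex model and the free fermionic Schur functions -/

/-- Weight of a vertex with row parameters `(x, y)` and column parameters `(a, b)`. The four Booleans
say whether the left, top, bottom and right edge is occupied. The six admissible types are, in the
order of the clauses, `a₁, a₂, b₁, b₂, c₁, c₂`; every other configuration has weight `0`. -/
def vertexWeight {K : Type*} [Field K] (x y a b : K) : Bool → Bool → Bool → Bool → K
  | false, false, false, false => 1 - b * x
  | true,  true,  true,  true  => y + a
  | false, true,  true,  false => 1 + b * y
  | true,  false, false, true  => x - a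
  | false, true,  false, true  => 1 - a * b
  | true,  false, true,  false => x + y
  | _, _, _, _ => 0

open Classical in
/-- Partition function of one row with columns `-n+1, …, m`, whose left and right boundary edges are
empty, whose top edges are given by `v` and whose bottom edges by `w`: the matrix coefficient
`⟨v | A(x, y; a^{n,m}, b^{n,m}) | w⟩`. A state is a choice `h` of the horizontal edges. -/
def finiteRow {K : Type*} [Field K] (a b : ℤ → K) (x y : K) (n m : ℕ) (v w : ℤ → Prop) : K :=
  ∑ h : Fin (n + m + 1) → Bool,
    if h 0 = false ∧ h (Fin.last (n + m)) = false then
      ∏ j : Fin (n + m),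
        vertexWeight x y (a ((j : ℤ) - n + 1)) (b ((j : ℤ) - n + 1))
          (h j.castSucc) (decide (v ((j : ℤ) - n + 1))) (decide (w ((j : ℤ) - n + 1))) (h j.succ)
    else 0

/-- The dual sequence `a'`, with `a'_i = -a_{-i+1}`. -/
def dualSeq {K : Type*} [Field K] (a : ℤ → K) : ℤ → K := fun i => -a (-i + 1)

/-- `(x; a)^k = (1 - a_1 x) ⋯ (1 - a_k x)`. -/
def shiftedOnePow {K : Type*} [Field K] (a : ℤ → K) (x : K) (k : ℕ) : K :=
  ∏ i ∈ Finset.range k, (1 - a ((i : ℤ) + 1) * x)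

open Classical in
/-- The value at which `f (n, m)` stabilizes as `n, m → ∞` (and `0` if it does not stabilize). -/
def stableValue {K : Type*} [Field K] (f : ℕ × ℕ → K) : K :=
  if h : ∃ c : K, ∀ᶠ p in Filter.atTop, f p = c then h.choose else 0

/-- Charged partitions `(λ; c)`. -/
abbrev ChargedPartition := YoungDiagram × ℤ

/-- The occupied columns `{λ_i - i + 1 + c : i ≥ 1}` of the Maya diagram of `(λ; c)`. Rows are
counted from `0` here, so that `λ_i` is `rowLen (i - 1)`. -/
def occupied (p : ChargedPartition) (k : ℤ) : Prop :=
  ∃ i : ℕ, k = (p.1.rowLen i : ℤ) - i + p.2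

/-- The matrix coefficient `⟨v | 𝒜_{a,b}(x, y) | w⟩` of the row transfer operator of the six vertex
model with columns indexed by all integers. -/
def rowOperator {K : Type*} [Field K] (a b : ℤ → K) (x y : K) (v w : ChargedPartition) : K :=
  stableValue fun p =>
    finiteRow a b x y p.1 p.2 (occupied v) (occupied w) /
      (shiftedOnePow (dualSeq b) y p.1 * shiftedOnePow b x p.2)

open Classical in
/-- Matrix coefficients of a product of row transfer operators. -/
def rowProduct {K : Type*} [Field K] (a b : ℤ → K) :
    List (K × K) → ChargedPartition → ChargedPartition → K
  | [], v, w => if v = w then 1 else 0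
  | r :: rs, v, w => ∑ᶠ u : ChargedPartition, rowOperator a b r.1 r.2 v u * rowProduct a b rs u w

/-- The free fermionic Schur function
`s_{λ/μ;a,b}(x/y) = ⟨μ | 𝒜_{a,b}(x₁, y₁) ⋯ 𝒜_{a,b}(x_n, y_n) | λ⟩`. -/
def ffSchur {K : Type*} [Field K] {n : ℕ} (a b : ℤ → K) (x y : Fin n → K)
    (lam mu : YoungDiagram) : K :=
  rowProduct a b (List.ofFn fun i => (x i, y i)) (mu, 0) (lam, 0)

/-! ### Tableaux of skew shape -/

/-- The boxes of `λ/μ`. -/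
abbrev SkewCell (lam mu : YoungDiagram) := {p : ℕ × ℕ // p ∈ lam.cells \ mu.cells}

/-- The content `c(α) = j - i` of the box `α = (i, j)`. -/
def content {lam mu : YoungDiagram} (p : SkewCell lam mu) : ℤ := (p.1.2 : ℤ) - p.1.1

/-- Semistandard tableaux: rows weakly increase and columns strictly increase. -/
def IsSemistandard {lam mu : YoungDiagram} {L : Type*} [LinearOrder L]
    (T : SkewCell lam mu → L) : Prop :=
  (∀ p q : SkewCell lam mu, p.1.1 = q.1.1 → p.1.2 < q.1.2 → T p ≤ T q) ∧
  (∀ p q : SkewCell lam mu, p.1.2 = q.1.2 → p.1.1 < q.1.1 → T p < T q)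

/-- Reverse tableaux: rows weakly decrease and columns strictly decrease. -/
def IsReverseTableau {lam mu : YoungDiagram} {L : Type*} [LinearOrder L]
    (T : SkewCell lam mu → L) : Prop :=
  (∀ p q : SkewCell lam mu, p.1.1 = q.1.1 → p.1.2 < q.1.2 → T q ≤ T p) ∧
  (∀ p q : SkewCell lam mu, p.1.2 = q.1.2 → p.1.1 < q.1.1 → T q < T p)

/-- Supertableaux over an ordered alphabet, some letters of which are primed: rows and columns weakly
increase, a primed letter occurs at most once in each row, and an unprimed letter occurs at most once
in each column. -/
def IsSupertableau {lam mu : YoungDiagram} {L : Type*} [LinearOrder L] (primed : L → Prop)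
    (T : SkewCell lam mu → L) : Prop :=
  (∀ p q : SkewCell lam mu, p.1.1 = q.1.1 → p.1.2 < q.1.2 →
    T p ≤ T q ∧ (T p = T q → ¬ primed (T p))) ∧
  (∀ p q : SkewCell lam mu, p.1.2 = q.1.2 → p.1.1 < q.1.1 →
    T p ≤ T q ∧ (T p = T q → primed (T p)))

/-! ### Classical and supersymmetric Schur functions -/

open Classical in
/-- The classical skew Schur function `s_{λ/μ}(x₁, …, x_n)`. -/
def schur {K : Type*} [Field K] {n : ℕ} (x : Fin n → K) (lam mu : YoungDiagram) : K :=
  ∑ T : SkewCell lam mu → Fin n with IsSemistandard T, ∏ p, x (T p)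

open Classical in
/-- The supersymmetric (hook) Schur function `s_{λ/μ}(x/y)` of Berele and Regev: the sum over the
supertableaux with letters `1 < ⋯ < m < 1' < ⋯ < n'`. -/
def superSchur {K : Type*} [Field K] {m n : ℕ} (x : Fin m → K) (y : Fin n → K)
    (lam mu : YoungDiagram) : K :=
  ∑ T : SkewCell lam mu → Fin m ⊕ₗ Fin n with
      IsSupertableau (fun t : Fin m ⊕ₗ Fin n => (ofLex t).isRight = true) T,
    ∏ p, Sum.elim x y (ofLex (T p))

/-! ### Factorial supersymmetric and double (factorial) Schur functions -/

/-- The alphabet `1' < 1 < 2' < 2 < ⋯ < n' < n`; the second component tells whether the letter is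
unprimed. -/
abbrev PrimedLetter (n : ℕ) := Fin n ×ₗ Bool

open Classical in
/-- Molev's factorial supersymmetric Schur function `s_{λ/μ}(x/y ‖ a)`: an unprimed letter `i` in the
box `α` contributes `x_i - a_{-c(α)+1}` and a primed letter `i'` contributes `y_i + a_{-c(α)+1}`. -/
def factorialSuperSchur {K : Type*} [Field K] {n : ℕ} (x y : Fin n → K) (a : ℤ → K)
    (lam mu : YoungDiagram) : K :=
  ∑ T : SkewCell lam mu → PrimedLetter n with
      IsSupertableau (fun t : PrimedLetter n => (ofLex t).2 = false) T,
    ∏ p, if (ofLex (T p)).2 = true then x (ofLex (T p)).1 - a (-content p + 1)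
      else y (ofLex (T p)).1 + a (-content p + 1)

open Classical in
/-- The skew double Schur function `s_{λ/μ}(x ‖ a)`: an unprimed letter `i` in the box `α` contributes
`x_i - a_{-c(α)+1}` and a primed letter `i'` contributes `a_{-c(α)+1} - a_i`. -/
def skewDoubleSchur {K : Type*} [Field K] {n : ℕ} (x : Fin n → K) (a : ℤ → K)
    (lam mu : YoungDiagram) : K :=
  ∑ T : SkewCell lam mu → PrimedLetter n with
      IsSupertableau (fun t : PrimedLetter n => (ofLex t).2 = false) T,
    ∏ p, if (ofLex (T p)).2 = true then x (ofLex (T p)).1 - a (-content p + 1)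
      else a (-content p + 1) - a (((ofLex (T p)).1 : ℤ) + 1)

/-- `(x ‖ a)^r = (x - a_n)(x - a_{n-1}) ⋯ (x - a_{n-r+1})`. -/
def doublePow {K : Type*} [Field K] (n : ℕ) (a : ℤ → K) (x : K) (r : ℕ) : K :=
  ∏ i ∈ Finset.range r, (x - a ((n : ℤ) - i))

/-- The double (factorial) Schur polynomial
`s_λ(x ‖ a) = det((x_i ‖ a)^{λ_j+n-j}) / det((x_i ‖ a)^{n-j})` in `n` distinct variables, which is `0`
when `λ` has more than `n` rows. -/
def doubleSchur {K : Type*} [Field K] {n : ℕ} (x : Fin n → K) (a : ℤ → K)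
    (lam : YoungDiagram) : K :=
  if lam.colLen 0 ≤ n then
    (Matrix.of fun i j : Fin n => doublePow n a (x i) (lam.rowLen j + (n - 1 - j))).det /
      (Matrix.of fun i j : Fin n => doublePow n a (x i) (n - 1 - j)).det
  else 0

/-! ### Frobenius–Schur functions -/

/-- The functions `h_{k;a}(x; y)`, defined by the expansion
`1 + ∑_{k ≥ 1} h_{k;a} / ((u - a_1) ⋯ (u - a_k)) = ∏ (u + y_i) / (u - x_i)` at `u = ∞`, and zero for
`k < 0`. For `k ≥ 1`, `h_{k;a}` is the coefficient of `u⁻¹` in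
`(u - a_1) ⋯ (u - a_{k-1}) ∏ (u + y_i) / (u - x_i)`, which is read off in the variable `X = u⁻¹`. -/
def frobeniusH {K : Type*} [Field K] {n : ℕ} (x y : Fin n → K) (a : ℤ → K) : ℤ → K
  | Int.ofNat k => PowerSeries.coeff k
      ((∏ i ∈ Finset.range (k - 1), (1 - PowerSeries.C (a ((i : ℤ) + 1)) * PowerSeries.X)) *
        (∏ i, (1 + PowerSeries.C (y i) * PowerSeries.X)) *
        (∏ i, (1 - PowerSeries.C (x i) * PowerSeries.X))⁻¹)
  | Int.negSucc _ => 0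

/-- The (multiparameter) Frobenius–Schur function
`s_{λ/μ;a}(x; y) = det(h_{λ_i-μ_j-i+j; τ^{μ_j-j+1} a})`, where `(τ^r a)_k = a_{k+r}` and `i, j` run
over the rows of `λ`. -/
def frobeniusSchur {K : Type*} [Field K] {n : ℕ} (x y : Fin n → K) (a : ℤ → K)
    (lam mu : YoungDiagram) : K :=
  (Matrix.of fun i j : Fin (lam.colLen 0) =>
    frobeniusH x y (fun k => a (k + ((mu.rowLen j : ℤ) - j)))
      ((lam.rowLen i : ℤ) - mu.rowLen j - i + j)).det

/-! ### Dual Schur functions -/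

/-- `X_i(g, h) = x_i (1 - g x_{i-1}) ⋯ (1 - g x_1) / ((1 - h x_i) ⋯ (1 - h x_1))`. -/
def dualFactor {K : Type*} [Field K] {n : ℕ} (x : Fin n → K) (i : Fin n) (g h : K) : K :=
  x i * (∏ j ∈ Finset.Iio i, (1 - g * x j)) / ∏ j ∈ Finset.Iic i, (1 - h * x j)

open Classical in
/-- Molev's skew dual Schur function `ŝ_{λ/μ}(x ‖ a) = ∑_T ∏_α X_{T(α)}(a_{-c(α)+1}, a_{-c(α)})`, the
sum over the reverse tableaux of shape `λ/μ` with entries in `{1, …, n}`. -/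
def skewDualSchur {K : Type*} [Field K] {n : ℕ} (x : Fin n → K) (a : ℤ → K)
    (lam mu : YoungDiagram) : K :=
  ∑ T : SkewCell lam mu → Fin n with IsReverseTableau T,
    ∏ p, dualFactor x (T p) (a (-content p + 1)) (a (-content p))

/-- The entries of the alternants for dual Schur functions:
`x^r / ((1 - a_0 x) ⋯ (1 - a_{1-r} x)) · (1 - a_{n-r-1} x)(1 - a_{n-r-2} x) ⋯ (1 - a_{1-r} x)`. -/
def dualAlternantEntry {K : Type*} [Field K] (n : ℕ) (a : ℤ → K) (x : K) (r : ℕ) : K :=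
  x ^ r / (∏ i ∈ Finset.range r, (1 - a (-(i : ℤ)) * x)) *
    ∏ k ∈ Finset.Icc (1 - (r : ℤ)) ((n : ℤ) - r - 1), (1 - a k * x)

/-- The dual Schur polynomial `ŝ_λ(x ‖ a)` in `n` distinct variables as a ratio of alternants; it is
`0` when `λ` has more than `n` rows. -/
def dualSchur {K : Type*} [Field K] {n : ℕ} (x : Fin n → K) (a : ℤ → K)
    (lam : YoungDiagram) : K :=
  if lam.colLen 0 ≤ n then
    (Matrix.of fun i j : Fin n => dualAlternantEntry n a (x i) (lam.rowLen j + (n - 1 - j))).det /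
      (Matrix.of fun i j : Fin n => dualAlternantEntry n a (x i) (n - 1 - j)).det
  else 0

end

end FreeFermionic

namespace FreeFermionic

section Minors

variable {K : Type*} [Field K] {N : ℕ}

/-- The minor of an upper triangular `ℤ × ℤ` matrix with rows `p` and columns `q`. -/
def minor (A : IncidenceAlgebra K ℤ) (p q : Fin N → ℤ) : K :=
  (Matrix.of fun i j => A (p i) (q j)).det

theorem minor_zero (A : IncidenceAlgebra K ℤ) (p q : Fin 0 → ℤ) : minor A p q = 1 :=
  Matrix.det_isEmpty

theorem minor_succ_of_row (A : IncidenceAlgebra K ℤ) (p q : Fin (N + 1) → ℤ)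
    (h : ∀ j : Fin N, A (p 0) (q j.succ) = 0) :
    minor A p q = A (p 0) (q 0) * minor A (Fin.tail p) (Fin.tail q) := by
  unfold minor
  rw [Matrix.det_succ_row_zero, Fin.sum_univ_succ, Finset.sum_eq_zero fun j _ => by simp [h j]]
  simp [Fin.tail, Matrix.submatrix]

theorem minor_succ_of_col (A : IncidenceAlgebra K ℤ) (p q : Fin (N + 1) → ℤ)
    (h : ∀ i : Fin N, A (p i.succ) (q 0) = 0) :
    minor A p q = A (p 0) (q 0) * minor A (Fin.tail p) (Fin.tail q) := by
  unfold minor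
  rw [Matrix.det_succ_column_zero, Fin.sum_univ_succ, Finset.sum_eq_zero fun j _ => by simp [h j]]
  simp [Fin.tail, Matrix.submatrix]

theorem minor_eq_zero_of_lt (A : IncidenceAlgebra K ℤ) (p q : Fin (N + 1) → ℤ) (hq : StrictAnti q)
    (h : q 0 < p 0) : minor A p q = 0 := by
  refine Matrix.det_eq_zero_of_row_eq_zero 0 fun j => ?_
  have := hq.antitone (Fin.zero_le j)
  exact IncidenceAlgebra.apply_eq_zero_of_not_le (by omega) A

/-- Subtracting a multiple of the second column from the first. -/
theorem minor_succ_of_col_sub (A : IncidenceAlgebra K ℤ) (p q : Fin (N + 2) → ℤ) (α : K)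
    (hα : ∀ i : Fin (N + 1), A (p i.succ) (q 0) = α * A (p i.succ) (q 1)) :
    minor A p q = (A (p 0) (q 0) - α * A (p 0) (q 1)) * minor A (Fin.tail p) (Fin.tail q) := by
  unfold minor
  rw [← Matrix.det_updateCol_add_smul_self _ (i := 0) (j := 1) (by simp) (-α),
    Matrix.det_succ_column_zero, Fin.sum_univ_succ, Finset.sum_eq_zero fun j _ => by
      simp [hα j]]
  simp only [Fin.val_zero, pow_zero, one_mul, add_zero, Matrix.updateCol_self, Matrix.of_apply,
    smul_eq_mul, neg_mul, ← sub_eq_add_neg]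
  congr 2

theorem minor_ne_zero_le (A : IncidenceAlgebra K ℤ) (p q : Fin N → ℤ) (hp : StrictAnti p)
    (hq : StrictAnti q) (h : minor A p q ≠ 0) (i : Fin N) : p i ≤ q i := by
  by_contra! hi
  apply h
  unfold minor
  rw [Matrix.det_apply]
  refine Finset.sum_eq_zero fun σ _ => ?_
  have : ∃ j, j ≤ i ∧ i ≤ σ.symm j := by
    by_contra! hc
    have h1 : (Finset.Iic i).card ≤ (Finset.Iio i).card :=
      Finset.card_le_card_of_injOn σ.symm (fun j hj => by
        simpa using hc j (by simpa using hj)) σ.symm.injective.injOn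
    simp at h1
  obtain ⟨j, hj, hj'⟩ := this
  have h2 : A (p (σ (σ.symm j))) (q (σ.symm j)) = 0 := by
    refine IncidenceAlgebra.apply_eq_zero_of_not_le ?_ A
    have := hp.antitone hj
    have := hq.antitone hj'
    simp only [Equiv.apply_symm_apply]
    omega
  rw [Finset.prod_eq_zero (Finset.mem_univ (σ.symm j)) (by simpa using h2), smul_zero]

theorem minor_self (A : IncidenceAlgebra K ℤ) (p : Fin N → ℤ) (hp : StrictAnti p) :
    minor A p p = ∏ i, A (p i) (p i) := by
  unfold minor
  rw [Matrix.det_of_isLowerTriangular]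
  · rfl
  · intro i j hij
    exact IncidenceAlgebra.apply_eq_zero_of_not_le (not_le.mpr (hp (by simpa using hij))) A

/-- The **Cauchy–Binet formula** for minors of a product of upper triangular matrices. -/
theorem minor_mul (A B : IncidenceAlgebra K ℤ) (p q : Fin N → ℤ) (lo hi : ℤ)
    (hlo : ∀ i, lo ≤ p i) (hhi : ∀ i, q i ≤ hi) [DecidablePred (StrictAnti : (Fin N → ℤ) → Prop)] :
    minor (A * B) p q =
      ∑ f ∈ (Fintype.piFinset fun _ : Fin N => Finset.Icc lo hi) with StrictAnti f,
        minor A p f * minor B f q := by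
  classical
  have h1 : minor (A * B) p q = Matrix.detRowAlternating (R := K)
      (fun i => ∑ r ∈ Finset.Icc lo hi, A (p i) r • fun j => B r (q j)) := by
    change Matrix.det _ = Matrix.det _
    congr 1
    ext i j
    rw [Matrix.of_apply, IncidenceAlgebra.mul_apply, Finset.sum_apply]
    simp only [Pi.smul_apply, smul_eq_mul]
    refine Finset.sum_subset (Finset.Icc_subset_Icc (hlo i) (hhi j)) fun r _ hr => ?_
    rw [Finset.mem_Icc, not_and_or] at hr
    rcases hr with hr | hr
    · rw [IncidenceAlgebra.apply_eq_zero_of_not_le hr, zero_mul]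
    · rw [IncidenceAlgebra.apply_eq_zero_of_not_le hr, mul_zero]
  have h2 := (Matrix.detRowAlternating (n := Fin N) (R := K)).toMultilinearMap.map_sum_finset
    (fun i r => A (p i) r • fun j => B r (q j)) (fun _ => Finset.Icc lo hi)
  simp only [AlternatingMap.coe_multilinearMap] at h2
  rw [h1, h2]
  have h3 : ∀ f : Fin N → ℤ, Matrix.detRowAlternating (R := K)
      (fun i => A (p i) (f i) • fun j => B (f i) (q j)) =
      (∏ i, A (p i) (f i)) * minor B f q := by
    intro f
    have := (Matrix.detRowAlternating (n := Fin N) (R := K)).toMultilinearMap.map_smul_univ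
      (fun i => A (p i) (f i)) (fun i j => B (f i) (q j))
    simp only [AlternatingMap.coe_multilinearMap, smul_eq_mul] at this
    rw [this]
    rfl
  simp_rw [h3]
  have h4 : ∀ f : Fin N → ℤ, minor A p f * minor B f q =
      ∑ σ : Equiv.Perm (Fin N), (∏ i, A (p i) ((f ∘ σ) i)) * minor B (f ∘ σ) q := by
    intro f
    have hB : ∀ σ : Equiv.Perm (Fin N), minor B (f ∘ σ) q = (σ.sign : K) * minor B f q :=
      fun σ => Matrix.det_permute σ (Matrix.of fun i j => B (f i) (q j))
    simp_rw [hB]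
    conv_lhs => rw [minor, ← Matrix.det_transpose, Matrix.det_apply, Finset.sum_mul]
    refine Finset.sum_congr rfl fun σ _ => ?_
    simp only [Matrix.transpose_apply, Matrix.of_apply, Function.comp_apply, Units.smul_def,
      zsmul_eq_mul]
    ring
  simp_rw [h4]
  rw [← Finset.sum_product']
  symm
  refine Finset.sum_bij_ne_zero (fun s _ _ => s.1 ∘ s.2) ?_ ?_ ?_ ?_
  · intro s hs _
    simp only [Finset.mem_product, Finset.mem_filter, Fintype.mem_piFinset] at hs ⊢
    exact fun i => hs.1.1 _
  · rintro ⟨f, σ⟩ hs _ ⟨g, τ⟩ ht _ h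
    simp only [Finset.mem_product, Finset.mem_filter] at hs ht h
    have hfg : f = g := by
      have hr : Set.range f = Set.range g := by
        rw [← σ.surjective.range_comp f, ← τ.surjective.range_comp g, h]
      exact (hs.1.2.range_inj ht.1.2).mp hr
    subst hfg
    congr 1
    ext i
    have := hs.1.2.injective (congrFun h i)
    rw [this]
  · intro f hf hne
    have hinj : Function.Injective f := by
      intro i j hij
      by_contra hne'
      apply hne
      rw [minor, Matrix.det_zero_of_row_eq hne' (by ext k; simp [hij]), mul_zero]
    let σ := Tuple.sort (OrderDual.toDual ∘ f)
    have hmono : Monotone ((OrderDual.toDual ∘ f) ∘ σ) := Tuple.monotone_sort _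
    have hanti : StrictAnti (f ∘ σ) :=
      Antitone.strictAnti_of_injective (fun i j hij => hmono hij) (hinj.comp σ.injective)
    have hcomp : (f ∘ σ) ∘ σ.symm = f := by ext; simp
    refine ⟨(f ∘ σ, σ.symm), ?_, ?_, hcomp⟩
    · simp only [Finset.mem_product, Finset.mem_filter, Fintype.mem_piFinset, Finset.mem_univ,
        and_true] at hf ⊢
      exact ⟨fun i => hf _, hanti⟩
    · simpa only [hcomp] using hne
  · intro s _ _
    rfl

end Minors

section Partitions

variable {K : Type*} [Field K] {N : ℕ}

/-- The columns of the first `N` particles of the Maya diagram of `(λ; 0)`. -/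
def particles (N : ℕ) (lam : YoungDiagram) : Fin N → ℤ := fun i => (lam.rowLen i : ℤ) - i

theorem particles_strictAnti (N : ℕ) (lam : YoungDiagram) : StrictAnti (particles N lam) := by
  intro i j hij
  have h1 := lam.rowLen_anti i j hij.le
  have h2 : (i : ℕ) < j := hij
  simp only [particles]
  omega

theorem neg_le_particles (lam : YoungDiagram) (i : Fin N) : -(i : ℤ) ≤ particles N lam i := by
  simp only [particles]
  omega

theorem rowLen_eq_zero_iff (lam : YoungDiagram) (i : ℕ) :
    lam.rowLen i = 0 ↔ lam.colLen 0 ≤ i := by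
  have h1 := YoungDiagram.mem_iff_lt_rowLen (μ := lam) (i := i) (j := 0)
  have h2 := YoungDiagram.mem_iff_lt_colLen (μ := lam) (i := i) (j := 0)
  rw [← not_lt, ← h2, h1]
  omega

theorem le_iff_rowLen_le {mu lam : YoungDiagram} :
    mu ≤ lam ↔ ∀ i, mu.rowLen i ≤ lam.rowLen i := by
  constructor
  · intro h i
    by_contra! hc
    exact absurd (YoungDiagram.mem_iff_lt_rowLen.mp (h (YoungDiagram.mem_iff_lt_rowLen.mpr hc)))
      (lt_irrefl _)
  · rintro h ⟨i, j⟩ hc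
    exact YoungDiagram.mem_iff_lt_rowLen.mpr ((YoungDiagram.mem_iff_lt_rowLen.mp hc).trans_le (h i))

theorem colLen_le_of_le {mu lam : YoungDiagram} (h : mu ≤ lam) : mu.colLen 0 ≤ lam.colLen 0 := by
  rw [← rowLen_eq_zero_iff]
  have := le_iff_rowLen_le.mp h (lam.colLen 0)
  have := (rowLen_eq_zero_iff lam (lam.colLen 0)).mpr le_rfl
  omega

theorem le_of_particles_le {mu lam : YoungDiagram} (hmu : mu.colLen 0 ≤ N)
    (h : ∀ i, particles N mu i ≤ particles N lam i) : mu ≤ lam := by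
  rw [le_iff_rowLen_le]
  intro i
  by_cases hi : i < N
  · have := h ⟨i, hi⟩
    simp only [particles] at this
    omega
  · rw [(rowLen_eq_zero_iff mu i).mpr (by omega)]
    exact Nat.zero_le _

theorem le_of_minor_ne_zero {mu lam : YoungDiagram} (hmu : mu.colLen 0 ≤ N)
    {A : IncidenceAlgebra K ℤ} (h : minor A (particles N mu) (particles N lam) ≠ 0) : mu ≤ lam :=
  le_of_particles_le hmu
    (minor_ne_zero_le A _ _ (particles_strictAnti N mu) (particles_strictAnti N lam) h)

theorem particles_injOn {mu lam : YoungDiagram} (hmu : mu.colLen 0 ≤ N) (hlam : lam.colLen 0 ≤ N)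
    (h : particles N mu = particles N lam) : mu = lam :=
  le_antisymm (le_of_particles_le hmu fun i => (congrFun h i).le)
    (le_of_particles_le hlam fun i => (congrFun h i).ge)

theorem particles_bot (N : ℕ) : particles N ⊥ = fun i : Fin N => -(i : ℤ) := by
  ext i
  have : (⊥ : YoungDiagram).rowLen i = 0 := by
    by_contra h
    exact YoungDiagram.notMem_bot _
      (YoungDiagram.mem_iff_lt_rowLen.mpr (Nat.pos_of_ne_zero h))
  simp [particles, this]

/-- A sequence of particles below those of a partition comes from a partition. -/
theorem exists_particles_eq (lam : YoungDiagram) (f : Fin N → ℤ) (hf : StrictAnti f)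
    (hlo : ∀ i : Fin N, -(i : ℤ) ≤ f i) (hhi : ∀ i, f i ≤ particles N lam i) :
    ∃ u : YoungDiagram, u ≤ lam ∧ u.colLen 0 ≤ N ∧ particles N u = f := by
  have hgap : ∀ (k : ℕ) (i j : Fin N), (i : ℕ) + k = j → f j + j ≤ f i + i := by
    intro k
    induction k with
    | zero => intro i j h; obtain rfl : i = j := Fin.ext (by omega); rfl
    | succ k ih =>
      intro i j h
      have h1 := ih i ⟨i + k, by omega⟩ rfl
      have h2 : f j < f ⟨i + k, by omega⟩ := hf (Fin.lt_def.mpr (by simp only; omega))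
      simp only [Nat.cast_add] at h1
      omega
  let u : YoungDiagram :=
    { cells := lam.cells.filter fun c => ∃ h : c.1 < N, (c.2 : ℤ) < f ⟨c.1, h⟩ + c.1
      isLowerSet := by
        rintro ⟨i, j⟩ ⟨i', j'⟩ ⟨hi, hj⟩ hc
        simp only [Finset.coe_filter, Set.mem_ofPred_eq, YoungDiagram.mem_cells] at hc ⊢
        simp only at hi hj
        obtain ⟨h1, h2, h3⟩ := hc
        refine ⟨lam.up_left_mem hi hj h1, by omega, ?_⟩
        have := hgap (i - i') ⟨i', by omega⟩ ⟨i, h2⟩ (by simp only; omega)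
        simp only at this
        omega }
  have hmem : ∀ i j, (i, j) ∈ u ↔ (i, j) ∈ lam ∧ ∃ h : i < N, (j : ℤ) < f ⟨i, h⟩ + i := by
    intro i j
    change (i, j) ∈ lam.cells.filter _ ↔ _
    simp [Finset.mem_filter]
  have hrow : ∀ i : Fin N, (u.rowLen i : ℤ) = f i + i := by
    intro i
    have hnn : 0 ≤ f i + i := by have := hlo i; omega
    have hlt : ∀ j : ℕ, j < u.rowLen i ↔ (j : ℤ) < f i + i := by
      intro j
      rw [← YoungDiagram.mem_iff_lt_rowLen, hmem]
      constructor
      · rintro ⟨_, _, h⟩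
        exact h
      · intro h
        refine ⟨YoungDiagram.mem_iff_lt_rowLen.mpr ?_, i.2, h⟩
        have := hhi i
        simp only [particles] at this
        omega
    have h1 := hlt (u.rowLen i)
    have h2 := hlt (f i + i).toNat
    omega
  refine ⟨u, ?_, ?_, ?_⟩
  · rintro ⟨i, j⟩ h
    exact ((hmem i j).mp h).1
  · rw [← rowLen_eq_zero_iff]
    by_contra h
    have := (hmem N 0).mp (YoungDiagram.mem_iff_lt_rowLen.mpr (Nat.pos_of_ne_zero h))
    obtain ⟨_, h, _⟩ := this
    omega
  · ext i
    rw [particles, hrow]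
    ring

/-- The Cauchy–Binet formula, indexed by partitions. -/
theorem minor_mul_particles (A B : IncidenceAlgebra K ℤ) (mu lam : YoungDiagram)
    (S : Finset YoungDiagram) (hS : ∀ u ∈ S, u.colLen 0 ≤ N)
    (hS' : ∀ u, u.colLen 0 ≤ N → mu ≤ u → u ≤ lam → u ∈ S) (hmu : mu.colLen 0 ≤ N) :
    minor (A * B) (particles N mu) (particles N lam) =
      ∑ u ∈ S, minor A (particles N mu) (particles N u) *
        minor B (particles N u) (particles N lam) := by
  classical
  have hhi : ∀ i, particles N lam i ≤ lam.rowLen 0 := by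
    intro i
    have := lam.rowLen_anti 0 i (Nat.zero_le _)
    simp only [particles]
    omega
  have hlo : ∀ (v : YoungDiagram) (i : Fin N), -(N : ℤ) ≤ particles N v i := by
    intro v i
    have := neg_le_particles v i
    omega
  rw [minor_mul A B _ _ (-(N : ℤ)) (lam.rowLen 0) (hlo mu) hhi]
  symm
  refine Finset.sum_bij_ne_zero (fun u _ _ => particles N u) ?_ ?_ ?_ ?_
  · intro u hu hne
    rw [Finset.mem_filter, Fintype.mem_piFinset]
    refine ⟨fun i => Finset.mem_Icc.mpr ⟨hlo u i, ?_⟩, particles_strictAnti N u⟩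
    exact (minor_ne_zero_le B _ _ (particles_strictAnti N u) (particles_strictAnti N lam)
      (right_ne_zero_of_mul hne) i).trans (hhi i)
  · intro u hu _ v hv _ h
    exact particles_injOn (hS u hu) (hS v hv) h
  · intro f hf hne
    rw [Finset.mem_filter] at hf
    have h1 := minor_ne_zero_le A _ _ (particles_strictAnti N mu) hf.2 (left_ne_zero_of_mul hne)
    have h2 := minor_ne_zero_le B _ _ hf.2 (particles_strictAnti N lam) (right_ne_zero_of_mul hne)
    obtain ⟨u, hu, huN, rfl⟩ := exists_particles_eq lam f hf.2
      (fun i => (neg_le_particles mu i).trans (h1 i)) h2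
    exact ⟨u, hS' u huN (le_of_particles_le hmu h1) hu, hne, rfl⟩
  · intro u _ _
    rfl

/-- The Young diagrams contained in `λ`. -/
noncomputable def subdiagrams (lam : YoungDiagram) : Finset YoungDiagram :=
  (Set.Finite.subset (Set.Finite.preimage (f := YoungDiagram.cells)
    (fun _ _ _ _ h => YoungDiagram.ext h) lam.cells.powerset.finite_toSet)
    (fun u (hu : u ≤ lam) => by simpa using hu) : {u | u ≤ lam}.Finite).toFinset

theorem mem_subdiagrams {u lam : YoungDiagram} : u ∈ subdiagrams lam ↔ u ≤ lam := by
  simp [subdiagrams]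

end Partitions

section IntegerProducts

variable {K : Type*} [CommMonoid K]

theorem prod_Ioc_add_one {c d : ℤ} (h : c ≤ d) (f : ℤ → K) :
    ∏ k ∈ Finset.Ioc c (d + 1), f k = (∏ k ∈ Finset.Ioc c d, f k) * f (d + 1) := by
  rw [← Finset.prod_erase_mul _ _ (Finset.mem_Ioc.mpr ⟨by omega, le_rfl⟩)]
  congr 1
  refine Finset.prod_congr ?_ fun _ _ => rfl
  ext k
  simp only [Finset.mem_erase, Finset.mem_Ioc]
  omega

theorem prod_Ioc_mul_prod_Ioc {c d e : ℤ} (h : c ≤ d) (h' : d ≤ e) (f : ℤ → K) :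
    (∏ k ∈ Finset.Ioc c d, f k) * ∏ k ∈ Finset.Ioc d e, f k = ∏ k ∈ Finset.Ioc c e, f k := by
  rw [← Finset.prod_union (Finset.disjoint_left.mpr fun k => by
    simp only [Finset.mem_Ioc]; omega)]
  refine Finset.prod_congr ?_ fun _ _ => rfl
  ext k
  simp only [Finset.mem_union, Finset.mem_Ioc]
  omega

theorem prod_Ico_mul_prod_Ico {c d e : ℤ} (h : c ≤ d) (h' : d ≤ e) (f : ℤ → K) :
    (∏ k ∈ Finset.Ico c d, f k) * ∏ k ∈ Finset.Ico d e, f k = ∏ k ∈ Finset.Ico c e, f k := by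
  rw [← Finset.prod_union (Finset.disjoint_left.mpr fun k => by
    simp only [Finset.mem_Ico]; omega)]
  refine Finset.prod_congr ?_ fun _ _ => rfl
  ext k
  simp only [Finset.mem_union, Finset.mem_Ico]
  omega

theorem mul_prod_Ioo {c d : ℤ} (h : c < d) (f : ℤ → K) :
    f c * ∏ k ∈ Finset.Ioo c d, f k = ∏ k ∈ Finset.Ico c d, f k := by
  rw [← Finset.mul_prod_erase (Finset.Ico c d) f (Finset.mem_Ico.mpr ⟨le_rfl, h⟩)]
  congr 1
  refine Finset.prod_congr ?_ fun _ _ => rfl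
  ext k
  simp only [Finset.mem_erase, Finset.mem_Ico, Finset.mem_Ioo]
  omega

theorem mul_prod_Ioc {c d : ℤ} (h : c ≤ d) (f : ℤ → K) :
    f c * ∏ k ∈ Finset.Ioc c d, f k = ∏ k ∈ Finset.Icc c d, f k := by
  rw [← Finset.mul_prod_erase (Finset.Icc c d) f (Finset.mem_Icc.mpr ⟨le_rfl, h⟩)]
  congr 1
  refine Finset.prod_congr ?_ fun _ _ => rfl
  ext k
  simp only [Finset.mem_erase, Finset.mem_Icc, Finset.mem_Ioc]
  omega

theorem prod_Ioc_neg (n m : ℕ) (f : ℤ → K) :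
    ∏ k ∈ Finset.Ioc (-(n : ℤ)) m, f k =
      (∏ i ∈ Finset.range n, f (-(i : ℤ))) * ∏ i ∈ Finset.range m, f ((i : ℤ) + 1) := by
  rw [← prod_Ioc_mul_prod_Ioc (d := 0) (by omega) (by omega)]
  congr 1
  · refine (Finset.prod_nbij (fun i : ℕ => -(i : ℤ)) ?_ ?_ ?_ fun _ _ => rfl).symm
    · intro i hi
      simp only [Finset.mem_range, Finset.mem_Ioc] at hi ⊢
      omega
    · intro i _ j _ h
      simpa using h
    · intro k hk
      simp only [Finset.coe_Ioc, Set.mem_Ioc, Finset.coe_range, Set.mem_image, Set.mem_Iio] at hk ⊢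
      exact ⟨(-k).toNat, by omega, by omega⟩
  · refine (Finset.prod_nbij (fun i : ℕ => (i : ℤ) + 1) ?_ ?_ ?_ fun _ _ => rfl).symm
    · intro i hi
      simp only [Finset.mem_range, Finset.mem_Ioc] at hi ⊢
      omega
    · intro i _ j _ h
      simpa using h
    · intro k hk
      simp only [Finset.coe_Ioc, Set.mem_Ioc, Finset.coe_range, Set.mem_image, Set.mem_Iio] at hk ⊢
      exact ⟨(k - 1).toNat, by omega, by omega⟩

end IntegerProducts

section Transfer

variable {K : Type*} [Field K]

/-- Sum over the states of the columns `A + 1, …, A + n` of a row, with empty left boundary edge and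
right boundary edge `s`. -/
def transfer (cw : ℤ → Bool → Bool → K) (A : ℤ) : ℕ → Bool → K
  | 0, s => if s = true then 0 else 1
  | n + 1, s => transfer cw A n true * cw (A + n + 1) true s +
      transfer cw A n false * cw (A + n + 1) false s

theorem sum_states_eq_transfer (cw : ℤ → Bool → Bool → K) (A : ℤ) (n : ℕ) (s : Bool) :
    (∑ h : Fin (n + 1) → Bool, if h 0 = false ∧ h (Fin.last n) = s then
      ∏ j : Fin n, cw (A + (j : ℕ) + 1) (h j.castSucc) (h j.succ) else 0) = transfer cw A n s := by
  induction n generalizing s with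
  | zero =>
    rw [Fintype.sum_equiv (Equiv.funUnique (Fin 1) Bool) _
      (fun t => if t = false ∧ t = s then (1 : K) else 0) (fun h => by simp)]
    cases s <;> simp [transfer]
  | succ n ih =>
    rw [transfer, ← ih true, ← ih false, Finset.sum_mul, Finset.sum_mul,
      ← Finset.sum_add_distrib,
      ← Fintype.sum_equiv (Fin.snocEquiv fun _ : Fin (n + 2) => Bool)
        (fun g => if g.2 0 = false ∧ g.1 = s then
          (∏ j : Fin n, cw (A + (j : ℕ) + 1) (g.2 j.castSucc) (g.2 j.succ)) *
            cw (A + n + 1) (g.2 (Fin.last n)) g.1 else 0), Fintype.sum_prod_type, Finset.sum_comm]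
    · refine Finset.sum_congr rfl fun h _ => ?_
      rw [Fintype.sum_bool]
      cases h0 : h 0 <;> cases hl : h (Fin.last n) <;> cases s <;> simp [h0, hl]
    · rintro ⟨t, h⟩
      have e1 : (Fin.snocEquiv fun _ : Fin (n + 2) => Bool) (t, h) 0 = h 0 :=
        Fin.snoc_castSucc (α := fun _ => Bool) t h 0
      have e2 : (Fin.snocEquiv fun _ : Fin (n + 2) => Bool) (t, h) (Fin.last (n + 1)) = t :=
        Fin.snoc_last (α := fun _ => Bool) t h
      have e3 : ∀ j : Fin (n + 1),
          (Fin.snocEquiv fun _ : Fin (n + 2) => Bool) (t, h) j.castSucc = h j :=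
        fun j => Fin.snoc_castSucc (α := fun _ => Bool) t h j
      rw [e1, e2, Fin.prod_univ_castSucc]
      simp only [e3, Fin.succ_castSucc, Fin.succ_last, e2, Fin.val_castSucc, Fin.val_last]

/-- The partial transfer as a function of the last column. -/
def colTransfer (cw : ℤ → Bool → Bool → K) (A c : ℤ) (s : Bool) : K :=
  transfer cw A (c - A).toNat s

theorem colTransfer_self (cw : ℤ → Bool → Bool → K) (A : ℤ) (s : Bool) :
    colTransfer cw A A s = if s = true then 0 else 1 := by
  simp [colTransfer, transfer]

theorem colTransfer_add_one (cw : ℤ → Bool → Bool → K) {A c : ℤ} (h : A ≤ c) (s : Bool) :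
    colTransfer cw A (c + 1) s = colTransfer cw A c true * cw (c + 1) true s +
      colTransfer cw A c false * cw (c + 1) false s := by
  obtain ⟨n, rfl⟩ := Int.le.dest h
  have h1 : (A + n + 1 - A).toNat = n + 1 := by omega
  have h2 : (A + n - A).toNat = n := by omega
  rw [colTransfer, h1, transfer, colTransfer, colTransfer, h2]

theorem colTransfer_congr {cw cw' : ℤ → Bool → Bool → K} {A c : ℤ} (h : A ≤ c)
    (hcw : ∀ k, A < k → k ≤ c → cw k = cw' k) (s : Bool) :
    colTransfer cw A c s = colTransfer cw' A c s := by
  induction c, h using Int.leInduction generalizing s with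
  | base => simp [colTransfer_self]
  | succ c h ih =>
    rw [colTransfer_add_one _ h, colTransfer_add_one _ h,
      ih fun k h1 h2 => hcw k h1 (by omega), ih fun k h1 h2 => hcw k h1 (by omega),
      hcw _ (by omega) le_rfl]

theorem colTransfer_eq_zero {cw : ℤ → Bool → Bool → K} {A c d : ℤ} (h : A ≤ c) (hd : c ≤ d)
    (h0 : ∀ s, colTransfer cw A c s = 0) (s : Bool) : colTransfer cw A d s = 0 := by
  induction d, hd using Int.leInduction generalizing s with
  | base => exact h0 s
  | succ d hd ih => rw [colTransfer_add_one _ (h.trans hd), ih, ih, zero_mul, zero_mul, add_zero]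

open Classical in
/-- The weight of column `k` with top edges `v` and bottom edges `w`. -/
noncomputable def colWeight (a b : ℤ → K) (x y : K) (v w : ℤ → Prop) (k : ℤ) (l r : Bool) : K :=
  vertexWeight x y (a k) (b k) l (decide (v k)) (decide (w k)) r

theorem finiteRow_eq_colTransfer (a b : ℤ → K) (x y : K) (n m : ℕ) (v w : ℤ → Prop) :
    finiteRow a b x y n m v w = colTransfer (colWeight a b x y v w) (-n) m false := by
  have h : ((m : ℤ) - -n).toNat = n + m := by omega
  rw [colTransfer, h, ← sum_states_eq_transfer, finiteRow]
  refine Finset.sum_congr rfl fun h _ => ?_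
  refine if_congr Iff.rfl (Finset.prod_congr rfl fun j _ => ?_) rfl
  have : ((j : ℕ) : ℤ) - n + 1 = -n + (j : ℕ) + 1 := by ring
  rw [this, colWeight]

variable {a b : ℤ → K} {x y : K}

/-- Conservation of particles. -/
theorem card_of_colTransfer_ne_zero {v w : ℤ → Prop} [DecidablePred v] [DecidablePred w] {A c : ℤ}
    (h : A ≤ c) {s : Bool} (hne : colTransfer (colWeight a b x y v w) A c s ≠ 0) :
    ((Finset.Ioc A c).filter v).card = ((Finset.Ioc A c).filter w).card + s.toNat := by
  induction c, h using Int.leInduction generalizing s with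
  | base =>
    cases s
    · simp
    · simp [colTransfer_self] at hne
  | succ c h ih =>
    have hcard : ∀ (u : ℤ → Prop) [DecidablePred u], ((Finset.Ioc A (c + 1)).filter u).card =
        ((Finset.Ioc A c).filter u).card + (decide (u (c + 1))).toNat := by
      intro u _
      simp only [Finset.card_filter]
      have : Finset.Ioc A (c + 1) = insert (c + 1) (Finset.Ioc A c) := by
        ext k
        simp only [Finset.mem_insert, Finset.mem_Ioc]
        omega
      rw [this, Finset.sum_insert (by simp)]
      by_cases hu : u (c + 1) <;> simp [hu, add_comm]
    rw [hcard v, hcard w]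
    rw [colTransfer_add_one _ h] at hne
    have key : ∃ t, colTransfer (colWeight a b x y v w) A c t ≠ 0 ∧
        colWeight a b x y v w (c + 1) t s ≠ 0 := by
      by_contra! hc
      apply hne
      have h1 := hc true
      have h2 := hc false
      by_cases e1 : colTransfer (colWeight a b x y v w) A c true = 0 <;>
      by_cases e2 : colTransfer (colWeight a b x y v w) A c false = 0 <;> simp_all
    obtain ⟨t, ht, hw⟩ := key
    have h1 := ih ht
    rw [h1]
    by_cases hv : v (c + 1) <;> by_cases hw' : w (c + 1) <;> cases s <;> cases t <;>
      simp [colWeight, vertexWeight, hv, hw'] at hw ⊢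

theorem colTransfer_empty {v w : ℤ → Prop} {A c d : ℤ} (h : A ≤ c) (hd : c ≤ d)
    (hv : ∀ k, c < k → k ≤ d → ¬ v k) (hw : ∀ k, c < k → k ≤ d → ¬ w k) :
    colTransfer (colWeight a b x y v w) A d false =
        colTransfer (colWeight a b x y v w) A c false * ∏ k ∈ Finset.Ioc c d, (1 - b k * x) ∧
      colTransfer (colWeight a b x y v w) A d true =
        colTransfer (colWeight a b x y v w) A c true * ∏ k ∈ Finset.Ioc c d, (x - a k) := by
  induction d, hd using Int.leInduction with
  | base => simp
  | succ d hd ih =>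
    obtain ⟨ih1, ih2⟩ := ih (fun k h1 h2 => hv k h1 (by omega)) (fun k h1 h2 => hw k h1 (by omega))
    rw [colTransfer_add_one _ (h.trans hd), colTransfer_add_one _ (h.trans hd), ih1, ih2,
      prod_Ioc_add_one hd, prod_Ioc_add_one hd]
    simp only [colWeight, hv (d + 1) (by omega) le_rfl, hw (d + 1) (by omega) le_rfl, vertexWeight,
      decide_false]
    constructor <;> ring

end Transfer

section RowMinor

variable {K : Type*} [Field K]

/-- Weight of a single path that enters a row in column `p` and leaves it in column `q`, relative to
the weight of the empty row. -/
noncomputable def pathWeight (a b : ℤ → K) (x y : K) : IncidenceAlgebra K ℤ where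
  toFun p q := if p = q then (1 + b p * y) / (1 - b p * x) else
    if p < q then (1 - a p * b p) * (x + y) * (∏ k ∈ Finset.Ioo p q, (x - a k)) /
      ∏ k ∈ Finset.Icc p q, (1 - b k * x) else 0
  eq_zero_of_not_le' p q h := by
    rw [if_neg (by omega), if_neg (by omega)]

variable {a b : ℤ → K} {x y : K}

theorem pathWeight_self (p : ℤ) : pathWeight a b x y p p = (1 + b p * y) / (1 - b p * x) :=
  if_pos rfl

theorem pathWeight_of_lt {p q : ℤ} (h : p < q) : pathWeight a b x y p q =
    (1 - a p * b p) * (x + y) * (∏ k ∈ Finset.Ioo p q, (x - a k)) /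
      ∏ k ∈ Finset.Icc p q, (1 - b k * x) :=
  (if_neg h.ne).trans (if_pos h)

theorem pathWeight_mul {p r q : ℤ} (h : p < r) (h' : r < q) :
    pathWeight a b x y p q = (∏ k ∈ Finset.Ico r q, (x - a k)) /
      (∏ k ∈ Finset.Ioc r q, (1 - b k * x)) * pathWeight a b x y p r := by
  rw [pathWeight_of_lt h, pathWeight_of_lt (h.trans h'), ← mul_prod_Ioc h.le,
    ← mul_prod_Ioc (h.trans h').le, ← prod_Ioc_mul_prod_Ioc h.le h'.le]
  have : ∏ k ∈ Finset.Ioo p q, (x - a k) =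
      (∏ k ∈ Finset.Ioo p r, (x - a k)) * ∏ k ∈ Finset.Ico r q, (x - a k) := by
    rw [← Finset.prod_union (Finset.disjoint_left.mpr fun k => by
      simp only [Finset.mem_Ioo, Finset.mem_Ico]; omega)]
    refine Finset.prod_congr ?_ fun _ _ => rfl
    ext k
    simp only [Finset.mem_union, Finset.mem_Ioo, Finset.mem_Ico]
    omega
  rw [this, div_mul_div_comm]
  congr 1 <;> ring

theorem pathWeight_sub {p q : ℤ} (h : p < q) (hb : 1 - b p * x ≠ 0) :
    pathWeight a b x y p q - (∏ k ∈ Finset.Ico p q, (x - a k)) /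
      (∏ k ∈ Finset.Ioc p q, (1 - b k * x)) * pathWeight a b x y p p =
    (y + a p) * (∏ k ∈ Finset.Ioo p q, (x - a k)) / ∏ k ∈ Finset.Ioc p q, (1 - b k * x) := by
  rw [pathWeight_of_lt h, pathWeight_self, ← mul_prod_Ioc h.le, ← mul_prod_Ioo h]
  generalize ∏ k ∈ Finset.Ioo p q, (x - a k) = u
  generalize ∏ k ∈ Finset.Ioc p q, (1 - b k * x) = t
  rw [div_mul_div_comm, mul_comm (1 - b p * x) t, ← sub_div,
    ← mul_div_mul_right ((y + a p) * u) t hb]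
  congr 1
  ring

variable {N : ℕ}

theorem minor_pathWeight_eq_zero (p q : Fin (N + 2) → ℤ) (hp : StrictAnti p) (hq : StrictAnti q)
    (h : p 0 < q 1) : minor (pathWeight a b x y) p q = 0 := by
  have hq01 : q 1 < q 0 := hq (by simp)
  have hp' : ∀ i, p i < q 1 := fun i => (hp.antitone (Fin.zero_le i)).trans_lt h
  rw [minor_succ_of_col_sub _ p q _ fun i => pathWeight_mul (hp' i.succ) hq01,
    pathWeight_mul (hp' 0) hq01, sub_self, zero_mul]

theorem minor_pathWeight_touch (p q : Fin (N + 2) → ℤ) (hp : StrictAnti p) (hq : StrictAnti q)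
    (h : p 0 = q 1) (hb : 1 - b (p 0) * x ≠ 0) : minor (pathWeight a b x y) p q =
      (y + a (p 0)) * (∏ k ∈ Finset.Ioo (p 0) (q 0), (x - a k)) /
        (∏ k ∈ Finset.Ioc (p 0) (q 0), (1 - b k * x)) *
      minor (pathWeight a b x y) (Fin.tail p) (Fin.tail q) := by
  have hq01 : q 1 < q 0 := hq (by simp)
  have hp' : ∀ i : Fin (N + 1), p i.succ < q 1 := fun i => (hp (Fin.succ_pos i)).trans_eq h
  rw [minor_succ_of_col_sub _ p q _ fun i => pathWeight_mul (hp' i) hq01, ← h,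
    pathWeight_sub (by omega) hb]

theorem card_filter_mem_range {p : Fin N → ℤ} (hp : StrictAnti p) {A : ℤ} (hA : ∀ i, A < p i)
    (c : ℤ) [DecidablePred (· ∈ Set.range p)] :
    ((Finset.Ioc A c).filter (· ∈ Set.range p)).card =
      (Finset.univ.filter fun i => p i ≤ c).card := by
  symm
  refine Finset.card_bij (fun i _ => p i) ?_ (fun i _ j _ h => hp.injective h) ?_
  · intro i hi
    simp only [Finset.mem_filter, Finset.mem_univ, true_and] at hi
    exact Finset.mem_filter.mpr ⟨Finset.mem_Ioc.mpr ⟨hA i, hi⟩, i, rfl⟩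
  · intro k hk
    obtain ⟨hk, i, rfl⟩ := Finset.mem_filter.mp hk
    exact ⟨i, by simpa using (Finset.mem_Ioc.mp hk).2, rfl⟩

theorem card_of_colTransfer_range_ne_zero {M : ℕ} {p : Fin N → ℤ} {q : Fin M → ℤ}
    (hp : StrictAnti p) (hq : StrictAnti q) {A c : ℤ} (hA : ∀ i, A < p i) (hA' : ∀ i, A < q i)
    (h : A ≤ c) {s : Bool}
    (hne : colTransfer (colWeight a b x y (· ∈ Set.range p) (· ∈ Set.range q)) A c s ≠ 0) :
    (Finset.univ.filter fun i => p i ≤ c).card =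
      (Finset.univ.filter fun i => q i ≤ c).card + s.toNat := by
  classical
  rw [← card_filter_mem_range hp hA, ← card_filter_mem_range hq hA']
  exact card_of_colTransfer_ne_zero h hne

theorem card_filter_le_of_forall {p : Fin N → ℤ} {c : ℤ} (h : ∀ i, p i ≤ c) :
    (Finset.univ.filter fun i => p i ≤ c).card = N := by
  rw [Finset.filter_true_of_mem fun i _ => h i, Finset.card_univ, Fintype.card_fin]

theorem mem_range_tail_iff {p : Fin (N + 1) → ℤ} (k : ℤ) (hk : k ≠ p 0) :
    k ∈ Set.range p ↔ k ∈ Set.range (Fin.tail p) := by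
  constructor
  · rintro ⟨i, rfl⟩
    cases i using Fin.cases with
    | zero => exact absurd rfl hk
    | succ i => exact ⟨i, rfl⟩
  · rintro ⟨i, rfl⟩
    exact ⟨i.succ, rfl⟩

theorem strictAnti_tail {p : Fin (N + 1) → ℤ} (hp : StrictAnti p) : StrictAnti (Fin.tail p) :=
  fun _ _ h => hp (Fin.succ_lt_succ_iff.mpr h)

/-- A path on top of a system of paths that ends to its left. -/
theorem colTransfer_succ {p q : Fin (N + 1) → ℤ} (hp : StrictAnti p) (hq : StrictAnti q)
    {A R : ℤ} (hA : ∀ i, A < p i) (hA' : ∀ i, A < q i) (hR : q 0 ≤ R)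
    (hb : ∀ k, 1 - b k * x ≠ 0) (hpq : p 0 ≤ q 0) (hlt : ∀ i, Fin.tail q i < p 0) :
    colTransfer (colWeight a b x y (· ∈ Set.range p) (· ∈ Set.range q)) A R false =
      pathWeight a b x y (p 0) (q 0) * colTransfer
        (colWeight a b x y (· ∈ Set.range (Fin.tail p)) (· ∈ Set.range (Fin.tail q))) A R false := by
  obtain ⟨c, hc⟩ : ∃ c, p 0 = c + 1 := ⟨p 0 - 1, by ring⟩
  have hAc : A ≤ c := by have := hA 0; omega
  have hcp : ∀ i, Fin.tail p i ≤ c := fun i => by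
    have : p i.succ < p 0 := hp (Fin.succ_pos i)
    simp only [Fin.tail]
    omega
  have hcq : ∀ i, Fin.tail q i ≤ c := fun i => by have := hlt i; omega
  have hp_not : ∀ k, c + 1 < k → k ∉ Set.range p := by
    rintro _ hk ⟨i, rfl⟩
    have := hp.antitone (Fin.zero_le i)
    omega
  have hq_not : ∀ k, c + 1 ≤ k → k ≠ q 0 → k ∉ Set.range q := by
    intro k hk hk0 hkq
    obtain ⟨i, rfl⟩ := (mem_range_tail_iff k hk0).mp hkq
    have := hcq i
    omega
  have hbelow : ∀ s, colTransfer (colWeight a b x y (· ∈ Set.range p) (· ∈ Set.range q)) A c s =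
      colTransfer (colWeight a b x y (· ∈ Set.range (Fin.tail p)) (· ∈ Set.range (Fin.tail q)))
        A c s := by
    refine colTransfer_congr hAc fun k _ hk => ?_
    funext l r
    simp only [colWeight]
    congr 1
    · exact decide_eq_decide.mpr (mem_range_tail_iff k (by omega))
    · exact decide_eq_decide.mpr (mem_range_tail_iff k (by omega))
  have htrue : colTransfer (colWeight a b x y (· ∈ Set.range (Fin.tail p))
      (· ∈ Set.range (Fin.tail q))) A c true = 0 := by
    by_contra hne
    have := card_of_colTransfer_range_ne_zero (strictAnti_tail hp) (strictAnti_tail hq)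
      (fun i => hA i.succ) (fun i => hA' i.succ) hAc hne
    rw [card_filter_le_of_forall hcp, card_filter_le_of_forall hcq] at this
    simp at this
  have htail : colTransfer (colWeight a b x y (· ∈ Set.range (Fin.tail p))
      (· ∈ Set.range (Fin.tail q))) A R false = colTransfer (colWeight a b x y
        (· ∈ Set.range (Fin.tail p)) (· ∈ Set.range (Fin.tail q))) A c false *
          ∏ k ∈ Finset.Ioc c R, (1 - b k * x) := by
    refine (colTransfer_empty hAc (by omega) ?_ ?_).1
    · rintro _ hk _ ⟨i, rfl⟩
      have := hcp i
      omega
    · rintro _ hk _ ⟨i, rfl⟩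
      have := hcq i
      omega
  have hp0 : c + 1 ∈ Set.range p := ⟨0, hc⟩
  rw [htail]
  generalize hF : colTransfer (colWeight a b x y (· ∈ Set.range (Fin.tail p))
    (· ∈ Set.range (Fin.tail q))) A c false = F at *
  rcases hpq.eq_or_lt with heq | hlt'
  · have hq0 : c + 1 ∈ Set.range q := ⟨0, by omega⟩
    rw [(colTransfer_empty (c := c + 1) (by omega) (by omega) (fun k h1 _ => hp_not k h1)
      fun k h1 _ => hq_not k (by omega) (by omega)).1, colTransfer_add_one _ hAc, hbelow, hbelow,
      htrue, hF, ← heq, pathWeight_self, hc,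
      ← prod_Ioc_mul_prod_Ioc (d := c + 1) (by omega : c ≤ c + 1) (by omega),
      prod_Ioc_add_one le_rfl]
    simp only [colWeight, hp0, hq0, decide_true, vertexWeight, Finset.Ioc_self, Finset.prod_empty]
    generalize ∏ k ∈ Finset.Ioc (c + 1) R, (1 - b k * x) = P
    field_simp [hb (c + 1)]
    ring
  · obtain ⟨d, hd⟩ : ∃ d, q 0 = d + 1 := ⟨q 0 - 1, by ring⟩
    have hq0 : d + 1 ∈ Set.range q := ⟨0, hd⟩
    have hqc : c + 1 ∉ Set.range q := hq_not _ le_rfl (by omega)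
    have hpd : d + 1 ∉ Set.range p := hp_not _ (by omega)
    rw [(colTransfer_empty (c := d + 1) (by omega) (by omega) (fun k h1 _ => hp_not k (by omega))
      fun k h1 _ => hq_not k (by omega) (by omega)).1, colTransfer_add_one _ (by omega),
      (colTransfer_empty (c := c + 1) (d := d) (by omega) (by omega) (fun k h1 _ => hp_not k h1)
        fun k h1 _ => hq_not k (by omega) (by omega)).1,
      (colTransfer_empty (c := c + 1) (d := d) (by omega) (by omega) (fun k h1 _ => hp_not k h1)
        fun k h1 _ => hq_not k (by omega) (by omega)).2, colTransfer_add_one _ hAc,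
      colTransfer_add_one _ hAc, hbelow, hbelow,
      htrue, hF, pathWeight_of_lt hlt', hc, hd]
    have e1 : Finset.Ioo (c + 1) (d + 1) = Finset.Ioc (c + 1) d := by
      ext k; simp only [Finset.mem_Ioo, Finset.mem_Ioc]; omega
    have e2 : Finset.Icc (c + 1) (d + 1) = Finset.Ioc c (d + 1) := by
      ext k; simp only [Finset.mem_Icc, Finset.mem_Ioc]; omega
    have hne : ∏ k ∈ Finset.Ioc c (d + 1), (1 - b k * x) ≠ 0 :=
      Finset.prod_ne_zero_iff.mpr fun k _ => hb k
    rw [e1, e2, ← prod_Ioc_mul_prod_Ioc (d := d + 1) (e := R) (by omega : c ≤ d + 1) (by omega)]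
    simp only [colWeight, hp0, hq0, hqc, hpd, decide_true, decide_false, vertexWeight]
    generalize ∏ k ∈ Finset.Ioc c (d + 1), (1 - b k * x) = P1 at *
    generalize ∏ k ∈ Finset.Ioc (d + 1) R, (1 - b k * x) = P2
    generalize ∏ k ∈ Finset.Ioc (c + 1) d, (x - a k) = P3
    field_simp
    ring

/-- A path on top of a system of paths that ends where it begins. -/
theorem colTransfer_succ_touch {p q : Fin (N + 2) → ℤ} (hp : StrictAnti p) (hq : StrictAnti q)
    {A R : ℤ} (hA : ∀ i, A < p i) (hA' : ∀ i, A < q i) (hR : q 0 ≤ R)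
    (hb : ∀ k, 1 - b k * x ≠ 0) (h : p 0 = q 1) :
    colTransfer (colWeight a b x y (· ∈ Set.range p) (· ∈ Set.range q)) A R false =
      (y + a (p 0)) * (∏ k ∈ Finset.Ioo (p 0) (q 0), (x - a k)) /
        (∏ k ∈ Finset.Ioc (p 0) (q 0), (1 - b k * x)) * colTransfer
        (colWeight a b x y (· ∈ Set.range (Fin.tail p)) (· ∈ Set.range (Fin.tail q))) A R false := by
  obtain ⟨c, hc⟩ : ∃ c, p 0 = c + 1 := ⟨p 0 - 1, by ring⟩
  have hq01 : q 1 < q 0 := hq (by simp)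
  have hAc : A ≤ c := by have := hA 0; omega
  have hcp : ∀ i, Fin.tail p i ≤ c := fun i => by
    have : p i.succ < p 0 := hp (Fin.succ_pos i)
    simp only [Fin.tail]
    omega
  have hq1 : ∀ i : Fin (N + 1), q i.succ ≤ q 1 := fun i => hq.antitone (by
    rw [← Fin.succ_zero_eq_one]; exact Fin.succ_le_succ_iff.mpr (Fin.zero_le i))
  have hp_not : ∀ k, c + 1 < k → k ∉ Set.range p := by
    rintro _ hk ⟨i, rfl⟩
    have := hp.antitone (Fin.zero_le i)
    omega
  have hq_not : ∀ k, c + 1 < k → k ≠ q 0 → k ∉ Set.range q := by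
    intro k hk hk0 hkq
    obtain ⟨i, rfl⟩ := (mem_range_tail_iff k hk0).mp hkq
    have : Fin.tail q i ≤ q 1 := hq1 i
    omega
  have hbelow : ∀ s, colTransfer (colWeight a b x y (· ∈ Set.range p) (· ∈ Set.range q)) A c s =
      colTransfer (colWeight a b x y (· ∈ Set.range (Fin.tail p)) (· ∈ Set.range (Fin.tail q)))
        A c s := by
    refine colTransfer_congr hAc fun k _ hk => ?_
    funext l r
    simp only [colWeight]
    congr 1
    · exact decide_eq_decide.mpr (mem_range_tail_iff k (by omega))
    · exact decide_eq_decide.mpr (mem_range_tail_iff k (by omega))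
  have hfalse : colTransfer (colWeight a b x y (· ∈ Set.range (Fin.tail p))
      (· ∈ Set.range (Fin.tail q))) A c false = 0 := by
    by_contra hne
    have := card_of_colTransfer_range_ne_zero (strictAnti_tail hp) (strictAnti_tail hq)
      (fun i => hA i.succ) (fun i => hA' i.succ) hAc hne
    rw [card_filter_le_of_forall hcp] at this
    have h2 : (Finset.univ.filter fun i => Fin.tail q i ≤ c).card < (Finset.univ : Finset
        (Fin (N + 1))).card := by
      refine Finset.card_lt_card (Finset.filter_ssubset.mpr ⟨0, Finset.mem_univ _, ?_⟩)
      have : Fin.tail q 0 = q 1 := rfl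
      omega
    rw [Finset.card_univ, Fintype.card_fin] at h2
    simp only [Bool.toNat_false] at this
    omega
  have hp0 : c + 1 ∈ Set.range p := ⟨0, hc⟩
  have hqc : c + 1 ∈ Set.range q := ⟨1, by omega⟩
  have htp : c + 1 ∉ Set.range (Fin.tail p) := by
    rintro ⟨i, hi⟩
    have := hcp i
    omega
  have htq : c + 1 ∈ Set.range (Fin.tail q) := ⟨0, by rw [← hc, h]; rfl⟩
  have htail : colTransfer (colWeight a b x y (· ∈ Set.range (Fin.tail p))
      (· ∈ Set.range (Fin.tail q))) A R false = colTransfer (colWeight a b x y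
        (· ∈ Set.range (Fin.tail p)) (· ∈ Set.range (Fin.tail q))) A c true * (x + y) *
          ∏ k ∈ Finset.Ioc (c + 1) R, (1 - b k * x) := by
    rw [(colTransfer_empty (c := c + 1) (by omega) (by omega) ?_ ?_).1,
      colTransfer_add_one _ hAc, hfalse]
    · simp only [colWeight, htp, htq, decide_true, decide_false, vertexWeight]
      ring
    · rintro _ hk _ ⟨i, rfl⟩
      have := hcp i
      omega
    · rintro _ hk _ ⟨i, rfl⟩
      have : Fin.tail q i ≤ q 1 := hq1 i
      omega
  rw [htail]
  generalize hF : colTransfer (colWeight a b x y (· ∈ Set.range (Fin.tail p))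
    (· ∈ Set.range (Fin.tail q))) A c true = F at *
  obtain ⟨d, hd⟩ : ∃ d, q 0 = d + 1 := ⟨q 0 - 1, by ring⟩
  have hq0 : d + 1 ∈ Set.range q := ⟨0, hd⟩
  have hpd : d + 1 ∉ Set.range p := hp_not _ (by omega)
  rw [(colTransfer_empty (c := d + 1) (by omega) (by omega) (fun k h1 _ => hp_not k (by omega))
    fun k h1 _ => hq_not k (by omega) (by omega)).1, colTransfer_add_one _ (by omega),
    (colTransfer_empty (c := c + 1) (d := d) (by omega) (by omega) (fun k h1 _ => hp_not k h1)
      fun k h1 _ => hq_not k (by omega) (by omega)).1,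
    (colTransfer_empty (c := c + 1) (d := d) (by omega) (by omega) (fun k h1 _ => hp_not k h1)
      fun k h1 _ => hq_not k (by omega) (by omega)).2, colTransfer_add_one _ hAc,
    colTransfer_add_one _ hAc, hbelow, hbelow, hfalse, hF, hc, hd]
  have e1 : Finset.Ioo (c + 1) (d + 1) = Finset.Ioc (c + 1) d := by
    ext k; simp only [Finset.mem_Ioo, Finset.mem_Ioc]; omega
  have hne : ∏ k ∈ Finset.Ioc (c + 1) (d + 1), (1 - b k * x) ≠ 0 :=
    Finset.prod_ne_zero_iff.mpr fun k _ => hb k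
  rw [e1, ← prod_Ioc_mul_prod_Ioc (d := d + 1) (e := R) (by omega : c + 1 ≤ d + 1) (by omega)]
  simp only [colWeight, hp0, hq0, hqc, hpd, decide_true, decide_false, vertexWeight]
  generalize ∏ k ∈ Finset.Ioc (c + 1) (d + 1), (1 - b k * x) = P1 at *
  generalize ∏ k ∈ Finset.Ioc (d + 1) R, (1 - b k * x) = P2
  generalize ∏ k ∈ Finset.Ioc (c + 1) d, (x - a k) = P3
  field_simp
  ring

/-- A row of the six vertex model as a minor of the matrix of path weights. -/
theorem colTransfer_eq_minor (hb : ∀ k, 1 - b k * x ≠ 0) {A R : ℤ} (hAR : A ≤ R)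
    (p q : Fin N → ℤ) (hp : StrictAnti p) (hq : StrictAnti q) (hA : ∀ i, A < p i)
    (hA' : ∀ i, A < q i) (hR : ∀ i, p i ≤ R) (hR' : ∀ i, q i ≤ R) :
    colTransfer (colWeight a b x y (· ∈ Set.range p) (· ∈ Set.range q)) A R false =
      (∏ k ∈ Finset.Ioc A R, (1 - b k * x)) * minor (pathWeight a b x y) p q := by
  induction N with
  | zero =>
    rw [(colTransfer_empty le_rfl hAR (by simp) (by simp)).1, colTransfer_self, minor_zero]
    simp
  | succ N ih =>
    have ih' := ih (Fin.tail p) (Fin.tail q) (strictAnti_tail hp) (strictAnti_tail hq)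
      (fun i => hA i.succ) (fun i => hA' i.succ) (fun i => hR i.succ) (fun i => hR' i.succ)
    have hvanish : ∀ c, A ≤ c → c ≤ R → (∀ s : Bool, (Finset.univ.filter fun i => p i ≤ c).card ≠
        (Finset.univ.filter fun i => q i ≤ c).card + s.toNat) →
        colTransfer (colWeight a b x y (· ∈ Set.range p) (· ∈ Set.range q)) A R false = 0 := by
      intro c h1 h2 h3
      refine colTransfer_eq_zero h1 h2 (fun s => ?_) false
      by_contra hne
      exact h3 s (card_of_colTransfer_range_ne_zero hp hq hA hA' h1 hne)
    rcases lt_or_ge (q 0) (p 0) with hlt | hpq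
    · rw [minor_eq_zero_of_lt _ p q hq hlt, mul_zero]
      refine hvanish (p 0 - 1) (by have := hA 0; omega) (by have := hR 0; omega) fun s => ?_
      have h1 : (Finset.univ.filter fun i => q i ≤ p 0 - 1).card = N + 1 :=
        card_filter_le_of_forall fun i => by
          have := hq.antitone (Fin.zero_le i)
          omega
      have h2 : (Finset.univ.filter fun i => p i ≤ p 0 - 1).card < (Finset.univ : Finset
          (Fin (N + 1))).card :=
        Finset.card_lt_card (Finset.filter_ssubset.mpr ⟨0, Finset.mem_univ _, by omega⟩)
      rw [Finset.card_univ, Fintype.card_fin] at h2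
      omega
    by_cases hN : ∀ i, Fin.tail q i < p 0
    · rw [colTransfer_succ hp hq hA hA' (hR' 0) hb hpq hN, ih',
        minor_succ_of_row _ p q fun j =>
          IncidenceAlgebra.apply_eq_zero_of_not_le (not_le.mpr (hN j)) _]
      ring
    · cases N with
      | zero => exact absurd (fun i => i.elim0) hN
      | succ N =>
        have h01 : p 0 ≤ q 1 := by
          push Not at hN
          obtain ⟨i, hi⟩ := hN
          exact hi.trans (hq.antitone (by
            rw [← Fin.succ_zero_eq_one]; exact Fin.succ_le_succ_iff.mpr (Fin.zero_le i)))
        rcases h01.eq_or_lt with h01 | h01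
        · rw [colTransfer_succ_touch hp hq hA hA' (hR' 0) hb h01, ih',
            minor_pathWeight_touch p q hp hq h01 (hb _)]
          ring
        · rw [minor_pathWeight_eq_zero p q hp hq h01, mul_zero]
          refine hvanish (p 0) (hA 0).le (hR 0) fun s => ?_
          have h1 : (Finset.univ.filter fun i => p i ≤ p 0).card = N + 2 :=
            card_filter_le_of_forall fun i => hp.antitone (Fin.zero_le i)
          have h2 : (Finset.univ.filter fun i => q i ≤ p 0) ⊆
              (Finset.univ.erase 0).erase 1 := by
            intro i hi
            have hi' := (Finset.mem_filter.mp hi).2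
            have h10 : q 1 < q 0 := hq (by simp)
            simp only [Finset.mem_erase, Finset.mem_univ, and_true]
            constructor
            · rintro rfl
              omega
            · rintro rfl
              omega
          have h3 := Finset.card_le_card h2
          rw [Finset.card_erase_of_mem (by simp), Finset.card_erase_of_mem (by simp),
            Finset.card_univ, Fintype.card_fin] at h3
          have h4 : s.toNat ≤ 1 := s.toNat_le
          omega

end RowMinor

section RowOperator

variable {K : Type*} [Field K] {N : ℕ}

theorem stableValue_eq {f : ℕ × ℕ → K} {c : K} (h : ∀ᶠ p in Filter.atTop, f p = c) :
    stableValue f = c := by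
  have hex : ∃ c : K, ∀ᶠ p in Filter.atTop, f p = c := ⟨c, h⟩
  rw [stableValue, dif_pos hex]
  obtain ⟨p, h1, h2⟩ := (hex.choose_spec.and h).exists
  rw [← h1, h2]

theorem occupied_iff (lam : YoungDiagram) {n : ℕ} (hn : lam.colLen 0 ≤ n) {k : ℤ}
    (hk : -(n : ℤ) < k) : occupied (lam, 0) k ↔ k ∈ Set.range (particles n lam) := by
  constructor
  · rintro ⟨i, hi⟩
    simp only [add_zero] at hi
    have hin : i < n := by
      by_contra hc
      have := (rowLen_eq_zero_iff lam i).mpr (by omega)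
      omega
    exact ⟨⟨i, hin⟩, hi.symm⟩
  · rintro ⟨i, rfl⟩
    exact ⟨i, by simp [particles]⟩

theorem minor_particles_succ (A : IncidenceAlgebra K ℤ) (mu lam : YoungDiagram) {n : ℕ}
    (hmu : mu.colLen 0 ≤ n) (hlam : lam.colLen 0 ≤ n) :
    minor A (particles (n + 1) mu) (particles (n + 1) lam) =
      minor A (particles n mu) (particles n lam) * A (-(n : ℤ)) (-(n : ℤ)) := by
  have h1 : ∀ v : YoungDiagram, v.colLen 0 ≤ n → particles (n + 1) v (Fin.last n) = -(n : ℤ) := by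
    intro v hv
    simp [particles, (rowLen_eq_zero_iff v n).mpr hv]
  have h2 : ∀ i : Fin n, A (particles (n + 1) mu i.castSucc) (-(n : ℤ)) = 0 := by
    intro i
    refine IncidenceAlgebra.apply_eq_zero_of_not_le ?_ A
    have := neg_le_particles mu i.castSucc
    have hi := i.2
    simp only [Fin.val_castSucc] at this
    omega
  unfold minor
  rw [Matrix.det_succ_column _ (Fin.last n), Fin.sum_univ_castSucc, Finset.sum_eq_zero]
  · simp only [Matrix.of_apply, h1 mu hmu, h1 lam hlam, Fin.val_last, ← two_mul, zero_add,
      Fin.succAbove_last, Even.neg_pow (even_two_mul n), one_pow, one_mul]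
    rw [mul_comm]
    congr 1
  · intro i _
    simp only [Matrix.of_apply, h1 lam hlam, h2, mul_zero, zero_mul]

variable {a b : ℤ → K} {x y : K}

/-- Weight of the first `n` nonpositive empty columns divided by that of the full ones. -/
noncomputable def vacuumFactor (b : ℤ → K) (x y : K) (n : ℕ) : K :=
  ∏ i ∈ Finset.range n, ((1 - b (-(i : ℤ)) * x) / (1 + b (-(i : ℤ)) * y))

theorem vacuumFactor_mul_minor (hb : ∀ k, 1 - b k * x ≠ 0) (hy : ∀ k, 1 + b k * y ≠ 0)
    {mu lam : YoungDiagram} (hmu : mu.colLen 0 ≤ N) (hlam : lam.colLen 0 ≤ N) {n : ℕ} (h : N ≤ n) :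
    vacuumFactor b x y n * minor (pathWeight a b x y) (particles n mu) (particles n lam) =
      vacuumFactor b x y N * minor (pathWeight a b x y) (particles N mu) (particles N lam) := by
  induction n, h using Nat.le_induction with
  | base => rfl
  | succ n h ih =>
    rw [← ih, minor_particles_succ _ _ _ (hmu.trans h) (hlam.trans h), pathWeight_self,
      vacuumFactor, vacuumFactor, Finset.prod_range_succ]
    have h1 := hb (-(n : ℤ))
    have h2 := hy (-(n : ℤ))
    generalize ∏ i ∈ Finset.range n, ((1 - b (-(i : ℤ)) * x) / (1 + b (-(i : ℤ)) * y)) = P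
    generalize 1 - b (-(n : ℤ)) * x = s at *
    generalize 1 + b (-(n : ℤ)) * y = t at *
    field_simp

theorem finiteRow_eq_minor (hb : ∀ k, 1 - b k * x ≠ 0) {mu lam : YoungDiagram} {n m : ℕ}
    (hmu : mu.colLen 0 ≤ n) (hlam : lam.colLen 0 ≤ n) (hmu' : mu.rowLen 0 ≤ m)
    (hlam' : lam.rowLen 0 ≤ m) :
    finiteRow a b x y n m (occupied (mu, 0)) (occupied (lam, 0)) =
      (∏ k ∈ Finset.Ioc (-(n : ℤ)) m, (1 - b k * x)) *
        minor (pathWeight a b x y) (particles n mu) (particles n lam) := by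
  have hlo : ∀ (v : YoungDiagram) (i : Fin n), -(n : ℤ) < particles n v i := by
    intro v i
    have := neg_le_particles v i
    omega
  have hhi : ∀ (v : YoungDiagram), v.rowLen 0 ≤ m → ∀ i : Fin n, particles n v i ≤ m := by
    intro v hv i
    have := v.rowLen_anti 0 i (Nat.zero_le _)
    simp only [particles]
    omega
  rw [finiteRow_eq_colTransfer, ← colTransfer_eq_minor hb (by omega) _ _ (particles_strictAnti n mu)
    (particles_strictAnti n lam) (hlo mu) (hlo lam) (hhi mu hmu') (hhi lam hlam')]
  refine colTransfer_congr (by omega) (fun k hk _ => ?_) _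
  funext l r
  simp only [colWeight]
  congr 1
  · exact decide_eq_decide.mpr (occupied_iff mu hmu hk)
  · exact decide_eq_decide.mpr (occupied_iff lam hlam hk)

theorem rowOperator_eq_minor (hb : ∀ k, 1 - b k * x ≠ 0) (hy : ∀ k, 1 + b k * y ≠ 0)
    {mu lam : YoungDiagram} (hmu : mu.colLen 0 ≤ N) (hlam : lam.colLen 0 ≤ N) :
    rowOperator a b x y (mu, 0) (lam, 0) = vacuumFactor b x y N *
      minor (pathWeight a b x y) (particles N mu) (particles N lam) := by
  refine stableValue_eq ?_
  filter_upwards [Filter.eventually_ge_atTop (N, max (mu.rowLen 0) (lam.rowLen 0))] with p hp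
  obtain ⟨h1, h2⟩ := Prod.le_def.mp hp
  simp only at h1 h2
  rw [finiteRow_eq_minor hb (hmu.trans h1) (hlam.trans h1) ((le_max_left _ _).trans h2)
    ((le_max_right _ _).trans h2), ← vacuumFactor_mul_minor hb hy hmu hlam h1, prod_Ioc_neg,
    vacuumFactor, Finset.prod_div_distrib, shiftedOnePow, shiftedOnePow]
  have e : ∀ i : ℕ, 1 - dualSeq b ((i : ℤ) + 1) * y = 1 + b (-(i : ℤ)) * y := by
    intro i
    rw [dualSeq, show -((i : ℤ) + 1) + 1 = -(i : ℤ) by ring]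
    ring
  simp only [e]
  have n1 : ∏ i ∈ Finset.range p.1, (1 + b (-(i : ℤ)) * y) ≠ 0 :=
    Finset.prod_ne_zero_iff.mpr fun i _ => hy _
  have n2 : ∏ i ∈ Finset.range p.2, (1 - b ((i : ℤ) + 1) * x) ≠ 0 :=
    Finset.prod_ne_zero_iff.mpr fun i _ => hb _
  generalize ∏ i ∈ Finset.range p.1, (1 + b (-(i : ℤ)) * y) = P1 at *
  generalize ∏ i ∈ Finset.range p.2, (1 - b ((i : ℤ) + 1) * x) = P2 at *
  generalize ∏ i ∈ Finset.range p.1, (1 - b (-(i : ℤ)) * x) = P3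
  field_simp

theorem card_filter_occupied (u : YoungDiagram) (c : ℤ) {n m : ℕ}
    (hn : (u.colLen 0 : ℤ) - c ≤ n) (hm : (u.rowLen 0 : ℤ) + c ≤ m)
    [DecidablePred (occupied (u, c))] :
    (((Finset.Ioc (-(n : ℤ)) m).filter (occupied (u, c))).card : ℤ) = n + c := by
  have h : ((Finset.Ioc (-(n : ℤ)) m).filter (occupied (u, c))).card = (n + c).toNat := by
    rw [← Finset.card_range (n + c).toNat]
    symm
    refine Finset.card_bij (fun i _ => (u.rowLen i : ℤ) - i + c) ?_ ?_ ?_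
    · intro i hi
      rw [Finset.mem_range] at hi
      have := u.rowLen_anti 0 i (Nat.zero_le _)
      exact Finset.mem_filter.mpr ⟨Finset.mem_Ioc.mpr ⟨by omega, by omega⟩, i, rfl⟩
    · intro i _ j _ hij
      rcases lt_trichotomy i j with h | h | h
      · have := u.rowLen_anti i j h.le
        omega
      · exact h
      · have := u.rowLen_anti j i h.le
        omega
    · intro k hk
      obtain ⟨hk, i, hi⟩ := Finset.mem_filter.mp hk
      simp only at hi
      rw [Finset.mem_Ioc] at hk
      refine ⟨i, ?_, hi.symm⟩
      rw [Finset.mem_range]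
      by_contra hc
      have := (rowLen_eq_zero_iff u i).mpr (by omega)
      omega
  rw [h]
  omega

theorem rowOperator_eq_zero_of_charge {mu u : YoungDiagram} {c : ℤ} (hc : c ≠ 0) :
    rowOperator a b x y (mu, 0) (u, c) = 0 := by
  classical
  refine stableValue_eq ?_
  filter_upwards [Filter.eventually_ge_atTop (mu.colLen 0 + u.colLen 0 + c.natAbs,
    mu.rowLen 0 + u.rowLen 0 + c.natAbs)] with p hp
  obtain ⟨h1, h2⟩ := Prod.le_def.mp hp
  simp only at h1 h2
  have : finiteRow a b x y p.1 p.2 (occupied (mu, 0)) (occupied (u, c)) = 0 := by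
    rw [finiteRow_eq_colTransfer]
    by_contra hne
    have h := card_of_colTransfer_ne_zero (by omega) hne
    have e1 := card_filter_occupied mu 0 (n := p.1) (m := p.2) (by omega) (by omega)
    have e2 := card_filter_occupied u c (n := p.1) (m := p.2) (by omega) (by omega)
    simp only [Bool.toNat_false] at h
    omega
  rw [this, zero_div]

theorem minor_one_of_ne {p q : Fin N → ℤ} (hp : StrictAnti p) (hq : StrictAnti q) (h : p ≠ q) :
    minor (1 : IncidenceAlgebra K ℤ) p q = 0 := by
  classical
  have : ∃ i, ∀ j, p i ≠ q j := by
    by_contra! hc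
    apply h
    refine (hp.range_inj hq).mp ?_
    have hsub : Finset.univ.image p ⊆ Finset.univ.image q := by
      intro k hk
      obtain ⟨i, _, rfl⟩ := Finset.mem_image.mp hk
      obtain ⟨j, hj⟩ := hc i
      exact Finset.mem_image.mpr ⟨j, Finset.mem_univ _, hj.symm⟩
    have heq := Finset.eq_of_subset_of_card_le hsub (by
      rw [Finset.card_image_of_injective _ hp.injective,
        Finset.card_image_of_injective _ hq.injective])
    simpa using congrArg (fun s : Finset ℤ => (s : Set ℤ)) heq
  obtain ⟨i, hi⟩ := this
  exact Matrix.det_eq_zero_of_row_eq_zero i fun j => by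
    rw [Matrix.of_apply, IncidenceAlgebra.one_apply, if_neg (hi j)]

theorem minor_one_self {p : Fin N → ℤ} (hp : StrictAnti p) :
    minor (1 : IncidenceAlgebra K ℤ) p p = 1 := by
  rw [minor_self _ _ hp]
  simp

/-- Products of row operators as minors of the product of the matrices of path weights. -/
theorem rowProduct_eq_minor (l : List (K × K)) (hb : ∀ r ∈ l, ∀ k, 1 - b k * r.1 ≠ 0)
    (hy : ∀ r ∈ l, ∀ k, 1 + b k * r.2 ≠ 0) {mu lam : YoungDiagram} {N : ℕ}
    (hmu : mu.colLen 0 ≤ N) (hlam : lam.colLen 0 ≤ N) :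
    rowProduct a b l (mu, 0) (lam, 0) = (l.map fun r => vacuumFactor b r.1 r.2 N).prod *
      minor (l.map fun r => pathWeight a b r.1 r.2).prod (particles N mu) (particles N lam) := by
  classical
  induction l generalizing mu N with
  | nil =>
    simp only [rowProduct, List.map_nil, List.prod_nil, one_mul]
    by_cases h : mu = lam
    · rw [h, if_pos rfl, minor_one_self (particles_strictAnti N lam)]
    · rw [if_neg (by simpa using h), minor_one_of_ne (particles_strictAnti N mu)
        (particles_strictAnti N lam) fun h' => h (particles_injOn hmu hlam h')]
  | cons r l ih =>
    have ih' := fun {mu} {N} => ih (fun r hr => hb r (List.mem_cons_of_mem _ hr))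
      (fun r hr => hy r (List.mem_cons_of_mem _ hr)) (mu := mu) (N := N)
    have hsupp : Function.support (fun u : ChargedPartition =>
        rowOperator a b r.1 r.2 (mu, 0) u * rowProduct a b l u (lam, 0)) ⊆
        ((subdiagrams lam).image fun u => ((u, 0) : ChargedPartition)) := by
      rintro ⟨u, c⟩ hu
      rw [Function.mem_support] at hu
      have hc : c = 0 := by
        by_contra hc
        exact hu (by rw [rowOperator_eq_zero_of_charge hc, zero_mul])
      subst hc
      have hu' := right_ne_zero_of_mul hu
      rw [ih' (le_max_left (u.colLen 0) N) (hlam.trans (le_max_right (u.colLen 0) N))] at hu'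
      have := le_of_minor_ne_zero (le_max_left (u.colLen 0) N) (right_ne_zero_of_mul hu')
      simpa [mem_subdiagrams] using this
    rw [rowProduct, finsum_eq_sum_of_support_subset _ hsupp,
      Finset.sum_image fun _ _ _ _ h => (Prod.mk.inj h).1, List.map_cons,
      List.prod_cons, List.map_cons, List.prod_cons, minor_mul_particles _ _ mu lam
        (subdiagrams lam) (fun u hu => (colLen_le_of_le (mem_subdiagrams.mp hu)).trans hlam)
        (fun u _ _ hu => mem_subdiagrams.mpr hu) hmu, Finset.mul_sum]
    refine Finset.sum_congr rfl fun u hu => ?_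
    have huN := (colLen_le_of_le (mem_subdiagrams.mp hu)).trans hlam
    rw [ih' huN hlam, rowOperator_eq_minor (hb r List.mem_cons_self) (hy r List.mem_cons_self)
      hmu huN]
    ring

end RowOperator

section Strips

variable {K : Type*} [Field K] {N : ℕ}

/-- The matrix whose minors are the weights of horizontal strips. -/
noncomputable def horizontalMatrix (wt : ℤ → K) : IncidenceAlgebra K ℤ where
  toFun p q := if p ≤ q then ∏ c ∈ Finset.Ico p q, wt c else 0
  eq_zero_of_not_le' _ _ h := if_neg h

/-- The matrix whose minors are the weights of vertical strips. -/
noncomputable def verticalMatrix (wt : ℤ → K) : IncidenceAlgebra K ℤ where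
  toFun p q := if p ≤ q ∧ q ≤ p + 1 then ∏ c ∈ Finset.Ico p q, wt c else 0
  eq_zero_of_not_le' _ _ h := if_neg fun h' => h h'.1

theorem horizontalMatrix_apply (wt : ℤ → K) {p q : ℤ} (h : p ≤ q) :
    horizontalMatrix wt p q = ∏ c ∈ Finset.Ico p q, wt c :=
  if_pos h

theorem verticalMatrix_apply (wt : ℤ → K) (p q : ℤ) :
    verticalMatrix wt p q = if p ≤ q ∧ q ≤ p + 1 then ∏ c ∈ Finset.Ico p q, wt c else 0 :=
  rfl

theorem minor_horizontalMatrix_of_strip (wt : ℤ → K) (p q : Fin N → ℤ) (h : ∀ i, p i ≤ q i)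
    (h' : ∀ i j, i < j → q j < p i) :
    minor (horizontalMatrix wt) p q = ∏ i, ∏ c ∈ Finset.Ico (p i) (q i), wt c := by
  induction N with
  | zero => rw [minor_zero]; simp
  | succ N ih =>
    rw [minor_succ_of_row _ p q fun j => IncidenceAlgebra.apply_eq_zero_of_not_le
      (not_le.mpr (h' 0 j.succ (Fin.succ_pos j))) _, horizontalMatrix_apply _ (h 0),
      ih (Fin.tail p) (Fin.tail q) (fun i => h i.succ)
        (fun i j hij => h' _ _ (Fin.succ_lt_succ_iff.mpr hij)), Fin.prod_univ_succ]
    rfl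

theorem minor_horizontalMatrix_eq_zero (wt : ℤ → K) (p q : Fin N → ℤ) (hp : StrictAnti p)
    (hq : StrictAnti q) {i j : Fin N} (hij : i < j) (h : p i ≤ q j) :
    minor (horizontalMatrix wt) p q = 0 := by
  induction N with
  | zero => exact i.elim0
  | succ N ih =>
    cases N with
    | zero => omega
    | succ N =>
      rcases lt_or_ge (q 1) (p 0) with h1 | h1
      · rw [minor_succ_of_row]
        · cases i using Fin.cases with
          | zero =>
            have : q j ≤ q 1 := hq.antitone (Fin.le_def.mpr (by
              have := Fin.lt_def.mp hij
              simp only [Fin.val_zero, Fin.val_one] at this ⊢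
              omega))
            omega
          | succ i =>
            cases j using Fin.cases with
            | zero => exact absurd hij (Fin.not_lt_zero _)
            | succ j =>
              rw [ih (Fin.tail p) (Fin.tail q) (strictAnti_tail hp) (strictAnti_tail hq)
                (Fin.succ_lt_succ_iff.mp hij) h, mul_zero]
        · intro k
          refine IncidenceAlgebra.apply_eq_zero_of_not_le ?_ _
          have : q k.succ ≤ q 1 := hq.antitone (by
            rw [← Fin.succ_zero_eq_one]; exact Fin.succ_le_succ_iff.mpr (Fin.zero_le k))
          omega
      · have hq01 : q 1 < q 0 := hq (by simp)
        have hcol : ∀ k, horizontalMatrix wt (p k) (q 0) =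
            (∏ c ∈ Finset.Ico (q 1) (q 0), wt c) * horizontalMatrix wt (p k) (q 1) := by
          intro k
          have := hp.antitone (Fin.zero_le k)
          rw [horizontalMatrix_apply _ (by omega), horizontalMatrix_apply _ (by omega), mul_comm,
            prod_Ico_mul_prod_Ico (by omega) hq01.le]
        rw [minor_succ_of_col_sub _ p q _ fun k => hcol k.succ, hcol 0, sub_self, zero_mul]

theorem minor_verticalMatrix_of_strip (wt : ℤ → K) (p q : Fin N → ℤ) (hp : StrictAnti p)
    (hq : StrictAnti q) (h : ∀ i, p i ≤ q i) (h' : ∀ i, q i ≤ p i + 1) :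
    minor (verticalMatrix wt) p q = ∏ i, ∏ c ∈ Finset.Ico (p i) (q i), wt c := by
  induction N with
  | zero => rw [minor_zero]; simp
  | succ N ih =>
    have hpeel : minor (verticalMatrix wt) p q =
        verticalMatrix wt (p 0) (q 0) * minor (verticalMatrix wt) (Fin.tail p) (Fin.tail q) := by
      rcases (h 0).eq_or_lt with h0 | h0
      · refine minor_succ_of_row _ p q fun j => ?_
        have := hq (Fin.succ_pos j)
        exact IncidenceAlgebra.apply_eq_zero_of_not_le (by omega) _
      · refine minor_succ_of_col _ p q fun i => ?_
        have := hp (Fin.succ_pos i)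
        rw [verticalMatrix_apply, if_neg (by omega)]
    rw [hpeel, verticalMatrix_apply, if_pos ⟨h 0, h' 0⟩, ih (Fin.tail p) (Fin.tail q)
      (strictAnti_tail hp) (strictAnti_tail hq) (fun i => h i.succ) (fun i => h' i.succ),
      Fin.prod_univ_succ]
    rfl

theorem minor_verticalMatrix_eq_zero (wt : ℤ → K) (p q : Fin N → ℤ) (hp : StrictAnti p)
    (hq : StrictAnti q) (h : ∀ i, p i ≤ q i) {i : Fin N} (hi : p i + 1 < q i) :
    minor (verticalMatrix wt) p q = 0 := by
  induction N with
  | zero => exact i.elim0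
  | succ N ih =>
    rcases lt_or_ge (p 0 + 1) (q 0) with h0 | h0
    · refine Matrix.det_eq_zero_of_column_eq_zero 0 fun k => ?_
      have := hp.antitone (Fin.zero_le k)
      rw [Matrix.of_apply, verticalMatrix_apply, if_neg (by omega)]
    · have hz : ∀ i : Fin N, p i.succ + 1 < q i.succ →
          minor (verticalMatrix wt) (Fin.tail p) (Fin.tail q) = 0 := fun i hi =>
        ih (Fin.tail p) (Fin.tail q) (strictAnti_tail hp) (strictAnti_tail hq)
          (fun i => h i.succ) hi
      have hz' : minor (verticalMatrix wt) (Fin.tail p) (Fin.tail q) = 0 := by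
        cases i using Fin.cases with
        | zero => omega
        | succ i => exact hz i hi
      rcases (h 0).eq_or_lt with h1 | h1
      · rw [minor_succ_of_row _ p q, hz', mul_zero]
        intro j
        have := hq (Fin.succ_pos j)
        exact IncidenceAlgebra.apply_eq_zero_of_not_le (by omega) _
      · rw [minor_succ_of_col _ p q, hz', mul_zero]
        intro k
        have := hp (Fin.succ_pos k)
        rw [verticalMatrix_apply, if_neg (by omega)]

theorem mem_sdiff_cells {mu lam : YoungDiagram} {c : ℕ × ℕ} :
    c ∈ lam.cells \ mu.cells ↔ mu.rowLen c.1 ≤ c.2 ∧ c.2 < lam.rowLen c.1 := by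
  rw [Finset.mem_sdiff, YoungDiagram.mem_cells, YoungDiagram.mem_cells, ← Prod.mk.eta (p := c),
    YoungDiagram.mem_iff_lt_rowLen, YoungDiagram.mem_iff_lt_rowLen]
  simp only
  omega

/-- The boxes of `λ/μ`, listed by rows and contents. -/
theorem prod_particles_eq_prod_cells (wt : ℤ → K) {mu lam : YoungDiagram}
    (hlam : lam.colLen 0 ≤ N) :
    ∏ i, ∏ c ∈ Finset.Ico (particles N mu i) (particles N lam i), wt c =
      ∏ c ∈ lam.cells \ mu.cells, wt ((c.2 : ℤ) - c.1) := by
  rw [Finset.prod_sigma']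
  refine Finset.prod_bij' (fun s _ => ((s.1 : ℕ), (s.2 + s.1).toNat))
    (fun c hc => ⟨⟨c.1, ?_⟩, (c.2 : ℤ) - c.1⟩) ?_ ?_ ?_ ?_ ?_
  · have := (mem_sdiff_cells.mp hc).2
    by_contra h
    have := (rowLen_eq_zero_iff lam c.1).mpr (by omega)
    omega
  · rintro ⟨i, c⟩ h
    simp only [Finset.mem_sigma, Finset.mem_univ, true_and, Finset.mem_Ico, particles] at h
    rw [mem_sdiff_cells]
    simp only
    omega
  · intro c hc
    have := mem_sdiff_cells.mp hc
    simp only [Finset.mem_sigma, Finset.mem_univ, true_and, Finset.mem_Ico, particles]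
    omega
  · rintro ⟨i, c⟩ h
    simp only [Finset.mem_sigma, Finset.mem_univ, true_and, Finset.mem_Ico, particles] at h
    refine Sigma.ext rfl (heq_of_eq ?_)
    simp only
    omega
  · intro c hc
    refine Prod.ext rfl ?_
    simp
  · rintro ⟨i, c⟩ h
    simp only [Finset.mem_sigma, Finset.mem_univ, true_and, Finset.mem_Ico, particles] at h
    simp only
    congr 1
    omega

/-- The matrix of a letter of a supertableau alphabet. -/
noncomputable def letterMatrix (primed : Prop) [Decidable primed] (wt : ℤ → K) :
    IncidenceAlgebra K ℤ :=
  if primed then verticalMatrix wt else horizontalMatrix wt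

/-- `λ/μ` has at most one box in each row (`primed`) or in each column (not `primed`). -/
def IsStrip (primed : Prop) (lam mu : YoungDiagram) : Prop :=
  ∀ c ∈ lam.cells \ mu.cells, ∀ d ∈ lam.cells \ mu.cells,
    (primed → c.1 = d.1 → c = d) ∧ (¬ primed → c.2 = d.2 → c = d)

open Classical in
theorem minor_letterMatrix (primed : Prop) [Decidable primed] (wt : ℤ → K) {mu lam : YoungDiagram}
    (hle : mu ≤ lam) (hlam : lam.colLen 0 ≤ N) :
    minor (letterMatrix primed wt) (particles N mu) (particles N lam) =
      if IsStrip primed lam mu then ∏ c ∈ lam.cells \ mu.cells, wt ((c.2 : ℤ) - c.1) else 0 := by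
  have hrow := le_iff_rowLen_le.mp hle
  have hle' : ∀ i, particles N mu i ≤ particles N lam i := fun i => by
    have := hrow i
    simp only [particles]
    omega
  have hpos : ∀ i, 0 < lam.rowLen i → i < N := by
    intro i hi
    by_contra h
    have := (rowLen_eq_zero_iff lam i).mpr (by omega)
    omega
  by_cases hpr : primed
  · rw [letterMatrix, if_pos hpr]
    by_cases hs : ∀ i : Fin N, particles N lam i ≤ particles N mu i + 1
    · rw [minor_verticalMatrix_of_strip _ _ _ (particles_strictAnti N mu)
        (particles_strictAnti N lam) hle' hs, prod_particles_eq_prod_cells wt hlam, if_pos]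
      intro c hc d hd
      refine ⟨fun _ h => Prod.ext h ?_, fun h => absurd hpr h⟩
      rw [mem_sdiff_cells] at hc hd
      have h1 := hs ⟨c.1, hpos _ (by omega)⟩
      simp only [particles] at h1
      rw [h] at h1 hc
      omega
    · push Not at hs
      obtain ⟨i, hi⟩ := hs
      rw [minor_verticalMatrix_eq_zero _ _ _ (particles_strictAnti N mu)
        (particles_strictAnti N lam) hle' hi, if_neg]
      intro hst
      simp only [particles] at hi
      have := (hst (i, mu.rowLen i) (mem_sdiff_cells.mpr ⟨le_rfl, by simp only; omega⟩)
        (i, mu.rowLen i + 1) (mem_sdiff_cells.mpr ⟨by simp only; omega, by simp only; omega⟩)).1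
        hpr rfl
      simp at this
  · rw [letterMatrix, if_neg hpr]
    by_cases hs : ∀ i j : Fin N, i < j → particles N lam j < particles N mu i
    · rw [minor_horizontalMatrix_of_strip _ _ _ hle' hs, prod_particles_eq_prod_cells wt hlam,
        if_pos]
      have key : ∀ c ∈ lam.cells \ mu.cells, ∀ d ∈ lam.cells \ mu.cells, c.2 = d.2 → ¬ c.1 < d.1 := by
        intro c hc d hd h hlt
        rw [mem_sdiff_cells] at hc hd
        have hd1 := hpos d.1 (by omega)
        have h1 := hs ⟨c.1, by omega⟩ ⟨c.1 + 1, by omega⟩ (Fin.lt_def.mpr (by simp))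
        have h2 := lam.rowLen_anti (c.1 + 1) d.1 hlt
        simp only [particles] at h1
        omega
      intro c hc d hd
      refine ⟨fun h => absurd h hpr, fun _ h => Prod.ext ?_ h⟩
      have h1 := key c hc d hd h
      have h2 := key d hd c hc h.symm
      omega
    · push Not at hs
      obtain ⟨i, j, hij, h⟩ := hs
      rw [minor_horizontalMatrix_eq_zero _ _ _ (particles_strictAnti N mu)
        (particles_strictAnti N lam) hij h, if_neg]
      intro hst
      have hij' : (i : ℕ) + 1 ≤ j := hij
      have h1 : (lam.rowLen (i + 1) : ℤ) > mu.rowLen i := by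
        have := (particles_strictAnti N lam).antitone
          (show (⟨i + 1, by omega⟩ : Fin N) ≤ j from Fin.le_def.mpr hij')
        simp only [particles] at this h
        push_cast at this
        omega
      have h2 := mu.rowLen_anti i (i + 1) (Nat.le_succ _)
      have h3 := lam.rowLen_anti i (i + 1) (Nat.le_succ _)
      have := (hst (i, mu.rowLen i) (mem_sdiff_cells.mpr ⟨le_rfl, by simp only; omega⟩)
        (i + 1, mu.rowLen i) (mem_sdiff_cells.mpr ⟨by simp only; omega, by simp only; omega⟩)).2
        hpr rfl
      simp at this

end Strips

section Tableaux

variable {K : Type*} [Field K] {L : Type*}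

theorem mem_skew {lam mu : YoungDiagram} (p : SkewCell lam mu) : p.1 ∈ lam ∧ p.1 ∉ mu :=
  Finset.mem_sdiff.mp p.2

/-- The inclusion of the boxes of `λ/ν` into those of `λ/μ`. -/
def skewInclusion {lam mu nu : YoungDiagram} (h : mu ≤ nu) (p : SkewCell lam nu) :
    SkewCell lam mu :=
  ⟨p.1, Finset.sdiff_subset_sdiff subset_rfl (YoungDiagram.cells_subset_iff.mpr h) p.2⟩

open Classical in
/-- Extension of a filling of `λ/ν` to `λ/μ` by a constant letter. -/
def extendFilling {lam mu nu : YoungDiagram} (m : L) (T : SkewCell lam nu → L) :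
    SkewCell lam mu → L :=
  fun p => if h : p.1 ∈ nu then m else T ⟨p.1, by
    rw [Finset.mem_sdiff, YoungDiagram.mem_cells, YoungDiagram.mem_cells]
    exact ⟨(mem_skew p).1, h⟩⟩

theorem extendFilling_of_mem {lam mu nu : YoungDiagram} (m : L) (T : SkewCell lam nu → L)
    {p : SkewCell lam mu} (h : p.1 ∈ nu) : extendFilling m T p = m :=
  dif_pos h

theorem extendFilling_inclusion {lam mu nu : YoungDiagram} (hmn : mu ≤ nu) (m : L)
    (T : SkewCell lam nu → L) (p : SkewCell lam nu) :
    extendFilling m T (skewInclusion hmn p) = T p :=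
  dif_neg (mem_skew p).2

/-- A box of `λ/μ` outside `ν` comes from a box of `λ/ν`. -/
theorem exists_inclusion_eq {lam mu nu : YoungDiagram} (hmn : mu ≤ nu) {p : SkewCell lam mu}
    (h : p.1 ∉ nu) : ∃ q : SkewCell lam nu, skewInclusion hmn q = p :=
  ⟨⟨p.1, by
    rw [Finset.mem_sdiff, YoungDiagram.mem_cells, YoungDiagram.mem_cells]
    exact ⟨(mem_skew p).1, h⟩⟩, rfl⟩

theorem prod_extendFilling {lam mu nu : YoungDiagram} (hmn : mu ≤ nu) (hnl : nu ≤ lam)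
    (wt : L → ℤ → K) (m : L) (T : SkewCell lam nu → L) :
    ∏ p : SkewCell lam mu, wt (extendFilling m T p) (content p) =
      (∏ c ∈ nu.cells \ mu.cells, wt m ((c.2 : ℤ) - c.1)) * ∏ p, wt (T p) (content p) := by
  rw [← Finset.prod_filter_mul_prod_filter_not Finset.univ fun p : SkewCell lam mu => p.1 ∈ nu]
  congr 1
  · refine Finset.prod_bij (fun p _ => p.1) ?_ (fun p _ q _ h => Subtype.ext h) ?_ ?_
    · intro p hp
      exact Finset.mem_sdiff.mpr ⟨(Finset.mem_filter.mp hp).2, (mem_skew p).2⟩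
    · intro c hc
      have hc' := Finset.mem_sdiff.mp hc
      exact ⟨⟨c, Finset.mem_sdiff.mpr ⟨hnl hc'.1, hc'.2⟩⟩,
        Finset.mem_filter.mpr ⟨Finset.mem_univ _, hc'.1⟩, rfl⟩
    · intro p hp
      rw [extendFilling_of_mem m T (Finset.mem_filter.mp hp).2]
      rfl
  · symm
    refine Finset.prod_bij (fun p _ => skewInclusion hmn p) ?_ ?_ ?_ ?_
    · intro p _
      exact Finset.mem_filter.mpr ⟨Finset.mem_univ _, (mem_skew p).2⟩
    · intro p _ q _ h
      exact Subtype.ext (congrArg (fun p : SkewCell lam mu => p.1) h)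
    · intro p hp
      obtain ⟨q, hq⟩ := exists_inclusion_eq hmn (Finset.mem_filter.mp hp).2
      exact ⟨q, Finset.mem_univ _, hq⟩
    · intro p _
      rw [extendFilling_inclusion]
      rfl

variable [LinearOrder L]

theorem le_of_isSupertableau {primed : L → Prop} {lam mu : YoungDiagram}
    {T : SkewCell lam mu → L} (hT : IsSupertableau primed T) {p q : SkewCell lam mu}
    (h1 : p.1.1 ≤ q.1.1) (h2 : p.1.2 ≤ q.1.2) : T p ≤ T q := by
  have hr : (p.1.1, q.1.2) ∈ lam.cells \ mu.cells := by
    rw [Finset.mem_sdiff, YoungDiagram.mem_cells, YoungDiagram.mem_cells]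
    exact ⟨lam.up_left_mem h1 le_rfl (mem_skew q).1,
      fun h => (mem_skew p).2 (mu.up_left_mem le_rfl h2 h)⟩
  refine le_trans (b := T ⟨_, hr⟩) ?_ ?_
  · rcases h2.eq_or_lt with h | h
    · exact (congrArg T (Subtype.ext (Prod.ext rfl h) : p = ⟨(p.1.1, q.1.2), hr⟩)).le
    · exact (hT.1 p ⟨_, hr⟩ rfl h).1
  · rcases h1.eq_or_lt with h | h
    · exact (congrArg T (Subtype.ext (Prod.ext h rfl) : (⟨(p.1.1, q.1.2), hr⟩ : SkewCell lam mu) = q)).le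
    · exact (hT.2 ⟨_, hr⟩ q rfl h).1

open Classical in
/-- The diagram formed by `μ` and the boxes that contain the least letter. -/
def leastPart {primed : L → Prop} {lam mu : YoungDiagram}
    {T : SkewCell lam mu → L} (hT : IsSupertableau primed T) {m : L} (hm : ∀ p, m ≤ T p) :
    YoungDiagram where
  cells := lam.cells.filter fun c => ∀ h : c ∈ lam.cells \ mu.cells, T ⟨c, h⟩ = m
  isLowerSet := by
    rintro ⟨i, j⟩ ⟨i', j'⟩ ⟨hi, hj⟩ hc
    simp only at hi hj
    simp only [Finset.coe_filter, Set.mem_ofPred_eq, YoungDiagram.mem_cells] at hc ⊢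
    refine ⟨lam.up_left_mem hi hj hc.1, fun h => ?_⟩
    have h' : (i, j) ∈ lam.cells \ mu.cells := by
      rw [Finset.mem_sdiff, YoungDiagram.mem_cells, YoungDiagram.mem_cells] at h ⊢
      exact ⟨hc.1, fun hmu => h.2 (mu.up_left_mem hi hj hmu)⟩
    refine le_antisymm ?_ (hm _)
    rw [← hc.2 h']
    exact le_of_isSupertableau hT hi hj

theorem mem_leastPart {primed : L → Prop} {lam mu : YoungDiagram}
    {T : SkewCell lam mu → L} (hT : IsSupertableau primed T) {m : L} (hm : ∀ p, m ≤ T p)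
    (c : ℕ × ℕ) : c ∈ leastPart hT hm ↔
      c ∈ lam ∧ ∀ h : c ∈ lam.cells \ mu.cells, T ⟨c, h⟩ = m := by
  rw [← YoungDiagram.mem_cells]
  simp [leastPart]

theorem isSupertableau_extendFilling {primed : L → Prop} {lam mu nu : YoungDiagram}
    (hmn : mu ≤ nu) (hnl : nu ≤ lam) {m : L} {T : SkewCell lam nu → L}
    (hm : ∀ p, m < T p) :
    IsSupertableau primed (extendFilling m T : SkewCell lam mu → L) ↔
      IsSupertableau primed T ∧ IsStrip (primed m) nu mu := by
  have hstep : ∀ {p q : SkewCell lam mu}, p.1.1 ≤ q.1.1 → p.1.2 ≤ q.1.2 → q.1 ∈ nu → p.1 ∈ nu :=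
    fun h1 h2 h => nu.up_left_mem h1 h2 h
  have hcell : ∀ c ∈ nu.cells \ mu.cells, c ∈ lam.cells \ mu.cells := by
    intro c hc
    rw [Finset.mem_sdiff, YoungDiagram.mem_cells, YoungDiagram.mem_cells] at hc ⊢
    exact ⟨hnl hc.1, hc.2⟩
  constructor
  · intro h
    refine ⟨⟨fun p q h1 h2 => ?_, fun p q h1 h2 => ?_⟩, ?_⟩
    · have := h.1 (skewInclusion hmn p) (skewInclusion hmn q) h1 h2
      simpa only [extendFilling_inclusion] using this
    · have := h.2 (skewInclusion hmn p) (skewInclusion hmn q) h1 h2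
      simpa only [extendFilling_inclusion] using this
    · have hval : ∀ c (hc : c ∈ nu.cells \ mu.cells),
          (extendFilling m T : SkewCell lam mu → L) ⟨c, hcell c hc⟩ = m := fun c hc =>
        extendFilling_of_mem m T (p := ⟨c, hcell c hc⟩) (Finset.mem_sdiff.mp hc).1
      have hr : ∀ c ∈ nu.cells \ mu.cells, ∀ d ∈ nu.cells \ mu.cells, primed m → c.1 = d.1 →
          ¬ c.2 < d.2 := by
        intro c hc d hd hp h1 h2
        have := (h.1 ⟨c, hcell c hc⟩ ⟨d, hcell d hd⟩ h1 h2).2 (by rw [hval c hc, hval d hd])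
        rw [hval c hc] at this
        exact this hp
      have hc' : ∀ c ∈ nu.cells \ mu.cells, ∀ d ∈ nu.cells \ mu.cells, ¬ primed m → c.2 = d.2 →
          ¬ c.1 < d.1 := by
        intro c hc d hd hp h1 h2
        have := (h.2 ⟨c, hcell c hc⟩ ⟨d, hcell d hd⟩ h1 h2).2 (by rw [hval c hc, hval d hd])
        rw [hval c hc] at this
        exact hp this
      intro c hc d hd
      refine ⟨fun hp h1 => Prod.ext h1 ?_, fun hp h1 => Prod.ext ?_ h1⟩
      · have e1 := hr c hc d hd hp h1
        have e2 := hr d hd c hc hp h1.symm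
        omega
      · have e1 := hc' c hc d hd hp h1
        have e2 := hc' d hd c hc hp h1.symm
        omega
  · rintro ⟨h, hs⟩
    have hmem : ∀ {p : SkewCell lam mu}, p.1 ∈ nu → p.1 ∈ nu.cells \ mu.cells := fun {p} hp =>
      Finset.mem_sdiff.mpr ⟨hp, (mem_skew p).2⟩
    refine ⟨fun p q h1 h2 => ?_, fun p q h1 h2 => ?_⟩
    · by_cases hq : q.1 ∈ nu
      · have hp := hstep h1.le h2.le hq
        rw [extendFilling_of_mem m T hp, extendFilling_of_mem m T hq]
        refine ⟨le_rfl, fun _ hpr => ?_⟩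
        have := (hs p.1 (hmem hp) q.1 (hmem hq)).1 hpr h1
        rw [this] at h2
        exact lt_irrefl _ h2
      · obtain ⟨q, rfl⟩ := exists_inclusion_eq hmn hq
        by_cases hp : p.1 ∈ nu
        · rw [extendFilling_of_mem m T hp, extendFilling_inclusion]
          exact ⟨(hm q).le, fun he => absurd he (hm q).ne⟩
        · obtain ⟨p, rfl⟩ := exists_inclusion_eq hmn hp
          rw [extendFilling_inclusion, extendFilling_inclusion]
          exact h.1 p q h1 h2
    · by_cases hq : q.1 ∈ nu
      · have hp := hstep h2.le h1.le hq
        rw [extendFilling_of_mem m T hp, extendFilling_of_mem m T hq]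
        refine ⟨le_rfl, fun _ => ?_⟩
        by_contra hpr
        have := (hs p.1 (hmem hp) q.1 (hmem hq)).2 hpr h1
        rw [this] at h2
        exact lt_irrefl _ h2
      · obtain ⟨q, rfl⟩ := exists_inclusion_eq hmn hq
        by_cases hp : p.1 ∈ nu
        · rw [extendFilling_of_mem m T hp, extendFilling_inclusion]
          exact ⟨(hm q).le, fun he => absurd he (hm q).ne⟩
        · obtain ⟨p, rfl⟩ := exists_inclusion_eq hmn hp
          rw [extendFilling_inclusion, extendFilling_inclusion]
          exact h.2 p q h1 h2

variable [Fintype L]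

open Classical in
/-- The sum over the supertableaux of shape `λ/μ` with letters from the list `l`, where the letter `t`
in a box of content `c` contributes `wt t c`. -/
noncomputable def tableauSum (primed : L → Prop) (wt : L → ℤ → K) (l : List L)
    (lam mu : YoungDiagram) : K :=
  ∑ T : SkewCell lam mu → L with IsSupertableau primed T ∧ ∀ p, T p ∈ l,
    ∏ p, wt (T p) (content p)

open Classical in
/-- The branching rule: the boxes with the least letter form a strip. -/
theorem tableauSum_cons (primed : L → Prop) (wt : L → ℤ → K) (m : L) (l : List L)
    (hl : ∀ t ∈ l, m < t) {lam mu : YoungDiagram} (hle : mu ≤ lam) :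
    tableauSum primed wt (m :: l) lam mu = ∑ nu ∈ subdiagrams lam with mu ≤ nu,
      (if IsStrip (primed m) nu mu then ∏ c ∈ nu.cells \ mu.cells, wt m ((c.2 : ℤ) - c.1) else 0) *
        tableauSum primed wt l lam nu := by
  have hrhs : ∀ nu ∈ (subdiagrams lam).filter (mu ≤ ·),
      (if IsStrip (primed m) nu mu then ∏ c ∈ nu.cells \ mu.cells, wt m ((c.2 : ℤ) - c.1) else 0) *
        tableauSum primed wt l lam nu =
      ∑ T : SkewCell lam nu → L with
        IsSupertableau primed (extendFilling m T : SkewCell lam mu → L) ∧ ∀ p, T p ∈ l,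
        ∏ p : SkewCell lam mu, wt (extendFilling m T p) (content p) := by
    intro nu hnu
    rw [Finset.mem_filter, mem_subdiagrams] at hnu
    rw [tableauSum, Finset.mul_sum, Finset.sum_filter, Finset.sum_filter]
    refine Finset.sum_congr rfl fun T _ => ?_
    by_cases hT : ∀ p, T p ∈ l
    · rw [isSupertableau_extendFilling hnu.2 hnu.1 fun p => hl _ (hT p)]
      rw [prod_extendFilling hnu.2 hnu.1]
      by_cases h1 : IsSupertableau primed T <;> by_cases h2 : IsStrip (primed m) nu mu <;>
        simp [hT, h1, h2]
    · rw [if_neg fun h => hT h.2, if_neg fun h => hT h.2]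
  rw [Finset.sum_congr rfl hrhs, Finset.sum_sigma', tableauSum]
  symm
  refine Finset.sum_bij (fun s _ => extendFilling m s.2) ?_ ?_ ?_ (fun _ _ => rfl)
  · rintro ⟨nu, T⟩ h
    simp only [Finset.mem_sigma, Finset.mem_filter, Finset.mem_univ, true_and] at h ⊢
    refine ⟨h.2.1, fun p => ?_⟩
    by_cases hp : p.1 ∈ nu
    · rw [extendFilling_of_mem m T hp]
      exact List.mem_cons_self
    · obtain ⟨p, rfl⟩ := exists_inclusion_eq h.1.2 hp
      rw [extendFilling_inclusion]
      exact List.mem_cons_of_mem _ (h.2.2 p)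
  · rintro ⟨nu, T⟩ h ⟨nu', T'⟩ h' heq
    simp only [Finset.mem_sigma, Finset.mem_filter, Finset.mem_univ, true_and,
      mem_subdiagrams] at h h' heq
    have key : ∀ {nu nu' : YoungDiagram} {T : SkewCell lam nu → L} {T' : SkewCell lam nu' → L},
        nu ≤ lam → mu ≤ nu' → (∀ p, T' p ∈ l) →
        (extendFilling m T : SkewCell lam mu → L) = extendFilling m T' → nu ≤ nu' := by
      intro nu nu' T T' h1 h2 h3 h4 c hc
      by_contra hc'
      have hcm : c ∈ lam.cells \ mu.cells := by
        rw [Finset.mem_sdiff]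
        exact ⟨h1 hc, fun h => hc' (h2 h)⟩
      have e := congrFun h4 ⟨c, hcm⟩
      obtain ⟨q, hq⟩ := exists_inclusion_eq h2 (p := ⟨c, hcm⟩) hc'
      rw [extendFilling_of_mem m T (p := ⟨c, hcm⟩) hc, ← hq, extendFilling_inclusion] at e
      exact (hl _ (h3 q)).ne e
    obtain rfl : nu = nu' := le_antisymm (key h.1.1 h'.1.2 h'.2.2 heq)
      (key h'.1.1 h.1.2 h.2.2 heq.symm)
    congr 1
    ext p
    have e := congrFun heq (skewInclusion h.1.2 p)
    rwa [extendFilling_inclusion, extendFilling_inclusion] at e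
  · intro T hT
    simp only [Finset.mem_filter, Finset.mem_univ, true_and] at hT
    have hm : ∀ p, m ≤ T p := by
      intro p
      rcases List.mem_cons.mp (hT.2 p) with h | h
      · exact h.ge
      · exact (hl _ h).le
    have hmn : mu ≤ leastPart hT.1 hm := by
      intro c hc
      exact (mem_leastPart hT.1 hm c).mpr
        ⟨hle hc, fun h => absurd hc (Finset.mem_sdiff.mp h).2⟩
    have hext : extendFilling m (T ∘ skewInclusion hmn) = T := by
      ext p
      by_cases hp : p.1 ∈ leastPart hT.1 hm
      · rw [extendFilling_of_mem _ _ hp]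
        exact (((mem_leastPart hT.1 hm p.1).mp hp).2 p.2).symm
      · obtain ⟨p, rfl⟩ := exists_inclusion_eq hmn hp
        rw [extendFilling_inclusion]
        rfl
    refine ⟨⟨leastPart hT.1 hm, T ∘ skewInclusion hmn⟩, ?_, hext⟩
    simp only [Finset.mem_sigma, Finset.mem_filter, Finset.mem_univ, true_and, mem_subdiagrams]
    refine ⟨⟨fun c hc => ((mem_leastPart hT.1 hm c).mp hc).1, hmn⟩, ?_, fun p => ?_⟩
    · rw [hext]
      exact hT.1
    · refine (List.mem_cons.mp (hT.2 (skewInclusion hmn p))).resolve_left fun h => ?_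
      refine (mem_skew p).2 ((mem_leastPart hT.1 hm p.1).mpr ⟨(mem_skew p).1, fun _ => h⟩)

theorem tableauSum_nil (primed : L → Prop) (wt : L → ℤ → K) {lam mu : YoungDiagram}
    (hle : mu ≤ lam) [Decidable (mu = lam)] :
    tableauSum primed wt [] lam mu = if mu = lam then 1 else 0 := by
  classical
  rw [tableauSum]
  split_ifs with h
  · subst h
    have : IsEmpty (SkewCell mu mu) := ⟨fun p => (mem_skew p).2 (mem_skew p).1⟩
    rw [Finset.filter_true_of_mem]
    · simp
    · intro T _
      exact ⟨⟨fun p => isEmptyElim p, fun p => isEmptyElim p⟩, fun p => isEmptyElim p⟩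
  · rw [Finset.filter_false_of_mem, Finset.sum_empty]
    rintro T _ ⟨_, hT⟩
    refine h (le_antisymm hle fun c hc => ?_)
    by_contra hcm
    have := hT ⟨c, Finset.mem_sdiff.mpr ⟨hc, hcm⟩⟩
    simp at this

/-- Tableau sums as minors of the product of the matrices of the letters. -/
theorem tableauSum_eq_minor (primed : L → Prop) [DecidablePred primed] (wt : L → ℤ → K)
    (l : List L) (hl : l.Pairwise (· < ·)) {lam mu : YoungDiagram} (hle : mu ≤ lam) {N : ℕ}
    (hlam : lam.colLen 0 ≤ N) :
    tableauSum primed wt l lam mu = minor (l.map fun t => letterMatrix (primed t) (wt t)).prod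
      (particles N mu) (particles N lam) := by
  classical
  induction l generalizing mu with
  | nil =>
    rw [tableauSum_nil primed wt hle, List.map_nil, List.prod_nil]
    split_ifs with h
    · rw [h, minor_one_self (particles_strictAnti N lam)]
    · rw [minor_one_of_ne (particles_strictAnti N mu) (particles_strictAnti N lam)
        fun h' => h (particles_injOn ((colLen_le_of_le hle).trans hlam) hlam h')]
  | cons m l ih =>
    rw [List.pairwise_cons] at hl
    rw [tableauSum_cons primed wt m l hl.1 hle, List.map_cons, List.prod_cons,
      minor_mul_particles _ _ mu lam ((subdiagrams lam).filter (mu ≤ ·))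
        (fun u hu => (colLen_le_of_le (mem_subdiagrams.mp (Finset.mem_filter.mp hu).1)).trans hlam)
        (fun u _ h1 h2 => Finset.mem_filter.mpr ⟨mem_subdiagrams.mpr h2, h1⟩)
        ((colLen_le_of_le hle).trans hlam)]
    refine Finset.sum_congr rfl fun u hu => ?_
    rw [Finset.mem_filter, mem_subdiagrams] at hu
    rw [ih hl.2 hu.1, minor_letterMatrix _ _ hu.2 ((colLen_le_of_le hu.1).trans hlam)]

end Tableaux

section PolynomialCase

variable {K : Type*} [Field K] {n : ℕ}

theorem verticalMatrix_zero : verticalMatrix (fun _ => (0 : K)) = 1 := by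
  ext p q h
  rw [verticalMatrix_apply, IncidenceAlgebra.one_apply]
  split_ifs with h1 h2 h2
  · subst h2; simp
  · exact Finset.prod_eq_zero (i := p) (Finset.mem_Ico.mpr ⟨le_rfl, by omega⟩) rfl
  · omega
  · rfl

theorem horizontalMatrix_zero : horizontalMatrix (fun _ => (0 : K)) = 1 := by
  ext p q h
  rw [horizontalMatrix_apply _ h, IncidenceAlgebra.one_apply]
  split_ifs with h2
  · subst h2; simp
  · exact Finset.prod_eq_zero (i := p) (Finset.mem_Ico.mpr ⟨le_rfl, by omega⟩) rfl

/-- A row with `b = 0` is a vertical strip followed by a horizontal one. -/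
theorem verticalMatrix_mul_horizontalMatrix (a : ℤ → K) (x y : K) :
    verticalMatrix (fun c => y + a c) * horizontalMatrix (fun c => x - a c) =
      pathWeight a 0 x y := by
  ext p q h
  rw [IncidenceAlgebra.mul_apply]
  rcases h.eq_or_lt with rfl | h
  · simp [verticalMatrix_apply, horizontalMatrix_apply, pathWeight_self]
  · rw [← Finset.sum_subset (s₁ := {p, p + 1}), Finset.sum_pair (by omega),
      verticalMatrix_apply, verticalMatrix_apply, if_pos (by omega), if_pos (by omega),
      horizontalMatrix_apply _ h.le, horizontalMatrix_apply _ (by omega), pathWeight_of_lt h,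
      ← mul_prod_Ioo h]
    · have e1 : Finset.Ico (p + 1) q = Finset.Ioo p q := by
        ext k; simp only [Finset.mem_Ico, Finset.mem_Ioo]; omega
      have e2 : Finset.Ico p (p + 1) = {p} := by
        ext k; simp only [Finset.mem_Ico, Finset.mem_singleton]; omega
      rw [e1, e2]
      simp only [Finset.Ico_self, Finset.prod_empty, Finset.prod_singleton, Pi.zero_apply, mul_zero,
        zero_mul, sub_zero, Finset.prod_const_one, div_one, one_mul]
      ring
    · intro r hr
      simp only [Finset.mem_insert, Finset.mem_singleton] at hr
      rw [Finset.mem_Icc]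
      omega
    · intro r _ hr
      simp only [Finset.mem_insert, Finset.mem_singleton] at hr
      rw [verticalMatrix_apply, if_neg (by omega), zero_mul]

theorem pathWeight_zero_left (x : K) :
    pathWeight 0 0 x 0 = horizontalMatrix (fun _ => x) := by
  rw [← verticalMatrix_mul_horizontalMatrix]
  simp [verticalMatrix_zero]

theorem pathWeight_zero_right (y : K) :
    pathWeight 0 0 0 y = verticalMatrix (fun _ => y) := by
  rw [← verticalMatrix_mul_horizontalMatrix]
  simp [horizontalMatrix_zero]

theorem ffSchur_eq_minor (a : ℤ → K) (x y : Fin n → K) {lam mu : YoungDiagram} {N : ℕ}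
    (hmu : mu.colLen 0 ≤ N) (hlam : lam.colLen 0 ≤ N) :
    ffSchur a 0 x y lam mu =
      minor ((List.ofFn fun i => (x i, y i)).map fun r => pathWeight a 0 r.1 r.2).prod
        (particles N mu) (particles N lam) := by
  have h : ∀ r : K × K, vacuumFactor 0 r.1 r.2 N = 1 := fun r => by simp [vacuumFactor]
  rw [ffSchur, rowProduct_eq_minor _ (by simp) (by simp) hmu hlam]
  simp only [h, List.map_const', List.prod_replicate, one_pow, one_mul]

theorem schur_eq_tableauSum (x : Fin n → K) (lam mu : YoungDiagram) :
    schur x lam mu =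
      tableauSum (fun _ : Fin n => False) (fun i _ => x i) (List.finRange n) lam mu := by
  unfold schur tableauSum
  refine Finset.sum_congr ?_ fun _ _ => rfl
  ext T
  simp only [Finset.mem_filter, Finset.mem_univ, true_and]
  simp only [List.mem_finRange, implies_true, and_true, IsSemistandard, IsSupertableau,
    not_false_eq_true]
  refine and_congr Iff.rfl (forall₄_congr fun p q _ _ => ?_)
  exact lt_iff_le_and_ne

theorem superSchur_eq_tableauSum {m : ℕ} (x : Fin m → K) (y : Fin n → K) (lam mu : YoungDiagram) :
    superSchur x y lam mu =
      tableauSum (fun t : Fin m ⊕ₗ Fin n => (ofLex t).isRight = true)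
        (fun t _ => Sum.elim x y (ofLex t))
        ((List.finRange m).map (fun i => toLex (Sum.inl i)) ++
          (List.finRange n).map fun i => toLex (Sum.inr i)) lam mu := by
  unfold superSchur tableauSum
  refine Finset.sum_congr ?_ fun _ _ => rfl
  ext T
  simp only [Finset.mem_filter, Finset.mem_univ, true_and]
  refine (and_iff_left fun p => ?_).symm
  rw [List.mem_append, List.mem_map, List.mem_map]
  rcases h : ofLex (T p) with i | i
  · exact Or.inl ⟨i, List.mem_finRange i, by rw [← h]; rfl⟩
  · exact Or.inr ⟨i, List.mem_finRange i, by rw [← h]; rfl⟩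

/-- The letters `1' < 1 < ⋯ < n' < n` in increasing order. -/
def primedLetters (n : ℕ) : List (PrimedLetter n) :=
  (List.finRange n).flatMap fun i => [toLex (i, false), toLex (i, true)]

theorem mem_primedLetters (t : PrimedLetter n) : t ∈ primedLetters n := by
  rw [primedLetters, List.mem_flatMap]
  refine ⟨(ofLex t).1, List.mem_finRange _, ?_⟩
  obtain ⟨i, b⟩ := t
  cases b
  · exact List.mem_cons_self
  · exact List.mem_cons_of_mem _ List.mem_cons_self

theorem pairwise_primedLetters (n : ℕ) : (primedLetters n).Pairwise (· < ·) := by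
  rw [primedLetters, List.pairwise_flatMap]
  constructor
  · intro i _
    rw [List.pairwise_pair]
    exact Prod.Lex.toLex_lt_toLex.mpr (Or.inr ⟨rfl, by simp⟩)
  · refine (List.pairwise_lt_finRange n).imp fun {i j} hij s hs t ht => ?_
    have h1 : ∀ (k : Fin n), ∀ r ∈ [toLex (k, false), toLex (k, true)], (ofLex r).1 = k := by
      intro k r hr
      simp only [List.mem_cons, List.not_mem_nil, or_false] at hr
      rcases hr with rfl | rfl <;> rfl
    refine Prod.Lex.lt_iff.mpr (Or.inl ?_)
    rw [h1 i s hs, h1 j t ht]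
    exact hij

theorem factorialSuperSchur_eq_tableauSum (x y : Fin n → K) (a : ℤ → K) (lam mu : YoungDiagram) :
    factorialSuperSchur x y (-dualSeq a) lam mu =
      tableauSum (fun t : PrimedLetter n => (ofLex t).2 = false)
        (fun t c => if (ofLex t).2 = true then x (ofLex t).1 - a c else y (ofLex t).1 + a c)
        (primedLetters n) lam mu := by
  unfold factorialSuperSchur tableauSum
  refine Finset.sum_congr ?_ fun T _ => Finset.prod_congr rfl fun p _ => ?_
  · ext T
    simp only [Finset.mem_filter, Finset.mem_univ, true_and]
    exact (and_iff_left fun p => mem_primedLetters _).symm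
  have : (-dualSeq a) (-content p + 1) = a (content p) := by
    simp only [Pi.neg_apply, dualSeq, neg_neg]
    congr 1
    ring
  rw [this]

theorem skewDoubleSchur_eq_factorialSuperSchur (x : Fin n → K) (a : ℤ → K)
    (lam mu : YoungDiagram) : skewDoubleSchur x (-dualSeq a) lam mu =
      factorialSuperSchur x (fun i => dualSeq a ((i : ℤ) + 1)) (-dualSeq a) lam mu := by
  unfold skewDoubleSchur factorialSuperSchur
  refine Finset.sum_congr rfl fun T _ => Finset.prod_congr rfl fun p _ => ?_
  split_ifs
  · rfl
  · simp only [Pi.neg_apply]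
    ring

theorem ffSchur_eq_schur (x : Fin n → K) {lam mu : YoungDiagram} (hle : mu ≤ lam) :
    ffSchur 0 0 x 0 lam mu = schur x lam mu := by
  rw [ffSchur_eq_minor 0 x 0 (colLen_le_of_le hle) le_rfl, schur_eq_tableauSum,
    tableauSum_eq_minor _ _ _ (List.pairwise_lt_finRange n) hle le_rfl, List.ofFn_eq_map,
    List.map_map]
  congr 3
  funext i
  simp [letterMatrix, pathWeight_zero_left]

theorem ffSchur_eq_factorialSuperSchur (x y : Fin n → K) (a : ℤ → K) {lam mu : YoungDiagram}
    (hle : mu ≤ lam) :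
    ffSchur a 0 x y lam mu = factorialSuperSchur x y (-dualSeq a) lam mu := by
  rw [ffSchur_eq_minor a x y (colLen_le_of_le hle) le_rfl, factorialSuperSchur_eq_tableauSum,
    tableauSum_eq_minor _ _ _ (pairwise_primedLetters n) hle le_rfl, List.ofFn_eq_map,
    List.map_map, primedLetters, List.map_flatMap,
    List.flatMap_def, List.prod_flatten, List.map_map]
  congr 3
  funext i
  simp [letterMatrix, ← verticalMatrix_mul_horizontalMatrix]

end PolynomialCase

section GeneratingFunctions

open PowerSeries

variable {K : Type*} [Field K] {n : ℕ}

/-- The function of the shift operator with parameters `a` given by a power series. -/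
noncomputable def coeffMatrix (a : ℤ → K) (G : K⟦X⟧) : IncidenceAlgebra K ℤ where
  toFun p q := if p ≤ q then
    coeff (q - p).toNat ((∏ m ∈ Finset.Ioo p q, (1 - C (a m) * X)) * G) else 0
  eq_zero_of_not_le' _ _ h := if_neg h

theorem coeffMatrix_apply (a : ℤ → K) (G : K⟦X⟧) {p q : ℤ} (h : p ≤ q) : coeffMatrix a G p q =
    coeff (q - p).toNat ((∏ m ∈ Finset.Ioo p q, (1 - C (a m) * X)) * G) :=
  if_pos h

theorem coeff_succ_one_sub_mul (c : K) (G : K⟦X⟧) (k : ℕ) :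
    coeff (k + 1) (G * (1 - C c * X)) = coeff (k + 1) G - c * coeff k G := by
  rw [mul_sub, mul_one, map_sub, ← mul_assoc, coeff_succ_mul_X, mul_comm G, coeff_C_mul]

theorem coeff_succ_one_add_mul (c : K) (G : K⟦X⟧) (k : ℕ) :
    coeff (k + 1) (G * (1 + C c * X)) = coeff (k + 1) G + c * coeff k G := by
  rw [mul_add, mul_one, map_add, ← mul_assoc, coeff_succ_mul_X, mul_comm G, coeff_C_mul]

theorem coeff_prod_one_sub_eq_zero {ι : Type*} (s : Finset ι) (c : ι → K) {k : ℕ}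
    (h : s.card < k) : coeff k (∏ i ∈ s, (1 - C (c i) * X)) = 0 := by
  classical
  induction s using Finset.induction_on generalizing k with
  | empty => rw [Finset.prod_empty, coeff_one, if_neg (by simp at h; omega)]
  | insert i s hi ih =>
    rw [Finset.card_insert_of_notMem hi] at h
    obtain ⟨k, rfl⟩ := Nat.exists_eq_succ_of_ne_zero (by omega : k ≠ 0)
    rw [Finset.prod_insert hi, mul_comm, Nat.succ_eq_add_one, coeff_succ_one_sub_mul,
      ih (by omega), ih (by omega), mul_zero, sub_zero]

theorem coeffMatrix_one (a : ℤ → K) : coeffMatrix a 1 = 1 := by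
  ext p q h
  rw [coeffMatrix_apply a _ h, mul_one, IncidenceAlgebra.one_apply]
  split_ifs with h1
  · subst h1; simp
  · refine coeff_prod_one_sub_eq_zero _ _ ?_
    rw [Int.card_Ioo]
    omega

theorem coeffMatrix_mul_pathWeight (a : ℤ → K) (x y : K) (G G' : K⟦X⟧)
    (hG : G' * (1 - C x * X) = G * (1 + C y * X)) :
    coeffMatrix a G * pathWeight a 0 x y = coeffMatrix a G' := by
  have h0 : coeff 0 G' = coeff 0 G := by
    have := congrArg (coeff 0) hG
    simpa using this
  have hrec : ∀ W : K⟦X⟧, ∀ k, coeff (k + 1) (W * G') - x * coeff k (W * G') =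
      coeff (k + 1) (W * G) + y * coeff k (W * G) := by
    intro W k
    rw [← coeff_succ_one_sub_mul, ← coeff_succ_one_add_mul, mul_assoc, hG, mul_assoc]
  ext p q h
  induction q, h using Int.leInduction with
  | base =>
    rw [IncidenceAlgebra.mul_apply, Finset.Icc_self, Finset.sum_singleton, pathWeight_self,
      coeffMatrix_apply a _ le_rfl, coeffMatrix_apply a _ le_rfl]
    simp only [sub_self, Int.toNat_zero, Finset.Ioo_self, Finset.prod_empty, one_mul, h0]
    simp
  | succ q h ih =>
    have hsum : ∀ q', p ≤ q' → (coeffMatrix a G * pathWeight a 0 x y) p q' =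
        (∑ r ∈ Finset.Ico p q', coeffMatrix a G p r * pathWeight a 0 x y r q') +
          coeffMatrix a G p q' := by
      intro q' hq'
      rw [IncidenceAlgebra.mul_apply, ← Finset.Ico_insert_right hq', Finset.sum_insert (by simp),
        pathWeight_self]
      simp [add_comm]
    have hlast : ∀ r ∈ Finset.Ico p q, coeffMatrix a G p r * pathWeight a 0 x y r (q + 1) =
        (x - a q) * (coeffMatrix a G p r * pathWeight a 0 x y r q) := by
      intro r hr
      rw [Finset.mem_Ico] at hr
      rw [pathWeight_mul hr.2 (lt_add_one q)]
      have e2 : Finset.Ico q (q + 1) = {q} := by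
        ext k; simp only [Finset.mem_Ico, Finset.mem_singleton]; omega
      rw [e2]
      simp
      ring
    have hIco : Finset.Ico p (q + 1) = insert q (Finset.Ico p q) := by
      ext k; simp only [Finset.mem_Ico, Finset.mem_insert]; omega
    have hqq : pathWeight a 0 x y q (q + 1) = x + y := by
      rw [pathWeight_of_lt (lt_add_one q)]
      have e2 : Finset.Ioo q (q + 1) = ∅ :=
        Finset.eq_empty_of_forall_notMem fun k hk => by rw [Finset.mem_Ioo] at hk; omega
      rw [e2]
      simp
    have hstep : coeffMatrix a G' p (q + 1) = coeffMatrix a G p (q + 1) +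
        (x + y) * coeffMatrix a G p q +
          (x - a q) * (coeffMatrix a G' p q - coeffMatrix a G p q) := by
      rw [coeffMatrix_apply a _ h, coeffMatrix_apply a _ h, coeffMatrix_apply a _ (by omega),
        coeffMatrix_apply a _ (by omega)]
      have e : (q + 1 - p).toNat = (q - p).toNat + 1 := by omega
      rw [e]
      rcases h.eq_or_lt with rfl | hlt
      · have e2 : Finset.Ioo p (p + 1) = ∅ :=
          Finset.eq_empty_of_forall_notMem fun k hk => by rw [Finset.mem_Ioo] at hk; omega
        rw [e2, Finset.Ioo_self, Finset.prod_empty, sub_self, Int.toNat_zero]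
        have := hrec 1 0
        simp only [one_mul] at this ⊢
        rw [h0] at this ⊢
        linear_combination this
      · have e2 : ∏ m ∈ Finset.Ioo p (q + 1), (1 - C (a m) * X) =
            (∏ m ∈ Finset.Ioo p q, (1 - C (a m) * X)) * (1 - C (a q) * X) := by
          rw [← Finset.prod_erase_mul _ _ (Finset.mem_Ioo.mpr ⟨hlt, lt_add_one q⟩)]
          congr 1
          refine Finset.prod_congr ?_ fun _ _ => rfl
          ext k
          simp only [Finset.mem_erase, Finset.mem_Ioo]
          omega
        rw [e2, mul_right_comm, mul_right_comm _ _ G, coeff_succ_one_sub_mul,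
          coeff_succ_one_sub_mul]
        have := hrec (∏ m ∈ Finset.Ioo p q, (1 - C (a m) * X)) (q - p).toNat
        linear_combination this
    rw [hsum _ (by omega), hIco, Finset.sum_insert (by simp), Finset.sum_congr rfl hlast,
      ← Finset.mul_sum, hqq, hstep, ← ih, hsum q h]
    ring

theorem one_sub_mul_inv (x : K) : (1 - C x * X : K⟦X⟧) * (1 - C x * X)⁻¹ = 1 :=
  PowerSeries.mul_inv_cancel _ (by simp)

theorem coeffMatrix_mul_prod (a : ℤ → K) (l : List (K × K)) (G : K⟦X⟧) :
    coeffMatrix a G * (l.map fun r => pathWeight a 0 r.1 r.2).prod =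
      coeffMatrix a (G * (l.map fun r => (1 + C r.2 * X) * (1 - C r.1 * X)⁻¹).prod) := by
  induction l generalizing G with
  | nil => simp
  | cons r l ih =>
    rw [List.map_cons, List.prod_cons, List.map_cons, List.prod_cons, ← mul_assoc,
      coeffMatrix_mul_pathWeight a r.1 r.2 G (G * ((1 + C r.2 * X) * (1 - C r.1 * X)⁻¹)), ih,
      mul_assoc]
    linear_combination (G * (1 + C r.2 * X)) * one_sub_mul_inv r.1

theorem prod_pathWeight_eq_coeffMatrix (a : ℤ → K) (l : List (K × K)) :
    (l.map fun r => pathWeight a 0 r.1 r.2).prod =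
      coeffMatrix a (l.map fun r => (1 + C r.2 * X) * (1 - C r.1 * X)⁻¹).prod := by
  rw [← one_mul (l.map fun r => pathWeight a 0 r.1 r.2).prod, ← coeffMatrix_one a,
    coeffMatrix_mul_prod, one_mul]

theorem prod_inv_powerSeries {ι : Type*} (s : Finset ι) (f : ι → K⟦X⟧) :
    (∏ i ∈ s, f i)⁻¹ = ∏ i ∈ s, (f i)⁻¹ := by
  classical
  induction s using Finset.induction_on with
  | empty => simp
  | insert i s hi ih =>
    rw [Finset.prod_insert hi, Finset.prod_insert hi, PowerSeries.mul_inv_rev, ih, mul_comm]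

/-- The generating function of the one-row functions. -/
noncomputable def genFun (x y : Fin n → K) : K⟦X⟧ :=
  (∏ i, (1 + C (y i) * X)) * (∏ i, (1 - C (x i) * X))⁻¹

theorem ffSchur_eq_minor_coeffMatrix (a : ℤ → K) (x y : Fin n → K) {lam mu : YoungDiagram} {N : ℕ}
    (hmu : mu.colLen 0 ≤ N) (hlam : lam.colLen 0 ≤ N) :
    ffSchur a 0 x y lam mu =
      minor (coeffMatrix a (genFun x y)) (particles N mu) (particles N lam) := by
  rw [ffSchur_eq_minor a x y hmu hlam, prod_pathWeight_eq_coeffMatrix, List.map_ofFn,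
    List.prod_ofFn, genFun, prod_inv_powerSeries, ← Finset.prod_mul_distrib]
  rfl

theorem ffSchur_eq_superSchur (x y : Fin n → K) {lam mu : YoungDiagram} (hle : mu ≤ lam) :
    ffSchur 0 0 x y lam mu = superSchur x y lam mu := by
  rw [ffSchur_eq_minor_coeffMatrix 0 x y (colLen_le_of_le hle) le_rfl, superSchur_eq_tableauSum,
    tableauSum_eq_minor _ _ _ ?_ hle le_rfl]
  · have h := prod_pathWeight_eq_coeffMatrix 0
      ((List.finRange n).map (fun i => (x i, (0 : K))) ++
        (List.finRange n).map fun i => ((0 : K), y i))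
    simp only [List.map_append, List.prod_append, List.map_map, Function.comp_def,
      pathWeight_zero_left, pathWeight_zero_right] at h
    congr 1
    simp only [List.map_append, List.prod_append, List.map_map, Function.comp_def, letterMatrix,
      ofLex_toLex, Sum.isRight_inl, Sum.isRight_inr, Sum.elim_inl, Sum.elim_inr, if_true,
      Bool.false_eq_true, if_false, h]
    congr 1
    simp only [← List.ofFn_eq_map, List.prod_ofFn, genFun, prod_inv_powerSeries, map_zero, zero_mul,
      add_zero, sub_zero, one_mul, inv_one, mul_one]
    rw [mul_comm]
  · rw [List.pairwise_append]
    refine ⟨?_, ?_, ?_⟩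
    · exact List.pairwise_map.mpr ((List.pairwise_lt_finRange n).imp fun h =>
        Sum.Lex.inl_lt_inl_iff.mpr h)
    · exact List.pairwise_map.mpr ((List.pairwise_lt_finRange n).imp fun h =>
        Sum.Lex.inr_lt_inr_iff.mpr h)
    · intro s hs t ht
      obtain ⟨i, _, rfl⟩ := List.mem_map.mp hs
      obtain ⟨j, _, rfl⟩ := List.mem_map.mp ht
      exact Sum.Lex.inl_lt_inr i j

theorem coeffMatrix_eq_frobeniusH (a : ℤ → K) (x y : Fin n → K) (p q : ℤ) :
    coeffMatrix a (genFun x y) p q = frobeniusH x y (fun k => a (k + p)) (q - p) := by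
  by_cases h : p ≤ q
  · obtain ⟨k, rfl⟩ := Int.le.dest h
    rw [coeffMatrix_apply a _ h, show p + (k : ℤ) - p = k by ring]
    change _ = frobeniusH x y _ (Int.ofNat k)
    rw [frobeniusH, Int.toNat_natCast, genFun, mul_assoc]
    congr 2
    refine (Finset.prod_nbij (fun i : ℕ => (i : ℤ) + 1 + p) ?_ ?_ ?_ fun _ _ => rfl).symm
    · intro i hi
      simp only [Finset.mem_range, Finset.mem_Ioo] at hi ⊢
      omega
    · intro i _ j _ h
      simpa using h
    · intro m hm
      simp only [Finset.coe_Ioo, Set.mem_Ioo, Finset.coe_range, Set.mem_image, Set.mem_Iio] at hm ⊢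
      exact ⟨(m - p - 1).toNat, by omega, by omega⟩
  · rw [IncidenceAlgebra.apply_eq_zero_of_not_le h]
    obtain ⟨k, hk⟩ : ∃ k : ℕ, q - p = Int.negSucc k := ⟨(p - q - 1).toNat, by omega⟩
    rw [hk, frobeniusH]

theorem ffSchur_eq_frobeniusSchur (a : ℤ → K) (x y : Fin n → K) {lam mu : YoungDiagram}
    (hle : mu ≤ lam) : ffSchur a 0 x y lam mu = frobeniusSchur x y a lam mu := by
  rw [ffSchur_eq_minor_coeffMatrix a x y (colLen_le_of_le hle) le_rfl, frobeniusSchur, minor,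
    ← Matrix.det_transpose]
  congr 1
  ext i j
  rw [Matrix.transpose_apply, Matrix.of_apply, Matrix.of_apply, coeffMatrix_eq_frobeniusH]
  simp only [particles]
  congr 1
  ring

end GeneratingFunctions

section PartialFractions

open Polynomial

variable {K : Type*} [Field K] {n : ℕ}

theorem natDegree_prod_X_sub_C_le {ι : Type*} (s : Finset ι) (c : ι → K) :
    (∏ i ∈ s, (X - C (c i))).natDegree ≤ s.card := by
  simp

theorem reflect_prod_X_sub_C {ι : Type*} (s : Finset ι) (c : ι → K) :
    reflect s.card (∏ i ∈ s, (X - C (c i))) = ∏ i ∈ s, (1 - C (c i) * X) := by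
  classical
  induction s using Finset.induction_on with
  | empty => simp
  | insert i s hi ih =>
    rw [Finset.card_insert_of_notMem hi, Finset.prod_insert hi, Finset.prod_insert hi, add_comm,
      reflect_mul _ _ (by simp) (natDegree_prod_X_sub_C_le s c), ih, reflect_sub, reflect_one_X,
      reflect_C, pow_one]

/-- The barycentric weights of the nodes `x`. -/
noncomputable def nodeWeight (x : Fin n → K) (s : Fin n) : K :=
  ∏ t ∈ Finset.univ.erase s, (x s - x t)⁻¹

/-- Lagrange interpolation of `X ^ m`, reversed. -/
theorem sum_nodeWeight_mul_prod {x : Fin n → K} (hx : Function.Injective x) {m : ℕ} (hm : m < n) :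
    ∑ s, C (nodeWeight x s * x s ^ m) * ∏ t ∈ Finset.univ.erase s, (1 - C (x t) * X) =
      X ^ (n - 1 - m) := by
  have hcard : ∀ s : Fin n, (Finset.univ.erase s).card = n - 1 := fun s => by
    rw [Finset.card_erase_of_mem (Finset.mem_univ s), Finset.card_univ, Fintype.card_fin]
  have h1 : (X : K[X]) ^ m = ∑ s, C (nodeWeight x s * x s ^ m) *
      ∏ t ∈ Finset.univ.erase s, (X - C (x t)) := by
    have h := Lagrange.eq_interpolate (s := Finset.univ) (v := x) (f := (X : K[X]) ^ m)
      hx.injOn (by rw [degree_X_pow, Finset.card_univ, Fintype.card_fin]; exact_mod_cast hm)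
    rw [Lagrange.interpolate_apply] at h
    rw [h]
    refine Finset.sum_congr rfl fun s _ => ?_
    simp only [eval_pow, eval_X, Lagrange.basis, Lagrange.basisDivisor, Finset.prod_mul_distrib,
      nodeWeight, map_mul, map_prod]
    ring
  have h2 := congrArg (reflect (n - 1)) h1
  rw [reflect_monomial, revAt_le (by omega)] at h2
  rw [h2]
  ext k
  rw [coeff_reflect, finsetSum_coeff, finsetSum_coeff]
  refine Finset.sum_congr rfl fun s _ => ?_
  rw [← reflect_prod_X_sub_C, hcard, ← reflect_C_mul, coeff_reflect]

theorem sum_nodeWeight_mul_eval {x : Fin n → K} (hx : Function.Injective x) {P : K[X]}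
    (hP : P.natDegree + 1 < n) : ∑ s, nodeWeight x s * P.eval (x s) = 0 := by
  have h := Lagrange.coeff_eq_sum (s := Finset.univ) (v := x) (P := P) hx.injOn (by
    rw [Finset.card_univ, Fintype.card_fin]
    refine lt_of_le_of_lt degree_le_natDegree ?_
    exact_mod_cast by omega)
  rw [Finset.card_univ, Fintype.card_fin, coeff_eq_zero_of_natDegree_lt (by omega)] at h
  rw [h]
  refine Finset.sum_congr rfl fun s _ => ?_
  rw [nodeWeight, Finset.prod_inv_distrib]
  ring

end PartialFractions

section PowerSeriesFractions

open PowerSeries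

variable {K : Type*} [Field K] {n : ℕ}

theorem sum_nodeWeight_mul_inv {x : Fin n → K} (hx : Function.Injective x) (hn : 0 < n) :
    ∑ s, C (nodeWeight x s) * (1 - C (x s) * X : K⟦X⟧)⁻¹ =
      X ^ (n - 1) * (∏ s, (1 - C (x s) * X))⁻¹ := by
  have h := congrArg (Polynomial.coeToPowerSeries.ringHom (R := K))
    (sum_nodeWeight_mul_prod hx hn)
  simp only [pow_zero, mul_one, tsub_zero, map_sum, map_mul, map_prod, map_sub, map_one, map_pow,
    Polynomial.coeToPowerSeries.ringHom_apply, Polynomial.coe_C, Polynomial.coe_X] at h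
  rw [← h, Finset.sum_mul]
  refine Finset.sum_congr rfl fun s _ => ?_
  have h1 : (∏ t ∈ Finset.univ.erase s, (1 - C (x t) * X : K⟦X⟧)) *
      (∏ t ∈ Finset.univ.erase s, (1 - C (x t) * X))⁻¹ = 1 :=
    PowerSeries.mul_inv_cancel _ (by simp)
  rw [← Finset.mul_prod_erase Finset.univ (fun t => (1 - C (x t) * X : K⟦X⟧)) (Finset.mem_univ s),
    PowerSeries.mul_inv_rev]
  linear_combination (-(C (nodeWeight x s)) * (1 - C (x s) * X : K⟦X⟧)⁻¹) * h1

theorem coeff_multiset_prod_eq_zero (S : Multiset K) {k : ℕ} (h : Multiset.card S < k) :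
    coeff k (S.map fun c => (1 - C c * X : K⟦X⟧)).prod = 0 := by
  induction S using Multiset.induction generalizing k with
  | empty =>
    rw [Multiset.map_zero, Multiset.prod_zero, coeff_one, if_neg (by simp at h; omega)]
  | cons c S ih =>
    rw [Multiset.card_cons] at h
    obtain ⟨k, rfl⟩ := Nat.exists_eq_succ_of_ne_zero (by omega : k ≠ 0)
    rw [Multiset.map_cons, Multiset.prod_cons, mul_comm, Nat.succ_eq_add_one,
      coeff_succ_one_sub_mul, ih (by omega), ih (by omega), mul_zero, sub_zero]

theorem coeff_multiset_prod_mul_inv (S : Multiset K) (x : K) :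
    coeff (Multiset.card S) ((S.map fun c => (1 - C c * X : K⟦X⟧)).prod * (1 - C x * X)⁻¹) =
      (S.map fun c => x - c).prod := by
  induction S using Multiset.induction with
  | empty => simp
  | cons c S ih =>
    rw [Multiset.card_cons, Multiset.map_cons, Multiset.prod_cons, Multiset.map_cons,
      Multiset.prod_cons, ← ih, mul_comm (1 - C c * X), mul_right_comm, coeff_succ_one_sub_mul]
    have h := coeff_succ_one_sub_mul x
      ((S.map fun c => (1 - C c * X : K⟦X⟧)).prod * (1 - C x * X)⁻¹) (Multiset.card S)
    rw [mul_assoc, mul_comm (1 - C x * X : K⟦X⟧)⁻¹, one_sub_mul_inv, mul_one,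
      coeff_multiset_prod_eq_zero S (Nat.lt_succ_self _)] at h
    linear_combination -h

theorem sum_nodeWeight_mul_multiset_prod {x : Fin n → K} (hx : Function.Injective x) (hn : 0 < n)
    (S : Multiset K) :
    ∑ s, nodeWeight x s * (S.map fun c => x s - c).prod = coeff (Multiset.card S)
      (X ^ (n - 1) * ((S.map fun c => (1 - C c * X : K⟦X⟧)).prod *
        (∏ s, (1 - C (x s) * X))⁻¹)) := by
  rw [mul_left_comm, ← sum_nodeWeight_mul_inv hx hn, Finset.mul_sum, map_sum]
  refine Finset.sum_congr rfl fun s _ => ?_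
  rw [mul_left_comm, coeff_C_mul, coeff_multiset_prod_mul_inv]

end PowerSeriesFractions

section DoubleSchur

variable {K : Type*} [Field K] {n : ℕ}

/-- If the minors with rows `(0, -1, …, 1 - n)` factor through `n` points, they are ratios of
alternants. -/
theorem minor_eq_mul_det_div_det (A : IncidenceAlgebra K ℤ) (B : Fin n → Fin n → K)
    (φ : K → ℕ → K) (x : Fin n → K)
    (hA : ∀ (i : Fin n) (r : ℕ), A (-(i : ℤ)) ((r : ℤ) + 1 - n) = ∑ s, B i s * φ (x s) r)
    (hne : minor A (particles n ⊥) (particles n ⊥) ≠ 0) (lam : YoungDiagram) :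
    minor A (particles n ⊥) (particles n lam) = minor A (particles n ⊥) (particles n ⊥) *
      ((Matrix.of fun i j : Fin n => φ (x i) (lam.rowLen j + (n - 1 - j))).det /
        (Matrix.of fun i j : Fin n => φ (x i) (n - 1 - j)).det) := by
  have key : ∀ v : YoungDiagram, minor A (particles n ⊥) (particles n v) =
      (Matrix.of B).det * (Matrix.of fun i j : Fin n => φ (x i) (v.rowLen j + (n - 1 - j))).det := by
    intro v
    rw [← Matrix.det_mul, minor]
    congr 1
    ext i j
    rw [Matrix.mul_apply, Matrix.of_apply, particles_bot]
    have : particles n v j = ((v.rowLen j + (n - 1 - j) : ℕ) : ℤ) + 1 - n := by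
      simp only [particles]
      omega
    rw [this, hA]
    rfl
  have hbot : ∀ j, (⊥ : YoungDiagram).rowLen j = 0 := fun j => by
    by_contra h
    exact YoungDiagram.notMem_bot _ (YoungDiagram.mem_iff_lt_rowLen.mpr (Nat.pos_of_ne_zero h))
  have h0 := key ⊥
  simp only [hbot, zero_add] at h0
  rw [h0] at hne ⊢
  rw [key lam]
  have := right_ne_zero_of_mul hne
  field_simp

theorem coeffMatrix_eq_sum_nodeWeight {x : Fin n → K} (hx : Function.Injective x) (a : ℤ → K)
    (i : Fin n) (r : ℕ) :
    coeffMatrix a (genFun x fun i => dualSeq a ((i : ℤ) + 1)) (-(i : ℤ)) ((r : ℤ) + 1 - n) =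
      ∑ s, (nodeWeight x s * ∏ m ∈ Finset.Ioc (-(i : ℤ)) 0, (x s - a m)) *
        doublePow n (-dualSeq a) (x s) r := by
  have hi := i.2
  have hn : 0 < n := by omega
  have hdp : ∀ s, doublePow n (-dualSeq a) (x s) r =
      ∏ m ∈ Finset.Ioc (-(n : ℤ)) ((r : ℤ) - n), (x s - a m) := by
    intro s
    refine Finset.prod_nbij (fun t : ℕ => (t : ℤ) + 1 - n) ?_ ?_ ?_ ?_
    · intro t ht
      simp only [Finset.mem_range, Finset.mem_Ioc] at ht ⊢
      omega
    · intro t _ t' _ h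
      simpa using h
    · intro m hm
      simp only [Finset.coe_Ioc, Set.mem_Ioc, Finset.coe_range, Set.mem_image, Set.mem_Iio] at hm ⊢
      exact ⟨(m - 1 + n).toNat, by omega, by omega⟩
    · intro t _
      simp only [Pi.neg_apply, dualSeq, neg_neg]
      congr 2
      ring
  simp only [hdp, mul_assoc]
  by_cases h : -(i : ℤ) < (r : ℤ) + 1 - n
  · have hgen : ∏ i : Fin n, (1 + PowerSeries.C (dualSeq a ((i : ℤ) + 1)) * PowerSeries.X) =
        ∏ m ∈ Finset.Ioc (-(n : ℤ)) 0, (1 - PowerSeries.C (a m) * PowerSeries.X) := by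
      rw [Fin.prod_univ_eq_prod_range
        (fun i => 1 + PowerSeries.C (dualSeq a ((i : ℤ) + 1)) * PowerSeries.X) n]
      have := prod_Ioc_neg n 0 fun m => (1 - PowerSeries.C (a m) * PowerSeries.X)
      rw [Finset.range_zero, Finset.prod_empty, mul_one] at this
      rw [Nat.cast_zero] at this
      rw [this]
      refine Finset.prod_congr rfl fun t _ => ?_
      rw [dualSeq, show -((t : ℤ) + 1) + 1 = -(t : ℤ) by ring, map_neg]
      ring
    have hS := sum_nodeWeight_mul_multiset_prod hx hn
      ((Finset.Ioo (-(i : ℤ)) ((r : ℤ) + 1 - n)).val.map a +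
        (Finset.Ioc (-(n : ℤ)) 0).val.map a)
    have hc : Multiset.card ((Finset.Ioo (-(i : ℤ)) ((r : ℤ) + 1 - n)).val.map a +
        (Finset.Ioc (-(n : ℤ)) 0).val.map a) = ((r : ℤ) + 1 - n - -(i : ℤ)).toNat + (n - 1) := by
      simp only [Multiset.card_add, Multiset.card_map, Finset.card_val, Int.card_Ioo, Int.card_Ioc]
      omega
    rw [hc, PowerSeries.coeff_X_pow_mul] at hS
    simp only [Multiset.map_add, Multiset.prod_add, Multiset.map_map, Function.comp_def] at hS
    rw [coeffMatrix_apply a _ h.le, genFun, hgen, ← mul_assoc]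
    refine hS.symm.trans (Finset.sum_congr rfl fun s _ => ?_)
    congr 1
    change (∏ m ∈ Finset.Ioo (-(i : ℤ)) ((r : ℤ) + 1 - n), (x s - a m)) *
      (∏ m ∈ Finset.Ioc (-(n : ℤ)) 0, (x s - a m)) = _
    have e : Finset.Ioo (-(i : ℤ)) ((r : ℤ) + 1 - n) = Finset.Ioc (-(i : ℤ)) ((r : ℤ) - n) := by
      ext k; simp only [Finset.mem_Ioo, Finset.mem_Ioc]; omega
    rw [e, ← prod_Ioc_mul_prod_Ioc (c := -(n : ℤ)) (d := -(i : ℤ)) (e := 0) (by omega) (by omega),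
      ← prod_Ioc_mul_prod_Ioc (c := -(n : ℤ)) (d := -(i : ℤ)) (e := (r : ℤ) - n)
        (by omega) (by omega)]
    ring
  · have hS := sum_nodeWeight_mul_multiset_prod hx hn
      ((Finset.Ioc (-(i : ℤ)) 0).val.map a + (Finset.Ioc (-(n : ℤ)) ((r : ℤ) - n)).val.map a)
    have hc : Multiset.card ((Finset.Ioc (-(i : ℤ)) 0).val.map a +
        (Finset.Ioc (-(n : ℤ)) ((r : ℤ) - n)).val.map a) = i + r := by
      simp only [Multiset.card_add, Multiset.card_map, Finset.card_val, Int.card_Ioc]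
      omega
    rw [hc] at hS
    simp only [Multiset.map_add, Multiset.prod_add, Multiset.map_map, Function.comp_def] at hS
    refine Eq.trans ?_ hS.symm
    rw [PowerSeries.coeff_X_pow_mul']
    rcases (not_lt.mp h).eq_or_lt with h' | h'
    · have : (i : ℕ) + r = n - 1 := by omega
      rw [h', coeffMatrix_apply a _ le_rfl, if_pos (by omega), this, Nat.sub_self, sub_self,
        Int.toNat_zero, Finset.Ioo_self, Finset.prod_empty, one_mul]
      simp [genFun]
    · rw [if_neg (by omega), IncidenceAlgebra.apply_eq_zero_of_not_le (not_le.mpr h')]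

end DoubleSchur

section DoubleSchur

variable {K : Type*} [Field K] {n : ℕ}

theorem mem_firstColumn {lam : YoungDiagram} {i : ℕ} (h : i < lam.colLen 0) :
    (i, 0) ∈ lam.cells \ (⊥ : YoungDiagram).cells := by
  rw [Finset.mem_sdiff, YoungDiagram.mem_cells, YoungDiagram.mem_cells]
  exact ⟨YoungDiagram.mem_iff_lt_colLen.mpr h, YoungDiagram.notMem_bot _⟩

theorem skewDoubleSchur_eq_zero (x : Fin n → K) (a : ℤ → K) {lam : YoungDiagram}
    (h : n < lam.colLen 0) : skewDoubleSchur x (-dualSeq a) lam ⊥ = 0 := by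
  classical
  rw [skewDoubleSchur_eq_factorialSuperSchur]
  refine Finset.sum_eq_zero fun T hT => ?_
  have hT := (Finset.mem_filter.mp hT).2
  by_contra hne
  have hfac := Finset.prod_ne_zero_iff.mp hne
  have hup : ∀ (i : ℕ) (hi : i < lam.colLen 0),
      i ≤ ((ofLex (T ⟨(i, 0), mem_firstColumn hi⟩)).1 : ℕ) →
      i < ((ofLex (T ⟨(i, 0), mem_firstColumn hi⟩)).1 : ℕ) ∨
        (i = ((ofLex (T ⟨(i, 0), mem_firstColumn hi⟩)).1 : ℕ) ∧
          (ofLex (T ⟨(i, 0), mem_firstColumn hi⟩)).2 = true) := by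
    intro i hi hle
    refine hle.lt_or_eq.imp_right fun heq => ⟨heq, ?_⟩
    by_contra h2
    refine hfac ⟨(i, 0), mem_firstColumn hi⟩ (Finset.mem_univ _) ?_
    rw [if_neg h2]
    simp only [content, Pi.neg_apply, dualSeq, ← heq]
    ring_nf
  have key : ∀ (i : ℕ) (hi : i < lam.colLen 0),
      i ≤ ((ofLex (T ⟨(i, 0), mem_firstColumn hi⟩)).1 : ℕ) := by
    intro i hi
    induction i with
    | zero => exact Nat.zero_le _
    | succ i ih =>
      have hi' : i < lam.colLen 0 := by omega
      obtain ⟨hle, hp⟩ := hT.2 ⟨(i, 0), mem_firstColumn hi'⟩ ⟨(i + 1, 0), mem_firstColumn hi⟩ rfl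
        (Nat.lt_succ_self i)
      have h1 := hup i hi' (ih hi')
      generalize T ⟨(i, 0), mem_firstColumn hi'⟩ = s at *
      generalize T ⟨(i + 1, 0), mem_firstColumn hi⟩ = t at *
      rcases hle.eq_or_lt with rfl | hlt
      · rw [hp rfl] at h1
        simp only [Bool.false_eq_true, and_false, or_false] at h1
        exact h1
      · rcases Prod.Lex.lt_iff.mp hlt with h2 | ⟨h2, h3⟩
        · have : ((ofLex s).1 : ℕ) < (ofLex t).1 := h2
          omega
        · rw [← h2]
          rcases h1 with h1 | ⟨_, h1⟩
          · exact h1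
          · rw [h1] at h3
            exact absurd h3 (by simp)
  have := key n h
  omega

theorem ffSchur_eq_doubleSchur {x : Fin n → K} (hx : Function.Injective x) (a : ℤ → K)
    (lam : YoungDiagram) : ffSchur a 0 x (fun i => dualSeq a ((i : ℤ) + 1)) lam ⊥ =
      doubleSchur x (-dualSeq a) lam := by
  unfold doubleSchur
  split_ifs with h
  · have hone : minor (coeffMatrix a (genFun x fun i => dualSeq a ((i : ℤ) + 1)))
        (particles n ⊥) (particles n ⊥) = 1 := by
      rw [minor_self _ _ (particles_strictAnti n ⊥)]
      refine Finset.prod_eq_one fun i _ => ?_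
      rw [coeffMatrix_apply a _ le_rfl, sub_self]
      simp [genFun]
    rw [ffSchur_eq_minor_coeffMatrix a x _ ((colLen_le_of_le bot_le).trans h) h,
      minor_eq_mul_det_div_det _ _ _ x (coeffMatrix_eq_sum_nodeWeight hx a)
        (by rw [hone]; exact one_ne_zero), hone, one_mul]
  · rw [ffSchur_eq_factorialSuperSchur _ _ _ bot_le, ← skewDoubleSchur_eq_factorialSuperSchur,
      skewDoubleSchur_eq_zero x a (not_le.mp h)]

end DoubleSchur

section DualRows

open Polynomial

variable {K : Type*} [Field K] {n : ℕ} {b : ℤ → K}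

theorem pathWeight_dual_apply (b : ℤ → K) (x : K) {p q : ℤ} (h : p ≤ q) :
    pathWeight 0 b x 0 p q = x ^ (q - p).toNat / ∏ k ∈ Finset.Icc p q, (1 - b k * x) := by
  rcases h.eq_or_lt with rfl | h
  · simp [pathWeight_self]
  · have e : (q - p).toNat = (q - p - 1).toNat + 1 := by omega
    rw [pathWeight_of_lt h, e, pow_succ']
    simp

theorem pathWeight_dual_succ (b : ℤ → K) (x : K) {p q : ℤ} (h : p ≤ q) :
    pathWeight 0 b x 0 p (q + 1) = pathWeight 0 b x 0 p q * (x / (1 - b (q + 1) * x)) := by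
  have e : (q + 1 - p).toNat = (q - p).toNat + 1 := by omega
  rw [pathWeight_dual_apply b x h, pathWeight_dual_apply b x (by omega), div_mul_div_comm, e,
    pow_succ, ← mul_prod_Ioc (by omega : p ≤ q + 1), prod_Ioc_add_one h, ← mul_assoc,
    mul_prod_Ioc h fun k => 1 - b k * x]

theorem pathWeight_dual_pred (b : ℤ → K) (x : K) {p q : ℤ} (h : p < q) :
    pathWeight 0 b x 0 p q = x / (1 - b p * x) * pathWeight 0 b x 0 (p + 1) q := by
  have e : (q - p).toNat = (q - (p + 1)).toNat + 1 := by omega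
  have e' : Finset.Icc (p + 1) q = Finset.Ioc p q := by
    ext k; simp only [Finset.mem_Icc, Finset.mem_Ioc]; omega
  rw [pathWeight_dual_apply b x h.le, pathWeight_dual_apply b x (by omega), div_mul_div_comm, e,
    pow_succ', ← mul_prod_Ioc h.le, e']

/-- The bidiagonal matrix of the shift plus multiplication by `b`. -/
noncomputable def shiftMatrix (b : ℤ → K) : IncidenceAlgebra K ℤ where
  toFun p q := if p = q then b p else if p + 1 = q then 1 else 0
  eq_zero_of_not_le' p q h := by rw [if_neg (by omega), if_neg (by omega)]

theorem shiftMatrix_mul_apply (b : ℤ → K) (A : IncidenceAlgebra K ℤ) {p q : ℤ} (h : p ≤ q) :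
    (shiftMatrix b * A) p q = b p * A p q + A (p + 1) q := by
  have hs : ∀ r, shiftMatrix b p r = if p = r then b p else if p + 1 = r then 1 else 0 :=
    fun _ => rfl
  rw [IncidenceAlgebra.mul_apply]
  rcases h.eq_or_lt with rfl | h
  · rw [Finset.Icc_self, Finset.sum_singleton, hs, if_pos rfl,
      IncidenceAlgebra.apply_eq_zero_of_not_le (by omega : ¬ p + 1 ≤ p), add_zero]
  · rw [← Finset.sum_subset (s₁ := {p, p + 1}), Finset.sum_pair (by omega), hs, hs, if_pos rfl,
      if_neg (by omega), if_pos rfl, one_mul]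
    · intro r hr
      simp only [Finset.mem_insert, Finset.mem_singleton] at hr
      rw [Finset.mem_Icc]
      omega
    · intro r _ hr
      simp only [Finset.mem_insert, Finset.mem_singleton] at hr
      rw [hs, if_neg (by omega), if_neg (by omega), zero_mul]

theorem mul_shiftMatrix_apply (b : ℤ → K) (A : IncidenceAlgebra K ℤ) {p q : ℤ} (h : p ≤ q) :
    (A * shiftMatrix b) p q = A p q * b q + A p (q - 1) := by
  have hs : ∀ r, shiftMatrix b r q = if r = q then b r else if r + 1 = q then 1 else 0 :=
    fun _ => rfl
  rw [IncidenceAlgebra.mul_apply]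
  rcases h.eq_or_lt with rfl | h
  · rw [Finset.Icc_self, Finset.sum_singleton, hs, if_pos rfl,
      IncidenceAlgebra.apply_eq_zero_of_not_le (by omega : ¬ p ≤ p - 1), add_zero]
  · rw [← Finset.sum_subset (s₁ := {q, q - 1}), Finset.sum_pair (by omega), hs, hs, if_pos rfl,
      if_neg (by omega), if_pos (by omega), mul_one]
    · intro r hr
      simp only [Finset.mem_insert, Finset.mem_singleton] at hr
      rw [Finset.mem_Icc]
      omega
    · intro r _ hr
      simp only [Finset.mem_insert, Finset.mem_singleton] at hr
      rw [hs, if_neg (by omega), if_neg (by omega), mul_zero]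

theorem one_sub_smul_shiftMatrix_mul {x : K} (hb : ∀ k, 1 - b k * x ≠ 0) :
    (1 - x • shiftMatrix b) * pathWeight 0 b x 0 = 1 := by
  ext p q h
  rw [sub_mul, one_mul, smul_mul_assoc, IncidenceAlgebra.sub_apply,
    IncidenceAlgebra.constSMul_apply, shiftMatrix_mul_apply b _ h, IncidenceAlgebra.one_apply,
    smul_eq_mul]
  have := hb p
  rcases h.eq_or_lt with rfl | h
  · rw [if_pos rfl, IncidenceAlgebra.apply_eq_zero_of_not_le (by omega : ¬ p + 1 ≤ p),
      pathWeight_self]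
    simp only [mul_zero, add_zero]
    field_simp
  · rw [if_neg h.ne, pathWeight_dual_pred b x h]
    linear_combination (x * pathWeight 0 b x 0 (p + 1) q) * mul_inv_cancel₀ this

theorem mul_one_sub_smul_shiftMatrix {x : K} (hb : ∀ k, 1 - b k * x ≠ 0) :
    pathWeight 0 b x 0 * (1 - x • shiftMatrix b) = 1 := by
  ext p q h
  rw [mul_sub, mul_one, mul_smul_comm, IncidenceAlgebra.sub_apply,
    IncidenceAlgebra.constSMul_apply, mul_shiftMatrix_apply b _ h, IncidenceAlgebra.one_apply,
    smul_eq_mul]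
  have := hb q
  rcases h.eq_or_lt with rfl | h
  · rw [if_pos rfl, IncidenceAlgebra.apply_eq_zero_of_not_le (by omega : ¬ p ≤ p - 1),
      pathWeight_self]
    simp only [mul_zero, add_zero]
    field_simp
  · obtain ⟨r, rfl⟩ : ∃ r, q = r + 1 := ⟨q - 1, by ring⟩
    rw [if_neg h.ne, pathWeight_dual_succ b x (by omega), add_sub_cancel_right]
    linear_combination (x * pathWeight 0 b x 0 p r) * mul_inv_cancel₀ this

theorem aeval_one_sub_C_mul_X (x : K) :
    aeval (shiftMatrix b) (1 - C x * X) = 1 - x • shiftMatrix b := by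
  rw [map_sub, map_one, map_mul, aeval_C, aeval_X, Algebra.smul_def]

theorem aeval_prod_mul_prod (l : List K) (hb : ∀ z ∈ l, ∀ k, 1 - b k * z ≠ 0) :
    aeval (shiftMatrix b) (l.map fun z => 1 - C z * X).prod *
      (l.map fun z => pathWeight 0 b z 0).prod = 1 := by
  induction l with
  | nil => simp
  | cons z l ih =>
    rw [List.map_cons, List.prod_cons, List.map_cons, List.prod_cons, mul_comm (1 - C z * X),
      map_mul, aeval_one_sub_C_mul_X, mul_assoc, ← mul_assoc (1 - z • shiftMatrix b),
      one_sub_smul_shiftMatrix_mul (hb z List.mem_cons_self), one_mul,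
      ih fun r hr => hb r (List.mem_cons_of_mem _ hr)]

theorem prod_mul_aeval_prod (l : List K) (hb : ∀ z ∈ l, ∀ k, 1 - b k * z ≠ 0) :
    (l.map fun z => pathWeight 0 b z 0).prod *
      aeval (shiftMatrix b) (l.map fun z => 1 - C z * X).prod = 1 := by
  induction l with
  | nil => simp
  | cons z l ih =>
    rw [List.map_cons, List.prod_cons, List.map_cons, List.prod_cons, mul_comm (1 - C z * X),
      map_mul, aeval_one_sub_C_mul_X, mul_assoc, ← mul_assoc _ _ (1 - z • shiftMatrix b),
      ih fun r hr => hb r (List.mem_cons_of_mem _ hr), one_mul,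
      mul_one_sub_smul_shiftMatrix (hb z List.mem_cons_self)]

/-- The rows commute. -/
theorem prod_pathWeight_perm {l l' : List K} (h : l.Perm l')
    (hb : ∀ z ∈ l, ∀ k, 1 - b k * z ≠ 0) :
    (l.map fun z => pathWeight 0 b z 0).prod = (l'.map fun z => pathWeight 0 b z 0).prod := by
  refine left_inv_eq_right_inv (prod_mul_aeval_prod l hb) ?_
  rw [(h.map _).prod_eq]
  exact aeval_prod_mul_prod l' fun z hz => hb z (h.mem_iff.mpr hz)

/-- The product of the rows of variables `x`, expanded in partial fractions. -/
theorem prod_pathWeight_eq_sum {x : Fin n → K} (hx : Function.Injective x) (hn : 0 < n)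
    (hb : ∀ (k : ℤ) (i : Fin n), 1 - b k * x i ≠ 0) :
    (List.ofFn fun i => pathWeight 0 b (x i) 0).prod =
      ∑ s, (nodeWeight x s * x s ^ (n - 1)) • pathWeight 0 b (x s) 0 := by
  set P := (List.ofFn fun i => pathWeight 0 b (x i) 0).prod with hP
  have h1 : aeval (shiftMatrix b) (∏ t, (1 - C (x t) * X)) * P = 1 := by
    have := aeval_prod_mul_prod (b := b) (List.ofFn x) (by
      intro z hz
      obtain ⟨i, rfl⟩ := List.mem_ofFn.mp hz
      exact fun k => hb k i)
    rw [List.map_ofFn, List.prod_ofFn, List.map_ofFn] at this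
    exact this
  have h2 : ∀ s, aeval (shiftMatrix b) (∏ t ∈ Finset.univ.erase s, (1 - C (x t) * X)) * P =
      pathWeight 0 b (x s) 0 := by
    intro s
    rw [← Finset.mul_prod_erase Finset.univ _ (Finset.mem_univ s), map_mul,
      aeval_one_sub_C_mul_X, mul_assoc] at h1
    exact (left_inv_eq_right_inv (mul_one_sub_smul_shiftMatrix fun k => hb k s) h1).symm
  have h3 := congrArg (aeval (shiftMatrix b)) (sum_nodeWeight_mul_prod hx (m := n - 1) (by omega))
  rw [Nat.sub_self, pow_zero, map_one, map_sum] at h3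
  rw [← one_mul P, ← h3, Finset.sum_mul]
  refine Finset.sum_congr rfl fun s _ => ?_
  rw [map_mul, aeval_C, ← Algebra.smul_def, smul_mul_assoc, h2]

theorem mul_apply_self (A B : IncidenceAlgebra K ℤ) (p : ℤ) : (A * B) p p = A p p * B p p := by
  rw [IncidenceAlgebra.mul_apply, Finset.Icc_self, Finset.sum_singleton]

theorem prod_pathWeight_apply_self (x : Fin n → K) (hb : ∀ (k : ℤ) (i : Fin n), 1 - b k * x i ≠ 0)
    (p : ℤ) : (∏ i, (1 - b p * x i)) * (List.ofFn fun i => pathWeight 0 b (x i) 0).prod p p = 1 := by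
  induction n with
  | zero => simp
  | succ n ih =>
    rw [Fin.prod_univ_succ, List.ofFn_succ, List.prod_cons, mul_apply_self, pathWeight_self]
    have h1 := ih (fun i => x i.succ) fun k i => hb k i.succ
    have h2 := hb p 0
    simp only [mul_zero, add_zero]
    field_simp
    exact h1

theorem ffSchur_dual_eq_minor (x : Fin n → K) (hb : ∀ (k : ℤ) (i : Fin n), 1 - b k * x i ≠ 0)
    {lam mu : YoungDiagram} {N : ℕ} (hmu : mu.colLen 0 ≤ N) (hlam : lam.colLen 0 ≤ N) :
    ffSchur 0 b x 0 lam mu = (∏ i, vacuumFactor b (x i) 0 N) *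
      minor (List.ofFn fun i => pathWeight 0 b (x i) 0).prod (particles N mu) (particles N lam) := by
  rw [ffSchur, rowProduct_eq_minor _ _ _ hmu hlam, List.map_ofFn, List.prod_ofFn, List.map_ofFn]
  · rfl
  · intro r hr
    obtain ⟨i, rfl⟩ := List.mem_ofFn.mp hr
    exact fun k => hb k i
  · intro r hr
    obtain ⟨i, rfl⟩ := List.mem_ofFn.mp hr
    simp

end DualRows

section DualSchur

variable {K : Type*} [Field K] {n : ℕ} {b : ℤ → K}

/-- The diagonal matrix with entries `f`. -/
noncomputable def diagMatrix (f : ℤ → K) : IncidenceAlgebra K ℤ where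
  toFun p q := if p = q then f p else 0
  eq_zero_of_not_le' p q h := if_neg (by omega)

theorem diagMatrix_mul_apply (f : ℤ → K) (A : IncidenceAlgebra K ℤ) {p q : ℤ} (h : p ≤ q) :
    (diagMatrix f * A) p q = f p * A p q := by
  have hs : ∀ r, diagMatrix f p r = if p = r then f p else 0 := fun _ => rfl
  rw [IncidenceAlgebra.mul_apply, Finset.sum_eq_single p]
  · rw [hs, if_pos rfl]
  · intro r _ hr
    rw [hs, if_neg hr.symm, zero_mul]
  · intro hp
    exact absurd (Finset.mem_Icc.mpr ⟨le_rfl, h⟩) hp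

theorem mul_diagMatrix_apply (f : ℤ → K) (A : IncidenceAlgebra K ℤ) {p q : ℤ} (h : p ≤ q) :
    (A * diagMatrix f) p q = A p q * f q := by
  have hs : ∀ r, diagMatrix f r q = if r = q then f r else 0 := fun _ => rfl
  rw [IncidenceAlgebra.mul_apply, Finset.sum_eq_single q]
  · rw [hs, if_pos rfl]
  · intro r _ hr
    rw [hs, if_neg hr, mul_zero]
  · intro hp
    exact absurd (Finset.mem_Icc.mpr ⟨h, le_rfl⟩) hp

theorem diagMatrix_one : diagMatrix (fun _ => (1 : K)) = 1 := by
  ext p q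
  rw [IncidenceAlgebra.one_apply]
  rfl

theorem minor_diagMatrix_mul (f : ℤ → K) (A : IncidenceAlgebra K ℤ) {N : ℕ} (p q : Fin N → ℤ) :
    minor (diagMatrix f * A) p q = (∏ i, f (p i)) * minor A p q := by
  rw [minor, minor, ← Matrix.det_mul_column]
  congr 1
  ext i j
  rw [Matrix.of_apply, Matrix.of_apply, Matrix.of_apply]
  by_cases h : p i ≤ q j
  · exact diagMatrix_mul_apply f A h
  · rw [IncidenceAlgebra.apply_eq_zero_of_not_le h, IncidenceAlgebra.apply_eq_zero_of_not_le h,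
      mul_zero]

theorem prod_reverse_telescope {R : Type*} [Monoid R] (D : ℕ → R) (H M : Fin n → R)
    (h : ∀ i : Fin n, H i * D i = D (i + 1) * M i) :
    ((List.finRange n).reverse.map H).prod * D 0 =
      D n * ((List.finRange n).reverse.map M).prod := by
  induction n with
  | zero => simp
  | succ n ih =>
    have hrev : (List.finRange (n + 1)).reverse =
        Fin.last n :: (List.finRange n).reverse.map Fin.castSucc := by
      rw [List.finRange_succ_last, List.reverse_append, List.reverse_singleton, List.map_reverse]
      rfl
    have h1 := ih (fun i => H i.castSucc) (fun i => M i.castSucc) fun i => h i.castSucc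
    have h2 := h (Fin.last n)
    rw [Fin.val_last] at h2
    rw [hrev, List.map_cons, List.prod_cons, List.map_cons, List.prod_cons, List.map_map,
      List.map_map, ← mul_assoc, ← h2, mul_assoc, mul_assoc]
    exact congrArg _ h1

/-- Partial products over the first `k` variables. -/
noncomputable def initialProd (b : ℤ → K) (x : Fin n → K) (k : ℕ) (c : ℤ) : K :=
  ∏ j ∈ Finset.univ.filter fun j : Fin n => (j : ℕ) < k, (1 - b c * x j)

theorem initialProd_succ (b : ℤ → K) (x : Fin n → K) (i : Fin n) (c : ℤ) :
    initialProd b x (i + 1) c = (1 - b c * x i) * initialProd b x i c := by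
  have : (Finset.univ.filter fun j : Fin n => (j : ℕ) < i + 1) =
      insert i (Finset.univ.filter fun j : Fin n => (j : ℕ) < i) := by
    ext j
    simp only [Finset.mem_filter, Finset.mem_univ, true_and, Finset.mem_insert, Fin.ext_iff]
    omega
  rw [initialProd, this, Finset.prod_insert (by simp)]
  rfl

theorem initialProd_zero (b : ℤ → K) (x : Fin n → K) (c : ℤ) : initialProd b x 0 c = 1 := by
  simp [initialProd]

theorem initialProd_card (b : ℤ → K) (x : Fin n → K) (c : ℤ) :
    initialProd b x n c = ∏ j, (1 - b c * x j) := by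
  rw [initialProd, Finset.filter_true_of_mem fun j _ => j.2]

theorem initialProd_ne_zero {x : Fin n → K} (hb : ∀ (k : ℤ) (i : Fin n), 1 - b k * x i ≠ 0)
    (k : ℕ) (c : ℤ) : initialProd b x k c ≠ 0 :=
  Finset.prod_ne_zero_iff.mpr fun j _ => hb c j

theorem dualFactor_eq (b : ℤ → K) (x : Fin n → K) (i : Fin n) (c d : ℤ) :
    dualFactor x i (b c) (b d) = x i * initialProd b x i c / initialProd b x (i + 1) d := by
  unfold dualFactor initialProd
  congr 2
  · congr 1
    ext j
    simp
  · ext j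
    simp only [Finset.mem_Iic, Finset.mem_filter, Finset.mem_univ, true_and, Fin.le_def]
    omega

/-- The matrix of a letter of dual tableaux is conjugate to the matrix of a row. -/
theorem horizontalMatrix_mul_diagMatrix {x : Fin n → K}
    (hb : ∀ (k : ℤ) (i : Fin n), 1 - b k * x i ≠ 0) (i : Fin n) :
    horizontalMatrix (fun c => dualFactor x i (b c) (b (c + 1))) *
        diagMatrix (initialProd b x i) =
      diagMatrix (initialProd b x (i + 1)) * pathWeight 0 b (x i) 0 := by
  ext p q h
  rw [mul_diagMatrix_apply _ _ h, diagMatrix_mul_apply _ _ h, horizontalMatrix_apply _ h]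
  induction q, h using Int.leInduction with
  | base =>
    have := hb p i
    rw [Finset.Ico_self, Finset.prod_empty, initialProd_succ, pathWeight_self]
    simp only [mul_zero, add_zero]
    field_simp
  | succ q h ih =>
    have e : ∏ c ∈ Finset.Ico p (q + 1), dualFactor x i (b c) (b (c + 1)) =
        (∏ c ∈ Finset.Ico p q, dualFactor x i (b c) (b (c + 1))) *
          dualFactor x i (b q) (b (q + 1)) := by
      have e2 : Finset.Ico q (q + 1) = {q} := by
        ext k; simp only [Finset.mem_Ico, Finset.mem_singleton]; omega
      rw [← prod_Ico_mul_prod_Ico h (by omega : q ≤ q + 1), e2, Finset.prod_singleton]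
    rw [e, pathWeight_dual_succ b _ h, ← mul_assoc, ← ih, dualFactor_eq, initialProd_succ b x i (q + 1)]
    have h1 := hb (q + 1) i
    have h2 := initialProd_ne_zero hb i (q + 1)
    field_simp

theorem skewDualSchur_eq_tableauSum (x : Fin n → K) (b : ℤ → K) (lam mu : YoungDiagram) :
    skewDualSchur x (-dualSeq b) lam mu =
      tableauSum (fun _ : (Fin n)ᵒᵈ => False)
        (fun t c => dualFactor x (OrderDual.ofDual t) (b c) (b (c + 1)))
        ((List.finRange n).reverse.map OrderDual.toDual) lam mu := by
  classical
  unfold skewDualSchur tableauSum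
  refine Finset.sum_equiv (Equiv.arrowCongr (Equiv.refl _) OrderDual.toDual) ?_ ?_
  · intro T
    rw [Finset.mem_filter, Finset.mem_filter]
    simp only [Finset.mem_univ, true_and, IsReverseTableau, IsSupertableau,
      List.mem_map, List.mem_reverse, List.mem_finRange, not_false_eq_true, implies_true, and_true]
    constructor
    · rintro ⟨h1, h2⟩
      refine ⟨⟨fun p q h h' => h1 p q h h', fun p q h h' => ⟨(h2 p q h h').le, fun he => ?_⟩⟩,
        fun p => ⟨_, rfl⟩⟩
      exact (h2 p q h h').ne he.symm
    · rintro ⟨⟨h1, h2⟩, _⟩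
      exact ⟨h1, fun p q h h' => lt_of_le_of_ne (h2 p q h h').1 fun he => (h2 p q h h').2 he.symm⟩
  · intro T _
    refine Finset.prod_congr rfl fun p _ => ?_
    have e1 : (-dualSeq b) (-content p + 1) = b (content p) := by
      simp only [Pi.neg_apply, dualSeq, neg_neg]
      congr 1
      ring
    have e2 : (-dualSeq b) (-content p) = b (content p + 1) := by
      simp only [Pi.neg_apply, dualSeq, neg_neg]
    rw [e1, e2]
    rfl

theorem skewDualSchur_eq_minor {x : Fin n → K} (hb : ∀ (k : ℤ) (i : Fin n), 1 - b k * x i ≠ 0)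
    {lam mu : YoungDiagram} (hle : mu ≤ lam) {N : ℕ} (hlam : lam.colLen 0 ≤ N) :
    skewDualSchur x (-dualSeq b) lam mu = (∏ j, ∏ i, (1 - b (particles N mu j) * x i)) *
      minor (List.ofFn fun i => pathWeight 0 b (x i) 0).prod
        (particles N mu) (particles N lam) := by
  have hsorted : ((List.finRange n).reverse.map OrderDual.toDual).Pairwise (· < ·) := by
    rw [List.pairwise_map, List.pairwise_reverse]
    exact List.pairwise_lt_finRange n
  have hprod := prod_reverse_telescope (fun k => diagMatrix (initialProd b x k)) _ _
    (horizontalMatrix_mul_diagMatrix hb)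
  have h0 : initialProd b x 0 = fun _ => 1 := funext (initialProd_zero b x)
  rw [h0, diagMatrix_one, mul_one] at hprod
  have hperm := prod_pathWeight_perm (b := b) (((List.reverse_perm (List.finRange n)).map x)) (by
    intro z hz
    obtain ⟨i, _, rfl⟩ := List.mem_map.mp hz
    exact fun k => hb k i)
  rw [List.map_map, List.map_map] at hperm
  rw [skewDualSchur_eq_tableauSum, tableauSum_eq_minor _ _ _ hsorted hle hlam, List.map_map]
  simp only [Function.comp_def, letterMatrix, if_false, OrderDual.ofDual_toDual] at hperm ⊢
  rw [hprod, hperm, minor_diagMatrix_mul, List.ofFn_eq_map]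
  simp only [initialProd_card]

theorem ffSchur_eq_mul_skewDualSchur {x : Fin n → K}
    (hb : ∀ (k : ℤ) (i : Fin n), 1 - b k * x i ≠ 0) {lam mu : YoungDiagram} (hle : mu ≤ lam) :
    ffSchur 0 b x 0 lam mu =
      ffSchur 0 b x 0 mu mu * skewDualSchur x (-dualSeq b) lam mu := by
  have hmu := colLen_le_of_le hle
  rw [ffSchur_dual_eq_minor x hb hmu le_rfl, ffSchur_dual_eq_minor x hb hmu hmu,
    skewDualSchur_eq_minor hb hle le_rfl, minor_self _ _ (particles_strictAnti _ mu)]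
  have : (∏ j, ∏ i, (1 - b (particles (lam.colLen 0) mu j) * x i)) *
      ∏ j, (List.ofFn fun i => pathWeight 0 b (x i) 0).prod (particles (lam.colLen 0) mu j)
        (particles (lam.colLen 0) mu j) = 1 := by
    rw [← Finset.prod_mul_distrib]
    exact Finset.prod_eq_one fun j _ => prod_pathWeight_apply_self x hb _
  linear_combination (-(∏ i, vacuumFactor b (x i) 0 (lam.colLen 0)) *
    minor (List.ofFn fun i => pathWeight 0 b (x i) 0).prod (particles (lam.colLen 0) mu)
      (particles (lam.colLen 0) lam)) * this

theorem skewDualSchur_eq_zero (x : Fin n → K) (a : ℤ → K) {lam : YoungDiagram}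
    (h : n < lam.colLen 0) : skewDualSchur x a lam ⊥ = 0 := by
  classical
  refine Finset.sum_eq_zero fun T hT => ?_
  have hT := (Finset.mem_filter.mp hT).2
  have key : ∀ (i : ℕ) (hi : i < lam.colLen 0),
      i + (T ⟨(i, 0), mem_firstColumn hi⟩ : ℕ) < n := by
    intro i hi
    induction i with
    | zero => rw [zero_add]; exact Fin.is_lt _
    | succ i ih =>
      have hi' : i < lam.colLen 0 := by omega
      have h1 : (T ⟨(i + 1, 0), mem_firstColumn hi⟩ : ℕ) < T ⟨(i, 0), mem_firstColumn hi'⟩ :=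
        hT.2 ⟨(i, 0), mem_firstColumn hi'⟩ ⟨(i + 1, 0), mem_firstColumn hi⟩ rfl
          (Nat.lt_succ_self i)
      have h2 := ih hi'
      omega
  have := key n h
  omega

theorem ffSchur_dual_bot_bot {x : Fin n → K} (hb : ∀ (k : ℤ) (i : Fin n), 1 - b k * x i ≠ 0)
    {N : ℕ} : (∏ i, vacuumFactor b (x i) 0 N) * minor
      (List.ofFn fun i => pathWeight 0 b (x i) 0).prod (particles N ⊥) (particles N ⊥) = 1 := by
  rw [minor_self _ _ (particles_strictAnti _ ⊥), particles_bot]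
  have : ∏ i, vacuumFactor b (x i) 0 N = ∏ j : Fin N, ∏ i, (1 - b (-(j : ℤ)) * x i) := by
    rw [Finset.prod_comm]
    refine Finset.prod_congr rfl fun i _ => ?_
    rw [vacuumFactor, Fin.prod_univ_eq_prod_range (fun j => 1 - b (-(j : ℤ)) * x i) N]
    simp
  rw [this, ← Finset.prod_mul_distrib]
  exact Finset.prod_eq_one fun j _ => prod_pathWeight_apply_self x hb _

theorem dualAlternantEntry_eq (n : ℕ) (b : ℤ → K) (z : K) (r : ℕ) :
    dualAlternantEntry n (-dualSeq b) z r =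
      z ^ r / (∏ k ∈ Finset.Ioc 0 (r : ℤ), (1 - b k * z)) *
        ∏ k ∈ Finset.Ioc ((r : ℤ) + 1 - n) r, (1 - b k * z) := by
  have h1 := prod_Ioc_neg 0 r fun k => 1 - b k * z
  rw [Finset.range_zero, Finset.prod_empty, one_mul, Nat.cast_zero, neg_zero] at h1
  have h2 : ∏ k ∈ Finset.Icc (1 - (r : ℤ)) ((n : ℤ) - r - 1), (1 - (-dualSeq b) k * z) =
      ∏ k ∈ Finset.Ioc ((r : ℤ) + 1 - n) r, (1 - b k * z) := by
    refine Finset.prod_nbij (fun k => 1 - k) ?_ ?_ ?_ ?_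
    · intro t ht
      simp only [Finset.mem_Icc, Finset.mem_Ioc] at ht ⊢
      omega
    · intro t _ t' _ h
      simpa using h
    · intro m hm
      simp only [Finset.coe_Ioc, Set.mem_Ioc, Finset.coe_Icc, Set.mem_image, Set.mem_Icc] at hm ⊢
      exact ⟨1 - m, by omega, by omega⟩
    · intro t _
      simp only [Pi.neg_apply, dualSeq, neg_neg]
      congr 3
      ring
  rw [dualAlternantEntry, h1, h2]
  simp only [Pi.neg_apply, dualSeq, neg_neg]

theorem prod_pathWeight_eq_sum_dualAlternantEntry {x : Fin n → K} (hx : Function.Injective x)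
    (hb : ∀ (k : ℤ) (i : Fin n), 1 - b k * x i ≠ 0) (i : Fin n) (r : ℕ) :
    (List.ofFn fun i => pathWeight 0 b (x i) 0).prod (-(i : ℤ)) ((r : ℤ) + 1 - n) =
      ∑ s, (nodeWeight x s * x s ^ (i : ℕ) /
          ∏ k ∈ Finset.Ioc (-(i : ℤ) - 1) 0, (1 - b k * x s)) *
        dualAlternantEntry n (-dualSeq b) (x s) r := by
  have hi := i.2
  have hn : 0 < n := by omega
  have hne : ∀ (s : Fin n) (u v : ℤ), ∏ k ∈ Finset.Ioc u v, (1 - b k * x s) ≠ 0 :=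
    fun s u v => Finset.prod_ne_zero_iff.mpr fun k _ => hb k s
  have hr : ∀ s, (nodeWeight x s * x s ^ (i : ℕ) /
        ∏ k ∈ Finset.Ioc (-(i : ℤ) - 1) 0, (1 - b k * x s)) *
        dualAlternantEntry n (-dualSeq b) (x s) r =
      nodeWeight x s * (x s ^ ((i : ℕ) + r) *
        (∏ k ∈ Finset.Ioc ((r : ℤ) + 1 - n) r, (1 - b k * x s)) /
        ∏ k ∈ Finset.Ioc (-(i : ℤ) - 1) r, (1 - b k * x s)) := by
    intro s
    rw [dualAlternantEntry_eq, ← prod_Ioc_mul_prod_Ioc (c := -(i : ℤ) - 1) (d := 0) (e := r)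
      (by omega) (by omega), pow_add]
    have h1 := hne s (-(i : ℤ) - 1) 0
    have h2 := hne s 0 r
    generalize ∏ k ∈ Finset.Ioc (-(i : ℤ) - 1) 0, (1 - b k * x s) = u at *
    generalize ∏ k ∈ Finset.Ioc 0 (r : ℤ), (1 - b k * x s) = v at *
    generalize ∏ k ∈ Finset.Ioc ((r : ℤ) + 1 - n) (r : ℤ), (1 - b k * x s) = w at *
    field_simp
  rw [Finset.sum_congr rfl fun s _ => hr s]
  by_cases h : -(i : ℤ) ≤ (r : ℤ) + 1 - n
  · rw [prod_pathWeight_eq_sum hx hn hb]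
    have happ : ∀ (S : Finset (Fin n)) (F : Fin n → IncidenceAlgebra K ℤ) (p q : ℤ),
        (∑ s ∈ S, F s) p q = ∑ s ∈ S, F s p q := by
      classical
      intro S F p q
      induction S using Finset.induction_on with
      | empty => rfl
      | insert s S hs ih =>
        rw [Finset.sum_insert hs, Finset.sum_insert hs, IncidenceAlgebra.add_apply, ih]
    rw [happ]
    refine Finset.sum_congr rfl fun s _ => ?_
    have e : Finset.Icc (-(i : ℤ)) ((r : ℤ) + 1 - n) =
        Finset.Ioc (-(i : ℤ) - 1) ((r : ℤ) + 1 - n) := by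
      ext k; simp only [Finset.mem_Icc, Finset.mem_Ioc]; omega
    have e' : (i : ℕ) + r = n - 1 + ((r : ℤ) + 1 - n - -(i : ℤ)).toNat := by omega
    rw [IncidenceAlgebra.constSMul_apply, pathWeight_dual_apply b _ h, e, smul_eq_mul, e', pow_add,
      ← prod_Ioc_mul_prod_Ioc (c := -(i : ℤ) - 1) (d := (r : ℤ) + 1 - n) (e := r)
      (by omega) (by omega)]
    have h1 := hne s (-(i : ℤ) - 1) ((r : ℤ) + 1 - n)
    have h2 := hne s ((r : ℤ) + 1 - n) r
    generalize ∏ k ∈ Finset.Ioc (-(i : ℤ) - 1) ((r : ℤ) + 1 - n), (1 - b k * x s) = u at *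
    generalize ∏ k ∈ Finset.Ioc ((r : ℤ) + 1 - n) (r : ℤ), (1 - b k * x s) = v at *
    field_simp
  · rw [IncidenceAlgebra.apply_eq_zero_of_not_le h]
    symm
    set Q : Polynomial K := ∏ k ∈ Finset.Ioc ((r : ℤ) + 1 - n) (-(i : ℤ) - 1),
      (1 - Polynomial.C (b k) * Polynomial.X) with hQ
    have hdeg : (Polynomial.X ^ ((i : ℕ) + r) * Q).natDegree + 1 < n := by
      have h1 : Q.natDegree ≤ (-(i : ℤ) - 1 - ((r : ℤ) + 1 - n)).toNat := by
        rw [← Int.card_Ioc, hQ]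
        refine (Polynomial.natDegree_prod_le _ _).trans ?_
        refine (Finset.sum_le_card_nsmul _ _ 1 fun k _ => ?_).trans (by simp)
        compute_degree
      have h2 := Polynomial.natDegree_mul_le (p := (Polynomial.X : Polynomial K) ^ ((i : ℕ) + r))
        (q := Q)
      rw [Polynomial.natDegree_X_pow] at h2
      omega
    rw [← sum_nodeWeight_mul_eval hx hdeg]
    refine Finset.sum_congr rfl fun s _ => ?_
    rw [Polynomial.eval_mul, Polynomial.eval_pow, Polynomial.eval_X, hQ, Polynomial.eval_prod,
      ← prod_Ioc_mul_prod_Ioc (c := (r : ℤ) + 1 - n) (d := -(i : ℤ) - 1) (e := r)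
      (by omega) (by omega), ← mul_assoc, mul_div_cancel_right₀ _ (hne s _ _)]
    simp

theorem ffSchur_eq_dualSchur {x : Fin n → K} (hx : Function.Injective x)
    (hb : ∀ (k : ℤ) (i : Fin n), 1 - b k * x i ≠ 0) (lam : YoungDiagram) :
    ffSchur 0 b x 0 lam ⊥ = dualSchur x (-dualSeq b) lam := by
  unfold dualSchur
  split_ifs with h
  · have hone := ffSchur_dual_bot_bot hb (N := n)
    rw [ffSchur_dual_eq_minor x hb ((colLen_le_of_le bot_le).trans h) h,
      minor_eq_mul_det_div_det _ _ _ x (prod_pathWeight_eq_sum_dualAlternantEntry hx hb)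
        (right_ne_zero_of_mul (by rw [hone]; exact one_ne_zero)), ← mul_assoc, hone, one_mul]
  · rw [ffSchur_eq_mul_skewDualSchur hb bot_le, skewDualSchur_eq_zero x _ (not_le.mp h), mul_zero]

end DualSchur

end FreeFermionic

theorem mainTheorem6 {K : Type*} [Field K] {n : ℕ} (x y : Fin n → K) (a b : ℤ → K)
    (lam mu : YoungDiagram) (hmu : mu ≤ lam) :
    -- classical Schur functions
    FreeFermionic.ffSchur 0 0 x 0 lam mu = FreeFermionic.schur x lam mu ∧
    -- supersymmetric Schur functions
    FreeFermionic.ffSchur 0 0 x y lam mu = FreeFermionic.superSchur x y lam mu ∧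
    -- factorial (double) Schur functions, skew and straight
    (FreeFermionic.ffSchur a 0 x (fun i => FreeFermionic.dualSeq a ((i : ℤ) + 1)) lam mu =
        FreeFermionic.skewDoubleSchur x (-FreeFermionic.dualSeq a) lam mu ∧
      (Function.Injective x →
        FreeFermionic.ffSchur a 0 x (fun i => FreeFermionic.dualSeq a ((i : ℤ) + 1)) lam ⊥ =
          FreeFermionic.doubleSchur x (-FreeFermionic.dualSeq a) lam)) ∧
    -- factorial supersymmetric Schur functions
    FreeFermionic.ffSchur a 0 x y lam mu =
        FreeFermionic.factorialSuperSchur x y (-FreeFermionic.dualSeq a) lam mu ∧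
    -- Frobenius–Schur functions
    FreeFermionic.ffSchur a 0 x y lam mu = FreeFermionic.frobeniusSchur x y a lam mu ∧
    -- dual Schur functions, skew and straight
    ((∀ (k : ℤ) (i : Fin n), 1 - b k * x i ≠ 0) →
      FreeFermionic.ffSchur 0 b x 0 lam mu =
          FreeFermionic.ffSchur 0 b x 0 mu mu *
            FreeFermionic.skewDualSchur x (-FreeFermionic.dualSeq b) lam mu ∧
      (Function.Injective x →
        FreeFermionic.ffSchur 0 b x 0 lam ⊥ =
          FreeFermionic.dualSchur x (-FreeFermionic.dualSeq b) lam)) := by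
  refine ⟨FreeFermionic.ffSchur_eq_schur x hmu, FreeFermionic.ffSchur_eq_superSchur x y hmu,
    ⟨?_, fun hx => FreeFermionic.ffSchur_eq_doubleSchur hx a lam⟩,
    FreeFermionic.ffSchur_eq_factorialSuperSchur x y a hmu,
    FreeFermionic.ffSchur_eq_frobeniusSchur a x y hmu,
    fun hb => ⟨FreeFermionic.ffSchur_eq_mul_skewDualSchur hb hmu,
      fun hx => FreeFermionic.ffSchur_eq_dualSchur hx hb lam⟩⟩
  rw [FreeFermionic.ffSchur_eq_factorialSuperSchur x _ a hmu,
    FreeFermionic.skewDoubleSchur_eq_factorialSuperSchur]
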